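/- Let $0<\nu\le 1$ and let $\lambda_k>0$, $k\ge 1$, be birth rates. For order $\alpha\in(0,2]$, $d^\alpha/dt^\alpha$ denotes the Dzherbashyan–Caputo derivative $\frac{1}{\Gamma(n-\alpha)}\int_0^t g^{(n)}(s)(t-s)^{n-\alpha-1}\,ds$, $n=\lceil\alpha\rceil$ (the ordinary derivative $g^{(n)}$ if $\alpha=n$), where $g$ is $C^{n-1}$ on $[0,\infty)$, $n$ times differentiable on $(0,\infty)$, and the integral converges absolutely for every $t>0$. Let $\mathcal N(s)$, $s\ge0$, be the classical birth process with $\mathcal N(0)=1$: it takes values in $\{1,2,\dots\}\cup\{\infty\}$, stays in state $k$ for an exponential time of parameter $\lambda_k$, the holding times being independent, then jumps to $k+1$, and equals $\infty$ from its explosion time on. A fractional birth process $\mathcal N_\nu$ is a family of $\mathbb N\cup\{\infty\}$-valued random variables $\mathcal N_\nu(t)$, $t\ge0$, whose state probabilities $p_k^\nu(t)=\Pr\{\mathcal N_\nu(t)=k\}$ satisfy $$\frac{d^\nu p_k}{dt^\nu}=-\lambda_kp_k+\lambda_{k-1}p_{k-1}\quad(k\ge1,\ t>0),\qquad p_0\equiv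 0,\qquad p_1(0)=1,\quad p_k(0)=0\ (k\ge2).$$ **Random time.** There is a unique family $u_{2\nu}(\cdot,t)$, $t\ge0$, of finite signed measures on $\mathbb R$ which is the fundamental solution of $$\frac{\partial^{2\nu}u}{\partial t^{2\nu}}=\frac{\partial^2u}{\partial s^2},\qquad u(s,0)=\delta(s),\qquad\text{and } u_t(s,0)=0\text{ if }\tfrac12<\nu\le1,$$ understood weakly in $s$: tested against smooth functions of $s$ that are bounded together with all derivatives. For $t>0$ the folded measure, equal to $2u_{2\nu}(ds,t)$ on $s>0$ and to $0$ on $s\le0$, is a probability law; call it the law of $T_{2\nu}(t)$, and put $T_{2\nu}(0)=0$. If $\nu<1$ it has a non-negative density $f_{T_{2\nu}}(s,t)$ on $s>0$, continuous on $(0,\infty)^2$, with $$\int_0^\infty e^{-\mu t}f_{T_{2\nu}}(s,t)\,dt=\mu^{\nu-1}e^{-s\mu^\nu},\qquad s>0,\ \mu>0 .$$ If $\nu=1$ then $T_2(t)=t$ almost surely. For all $0<\nu\le1$, $\int_0^\infty e^{-\mu t}\Pr\{T_{2\nu}(t)\in B\}\,dt=\int_B\mu^{\nu-1}e^{-s\mu^\nu}\,ds$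 for $\mu>0$ and Borel $B\subseteq(0,\infty)$. **State probabilities.** The above Cauchy problem for $(p_k)_{k\ge 0}$ has a unique solution $(p_k^\nu)$ on $[0,\infty)$. If the $\lambda_k$ are pairwise distinct, then for $k\ge1$ $$p_k^\nu(t)=\prod_{j=1}^{k-1}\lambda_j\sum_{m=1}^k\frac{E_{\nu,1}(-\lambda_mt^\nu)}{\prod_{l=1,\,l\ne m}^k(\lambda_l-\lambda_m)},\qquad E_{\nu,1}(x)=\sum_{h\ge0}\frac{x^h}{\Gamma(\nu h+1)} .$$ **Subordination.** For $k\ge1$ and $t>0$, $$p_k^\nu(t)=\int_0^\infty\Pr\{\mathcal N(s)=k\}\,\Pr\{T_{2\nu}(t)\in ds\}.$$ A birth process $\mathcal N$ and a random time process $T_{2\nu}(t)$, $t\ge0$, with the above one-dimensional laws, such that each $T_{2\nu}(t)$ is independent of the holding times of $\mathcal N$, exist on a common probability space. For all such $\mathcal N$ and $T_{2\nu}$, $t\mapsto\mathcal N(T_{2\nu}(t))$ is a fractional birth process, and every fractional birth process satisfies $\mathcal N_\nu(t)=\mathcal N(T_{2\nu}(t))$ in distribution, for each $t\ge0$. **Consequences.**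 $p_k^\nu(t)\ge0$ for all $k$ and $t\ge0$. Moreover $\sum_{k\ge1}p_k^\nu(t)=1$ for all $t>0$ if and only if $\sum_{k\ge1}1/\lambda_k=\infty$; equivalently, a fractional birth process is non-exploding, i.e. $\Pr\{\mathcal N_\nu(t)<\infty\}=1$ for all $t>0$, if and only if $\sum_{k\ge1}1/\lambda_k=\infty$. -/

import Mathlib

open MeasureTheory ProbabilityTheory Set

noncomputable section

/-- `h` is the Dzherbashyan-Caputo derivative of order `α > 0` of `g` on `(0, ∞)`.  With
`n = ⌈α⌉`, the function `g` is of class `C^(n-1)` on `[0, ∞)` and `n` times differentiable on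
`(0, ∞)`.  If `α = n`, the derivative is the ordinary one; otherwise it is
`1 / Γ(n - α) * ∫_0^t g^(n)(s) (t - s)^(n - α - 1) ds`, the integral being absolutely convergent.
For `0 < α < 1` this is `1 / Γ(1 - α) * ∫_0^t g'(s) (t - s)^(-α) ds`. -/
def HasCaputoDeriv (α : ℝ) (g h : ℝ → ℝ) : Prop :=
  ContDiffOn ℝ ((⌈α⌉₊ - 1 : ℕ) : WithTop ℕ∞) g (Ici 0) ∧
  DifferentiableOn ℝ (iteratedDeriv (⌈α⌉₊ - 1) g) (Ioi 0) ∧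
  ∀ t : ℝ, 0 < t →
    (α = (⌈α⌉₊ : ℝ) → h t = iteratedDeriv ⌈α⌉₊ g t) ∧
    (α ≠ (⌈α⌉₊ : ℝ) →
      IntegrableOn (fun s => iteratedDeriv ⌈α⌉₊ g s * (t - s) ^ ((⌈α⌉₊ : ℝ) - α - 1)) (Ioo 0 t) ∧
      h t = 1 / Real.Gamma ((⌈α⌉₊ : ℝ) - α) *
        ∫ s in Ioo 0 t, iteratedDeriv ⌈α⌉₊ g s * (t - s) ^ ((⌈α⌉₊ : ℝ) - α - 1))

/-- Test functions on the line: smooth, bounded together with all their derivatives. -/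
def IsTestFunction (φ : ℝ → ℝ) : Prop :=
  ContDiff ℝ (⊤ : ℕ∞) φ ∧ ∀ n : ℕ, ∃ C : ℝ, ∀ x : ℝ, |iteratedDeriv n φ x| ≤ C

/-- The fundamental solution of `∂^(2ν) u / ∂t^(2ν) = ∂² u / ∂s²`, the Caputo derivative being
taken in `t`, with `u(s, 0) = δ(s)` and, when `ν > 1/2`, also `u_t(s, 0) = 0`.
For `ν = 1` it is not a function, so `u t` is a (finite signed) measure on the line for every
time `t`, and the equation and the initial conditions hold weakly in the space variable. -/
structure IsFundamentalSolution (ν : ℝ) (u : ℝ → SignedMeasure ℝ) : Prop where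
  initial : u 0 = (Measure.dirac (0 : ℝ)).toSignedMeasure
  equation : ∀ φ : ℝ → ℝ, IsTestFunction φ →
    HasCaputoDeriv (2 * ν) (fun t => ∫ᵛ x, φ x ∂<•(u t))
      (fun t => ∫ᵛ x, iteratedDeriv 2 φ x ∂<•(u t))
  initial_velocity : 1 / 2 < ν → ∀ φ : ℝ → ℝ, IsTestFunction φ →
    derivWithin (fun t => ∫ᵛ x, φ x ∂<•(u t)) (Ici 0) 0 = 0

/-- `m t` is the probability law on the line equal to `2 u(s, t) ds` for `s > 0` and to `0` for
`s ≤ 0`, when `t > 0`; at time `0` it is the unit mass at `0`. -/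
structure IsFoldedLaw (u : ℝ → SignedMeasure ℝ) (m : ℝ → Measure ℝ) : Prop where
  zero : m 0 = Measure.dirac 0
  isProbabilityMeasure : ∀ t : ℝ, 0 < t → IsProbabilityMeasure (m t)
  folded : ∀ t : ℝ, 0 < t → ∀ B : Set ℝ, MeasurableSet B →
    (m t).real B = 2 * u t (B ∩ Ioi 0)

/-- The equations of the fractional birth process with birth rates `lam k`, `k ≥ 1`:
`d^ν p_k / dt^ν = - lam_k p_k + lam_(k-1) p_(k-1)` for `k ≥ 1`, where `p_0 = 0`,
with `p_1(0) = 1` and `p_k(0) = 0` for `k ≥ 2`. -/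
structure SolvesFractionalBirth (ν : ℝ) (lam : ℕ → ℝ) (p : ℕ → ℝ → ℝ) : Prop where
  zero : ∀ t : ℝ, 0 ≤ t → p 0 t = 0
  initial : ∀ k : ℕ, 1 ≤ k → p k 0 = if k = 1 then 1 else 0
  equation : ∀ k : ℕ, 1 ≤ k →
    HasCaputoDeriv ν (p k) (fun t => -(lam k) * p k t + lam (k - 1) * p (k - 1) t)

/-- The Mittag-Leffler function `E_{ν,1}`. -/
def mittagLeffler (ν x : ℝ) : ℝ := ∑' h : ℕ, x ^ h / Real.Gamma (ν * h + 1)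

/-- The explicit state probabilities of the fractional birth process with pairwise distinct
rates. -/
def explicitBirthProb (ν : ℝ) (lam : ℕ → ℝ) (k : ℕ) (t : ℝ) : ℝ :=
  (∏ j ∈ Finset.Icc 1 (k - 1), lam j) *
    ∑ m ∈ Finset.Icc 1 k,
      1 / (∏ l ∈ (Finset.Icc 1 k).erase m, (lam l - lam m)) *
        mittagLeffler ν (-(lam m) * t ^ ν)

/-- Holding times of a classical birth process started from one individual: independent, and
`τ n`, the time spent with `n + 1` individuals, is exponential with parameter `lam (n + 1)`. -/
structure IsHoldingTimes {Ω : Type*} [MeasurableSpace Ω] (lam : ℕ → ℝ) (P : Measure Ω)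
    (τ : ℕ → Ω → ℝ) : Prop where
  measurable : ∀ n : ℕ, Measurable (τ n)
  indep : iIndepFun τ P
  law : ∀ n : ℕ, P.map (τ n) = expMeasure (lam (n + 1))

/-- The classical birth process with holding times `τ`, started from one individual: the number
of individuals at time `s` is one plus the number of births up to time `s`, the `n`-th birth
taking place at time `τ 0 + ⋯ + τ (n - 1)`.  It is `⊤` from the explosion time on. -/
def birthProcess {Ω : Type*} (τ : ℕ → Ω → ℝ) (s : ℝ) (ω : Ω) : ℕ∞ :=
  1 + Set.encard {n : ℕ | ∑ i ∈ Finset.range (n + 1), τ i ω ≤ s}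

/-- `T` is a random time process with one-dimensional laws `m`, independent at each time of the
birth process with holding times `τ`. -/
structure IsIndependentRandomTime {Ω : Type*} [MeasurableSpace Ω] (m : ℝ → Measure ℝ)
    (P : Measure Ω) (τ : ℕ → Ω → ℝ) (T : ℝ → Ω → ℝ) : Prop where
  measurable : ∀ t : ℝ, 0 ≤ t → Measurable (T t)
  law : ∀ t : ℝ, 0 ≤ t → P.map (T t) = m t
  indep : ∀ t : ℝ, 0 ≤ t → IndepFun (fun ω n => τ n ω) (T t) P

/-- A fractional birth process of order `ν` with rates `lam`, started from one individual: the
number of individuals is in `ℕ ∪ {∞}`, and its state probabilities `Pr {X t = k}` satisfy the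
fractional birth equations. -/
structure IsFractionalBirthProcess {Ω : Type*} [MeasurableSpace Ω] (ν : ℝ) (lam : ℕ → ℝ)
    (P : Measure Ω) (X : ℝ → Ω → ℕ∞) : Prop where
  measurable : ∀ t : ℝ, 0 ≤ t → Measurable (X t)
  law : SolvesFractionalBirth ν lam (fun k t => P.real {ω | X t ω = (k : ℕ∞)})

end

/-! ### Kanter's function and its moments -/

section Kanter

open Real Filter Topology

/-! Everything rests on one positive random variable `Y` with moments `n! / Γ(ν n + 1)`, whose law
is `timeLaw ν`; the random time at `t` has the law of `t ^ ν * Y`. For `ν = 1`, `Y = 1`. For `ν <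
1`, `Y` is built by Kanter's formula as `K(φ) W ^ (1 - ν)`, with `φ` uniform on `(0, π)` and `W` an
independent standard exponential, so non-negativity of the density is visible. Its moments come from
an explicit integral of `K ^ n` (`integral_kanter_pow`, `sum_choose_mul_sinc`).

The moments give the moment generating function of `Y` as the Mittag-Leffler series. Integrating it
against `exp (-μ t) dt` cancels the Gamma factors and leaves a geometric series, so `t ^ ν * Y`
under this weight has law `μ ^ (ν - 1) exp (-μ ^ ν s) ds` (`map_expWeight_prod_timeLaw`). Hence, if
`g(t) = E q(t ^ ν Y)`, the Laplace transform of `g` at `μ` is `μ ^ (ν - 1)` times that of `q` at `μ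
^ ν`. Therefore subordination turns `d/ds` into the Caputo derivative of order `ν`, and `d²/ds²`
into that of order `2 ν` when `q'(0) = 0` (`hasCaputoDeriv_timeMean`,
`hasCaputoDeriv_timeMean_second`).

Applied to the even part of a test function, the second statement shows that the symmetrized law of
the random time is the fundamental solution. Applied to the classical state probabilities, the first
solves the fractional birth equations. Uniqueness in both cases follows from an equivalent Volterra
equation and a contraction in an exponentially weighted norm; for the fundamental solution, sines
and cosines as test functions reduce the equation to scalar ones and determine all characteristic
functions.

The classical probabilities are identified with those of the process by conditioning on the last
birth time, and independence of the random time then gives subordination by Fubini. For explosion,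
the transform at `μ = 1` of the probability of having left the first `K + 1` states is `∏ lam_j / (1
+ lam_j)`. Since `1 ^ ν = 1` it does not depend on `ν`, and it tends to `0` exactly when `∑ 1 /
lam_j` diverges; monotonicity in `t` carries this back to every fixed time. -/

theorem hasDerivAt_mul_sinc (c x : ℝ) :
    HasDerivAt (fun y => y * sinc (c * y)) (cos (c * x)) x := by
  rcases eq_or_ne c 0 with rfl | hc
  · simpa using! hasDerivAt_id x
  have h : (fun y => y * sinc (c * y)) = fun y => sin (c * y) / c := by
    funext y
    rcases eq_or_ne y 0 with rfl | hy
    · simp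
    · rw [sinc_of_ne_zero (mul_ne_zero hc hy)]
      field_simp
  rw [h]
  have h1 : HasDerivAt (fun y : ℝ => sin (c * y)) (cos (c * x) * c) x := by
    simpa using ((hasDerivAt_id x).const_mul c).sin
  simpa [hc] using h1.div_const c

theorem mul_mul_sinc (c x : ℝ) : c * (x * sinc (c * x)) = sin (c * x) := by
  rcases eq_or_ne (c * x) 0 with h | h
  · rw [h, ← mul_assoc, h]; simp
  · rw [sinc_of_ne_zero h, ← mul_assoc, mul_div_cancel₀ _ h]

theorem sinc_pos {x : ℝ} (h0 : 0 ≤ x) (h1 : x < π) : 0 < sinc x := by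
  rcases h0.eq_or_lt with rfl | h
  · simp
  · rw [sinc_of_ne_zero h.ne']
    exact div_pos (sin_pos_of_pos_of_lt_pi h h1) h

/-- The ratio `sin (ν φ) / sin ((1 - ν) φ)`, extended continuously to `φ = 0`. -/
noncomputable def sineRatio (ν φ : ℝ) : ℝ :=
  ν * sinc (ν * φ) / ((1 - ν) * sinc ((1 - ν) * φ))

/-- The function `sin φ / (sin (ν φ) ^ ν * sin ((1 - ν) φ) ^ (1 - ν))` of Kanter's formula. -/
noncomputable def kanter (ν φ : ℝ) : ℝ :=
  sin φ / sin ((1 - ν) * φ) * sineRatio ν φ ^ (-ν)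

theorem sineRatio_eq {ν φ : ℝ} (hφ : φ ≠ 0) :
    sineRatio ν φ = sin (ν * φ) / sin ((1 - ν) * φ) := by
  rw [← mul_mul_sinc ν φ, ← mul_mul_sinc (1 - ν) φ, sineRatio]
  rw [mul_left_comm ν, mul_left_comm (1 - ν), mul_div_mul_left _ _ hφ]

theorem sineRatio_pos {ν φ : ℝ} (h0 : 0 < ν) (h1 : ν < 1) (hφ : φ ∈ Icc 0 π) :
    0 < sineRatio ν φ := by
  have hp := pi_pos
  have h2 : 0 < 1 - ν := by linarith
  have hs1 : 0 < sinc (ν * φ) := sinc_pos (mul_nonneg h0.le hφ.1) (by nlinarith [hφ.1, hφ.2])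
  have hs2 : 0 < sinc ((1 - ν) * φ) :=
    sinc_pos (mul_nonneg h2.le hφ.1) (by nlinarith [hφ.1, hφ.2])
  unfold sineRatio
  positivity

theorem continuousOn_sineRatio {ν : ℝ} (h0 : 0 < ν) (h1 : ν < 1) :
    ContinuousOn (sineRatio ν) (Icc 0 π) := by
  have hc := continuous_sinc
  refine ContinuousOn.div (by fun_prop) (by fun_prop) fun φ hφ => ?_
  have hp := pi_pos
  have h2 : 0 < 1 - ν := by linarith
  exact (mul_pos h2 (sinc_pos (mul_nonneg h2.le hφ.1) (by nlinarith [hφ.1, hφ.2]))).ne'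

theorem sin_one_sub_mul_pos {ν φ : ℝ} (h0 : 0 < ν) (h1 : ν < 1) (hφ : φ ∈ Ioo 0 π) :
    0 < sin ((1 - ν) * φ) := by
  have hp := pi_pos
  exact sin_pos_of_pos_of_lt_pi (mul_pos (by linarith) hφ.1) (by nlinarith [hφ.1, hφ.2])

theorem kanter_pos {ν φ : ℝ} (h0 : 0 < ν) (h1 : ν < 1) (hφ : φ ∈ Ioo 0 π) :
    0 < kanter ν φ := by
  have := sineRatio_pos h0 h1 (Ioo_subset_Icc_self hφ)
  have := sin_one_sub_mul_pos h0 h1 hφ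
  have := sin_pos_of_pos_of_lt_pi hφ.1 hφ.2
  unfold kanter
  positivity

theorem measurable_kanter (ν : ℝ) : Measurable (kanter ν) := by
  have := continuous_sinc.measurable
  unfold kanter sineRatio
  fun_prop

theorem exists_hasDerivAt_sineRatio {ν φ : ℝ} (h0 : 0 < ν) (h1 : ν < 1) (hφ : φ ∈ Ioo 0 π) :
    ∃ r', HasDerivAt (sineRatio ν) r' φ := by
  have hs := (sin_one_sub_mul_pos h0 h1 hφ).ne'
  have hd : DifferentiableAt ℝ (fun x => sin (ν * x) / sin ((1 - ν) * x)) φ := by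
    refine DifferentiableAt.div ?_ ?_ hs <;> fun_prop
  refine ⟨_, hd.hasDerivAt.congr_of_eventuallyEq ?_⟩
  filter_upwards [Ioi_mem_nhds hφ.1] with x hx
  exact sineRatio_eq (ne_of_gt hx)

/-- On the curve `z = r exp (i φ)` with `r = sineRatio ν φ`, the number `1 + z` has argument `ν φ`,
so `(1 + z) ^ n z ^ (-ν n)` is real and equals `kanter ν φ ^ n`. The two identities are the real and
imaginary parts of its binomial expansion. -/
theorem sum_choose_sineRatio {ν φ : ℝ} (h0 : 0 < ν) (h1 : ν < 1) (hφ : φ ∈ Ioo 0 π) (n : ℕ) :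
    (∑ j ∈ Finset.range (n + 1), (n.choose j : ℝ) *
        (sineRatio ν φ ^ ((j : ℝ) - ν * n) * cos (((j : ℝ) - ν * n) * φ)) = kanter ν φ ^ n) ∧
    ∑ j ∈ Finset.range (n + 1), (n.choose j : ℝ) *
        (sineRatio ν φ ^ ((j : ℝ) - ν * n) * sin (((j : ℝ) - ν * n) * φ)) = 0 := by
  set r := sineRatio ν φ with hr
  have hrpos : 0 < r := sineRatio_pos h0 h1 (Ioo_subset_Icc_self hφ)
  have hs : 0 < sin ((1 - ν) * φ) := sin_one_sub_mul_pos h0 h1 hφ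
  have hreq : r = sin (ν * φ) / sin ((1 - ν) * φ) := sineRatio_eq hφ.1.ne'
  have hre : 1 + r * cos φ = sin φ / sin ((1 - ν) * φ) * cos (ν * φ) := by
    have : sin ((1 - ν) * φ) = sin φ * cos (ν * φ) - cos φ * sin (ν * φ) := by
      rw [← sin_sub]; ring_nf
    rw [hreq, div_mul_eq_mul_div, div_mul_eq_mul_div, one_add_div hs.ne']
    congr 1
    rw [this]; ring
  have him : r * sin φ = sin φ / sin ((1 - ν) * φ) * sin (ν * φ) := by
    rw [hreq]; field_simp
  have key : (1 + (r : ℂ) * Complex.exp (φ * Complex.I)) =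
      ((sin φ / sin ((1 - ν) * φ) : ℝ) : ℂ) * Complex.exp ((ν * φ : ℝ) * Complex.I) := by
    apply Complex.ext
    · simp only [Complex.add_re, Complex.one_re, Complex.re_ofReal_mul, Complex.exp_ofReal_mul_I_re]
      exact hre
    · simp only [Complex.add_im, Complex.one_im, Complex.im_ofReal_mul,
        Complex.exp_ofReal_mul_I_im, zero_add]
      exact him
  have hpow : ∑ j ∈ Finset.range (n + 1), ((n.choose j : ℝ) : ℂ) *
      (((r ^ ((j : ℝ) - ν * n) : ℝ) : ℂ) *
        Complex.exp (((((j : ℝ) - ν * n) * φ : ℝ) : ℂ) * Complex.I)) =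
        ((kanter ν φ ^ n : ℝ) : ℂ) := by
    have hK : kanter ν φ ^ n = (sin φ / sin ((1 - ν) * φ)) ^ n * r ^ (-(ν * n)) := by
      rw [kanter, mul_pow, ← rpow_natCast (_ ^ (-ν)), ← rpow_mul hrpos.le, neg_mul]
    have h3 : (sin φ / sin ((1 - ν) * φ) : ℝ) ^ n =
        (1 + (r : ℂ) * Complex.exp (φ * Complex.I)) ^ n *
          Complex.exp (-(ν * n * φ : ℝ) * Complex.I) := by
      rw [key, mul_pow, ← Complex.exp_nat_mul, mul_assoc, ← Complex.exp_add]
      have : (n : ℂ) * (((ν * φ : ℝ) : ℂ) * Complex.I) + -((ν * n * φ : ℝ) : ℂ) * Complex.I = 0 := by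
        push_cast; ring
      rw [this, Complex.exp_zero, mul_one]
    rw [hK, Complex.ofReal_mul, Complex.ofReal_pow, h3, add_comm (1 : ℂ), add_pow, Finset.sum_mul,
      Finset.sum_mul]
    refine Finset.sum_congr rfl fun j _ => ?_
    rw [sub_eq_add_neg, rpow_add hrpos, rpow_natCast, mul_pow, ← Complex.exp_nat_mul]
    have : Complex.exp ((((j : ℝ) + -(ν * n)) * φ : ℝ) * Complex.I) =
        Complex.exp ((j : ℂ) * ((φ : ℂ) * Complex.I)) *
          Complex.exp (-(ν * n * φ : ℝ) * Complex.I) := by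
      rw [← Complex.exp_add]; congr 1; push_cast; ring
    rw [this]
    push_cast
    ring
  constructor
  · have := congrArg Complex.re hpow
    simpa only [Complex.re_sum, Complex.re_ofReal_mul, Complex.exp_ofReal_mul_I_re,
      Complex.ofReal_re] using this
  · have := congrArg Complex.im hpow
    simpa only [Complex.im_sum, Complex.im_ofReal_mul, Complex.exp_ofReal_mul_I_im,
      Complex.ofReal_im] using this

/-- In effect a contour integral of `(1 + z) ^ n z ^ (-ν n - 1)` along that curve. The
antiderivative `Ψ` is the imaginary part of the termwise integrated binomial expansion; writing it
with `sinc` covers an exponent `j - ν n` equal to `0` without a separate case. -/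
theorem integral_kanter_pow {ν : ℝ} (h0 : 0 < ν) (h1 : ν < 1) (n : ℕ) :
    IntegrableOn (fun φ => kanter ν φ ^ n) (Ioo 0 π) ∧
    ∫ φ in Ioo 0 π, kanter ν φ ^ n =
      π * ∑ j ∈ Finset.range (n + 1), (n.choose j : ℝ) * sinc (π * ((j : ℝ) - ν * n)) := by
  set Ψ : ℝ → ℝ := fun φ => ∑ j ∈ Finset.range (n + 1), (n.choose j : ℝ) *
    (sineRatio ν φ ^ ((j : ℝ) - ν * n) * (φ * sinc (((j : ℝ) - ν * n) * φ))) with hΨ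
  have hcont : ContinuousOn Ψ (Icc 0 π) := by
    have hc := continuous_sinc
    refine continuousOn_finsetSum _ fun j _ => ContinuousOn.mul continuousOn_const
      (ContinuousOn.mul ?_ (by fun_prop))
    exact (continuousOn_sineRatio h0 h1).rpow_const
      fun φ hφ => Or.inl (sineRatio_pos h0 h1 hφ).ne'
  have hderiv : ∀ φ ∈ Ioo 0 π, HasDerivAt Ψ (kanter ν φ ^ n) φ := by
    intro φ hφ
    obtain ⟨r', hr'⟩ := exists_hasDerivAt_sineRatio h0 h1 hφ
    have hrpos := sineRatio_pos h0 h1 (Ioo_subset_Icc_self hφ)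
    have hsum : HasDerivAt Ψ (∑ j ∈ Finset.range (n + 1), (n.choose j : ℝ) *
        (r' * ((j : ℝ) - ν * n) * sineRatio ν φ ^ ((j : ℝ) - ν * n - 1) *
          (φ * sinc (((j : ℝ) - ν * n) * φ)) +
          sineRatio ν φ ^ ((j : ℝ) - ν * n) * cos (((j : ℝ) - ν * n) * φ))) φ := by
      refine HasDerivAt.fun_sum fun j _ => HasDerivAt.const_mul _ ?_
      exact (hr'.rpow_const (Or.inl hrpos.ne')).mul (hasDerivAt_mul_sinc _ φ)
    convert hsum using 1
    -- The terms containing `r'` add up to `r' / r` times the sine sum, which vanishes; the cosine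
    -- sum that remains is `kanter ν φ ^ n`.
    obtain ⟨hc, hs⟩ := sum_choose_sineRatio h0 h1 hφ n
    rw [← hc, ← add_zero (Finset.sum _ _), ← mul_zero (r' / sineRatio ν φ), ← hs, Finset.mul_sum,
      ← Finset.sum_add_distrib]
    refine Finset.sum_congr rfl fun j _ => ?_
    rw [← mul_mul_sinc ((j : ℝ) - ν * n) φ, rpow_sub_one hrpos.ne']
    field_simp
    ring
  have hint := intervalIntegral.integrableOn_deriv_of_nonneg hcont hderiv
    fun φ hφ => (pow_pos (kanter_pos h0 h1 hφ) n).le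
  refine ⟨hint.mono_set Ioo_subset_Ioc_self, ?_⟩
  rw [← integral_Ioc_eq_integral_Ioo, ← intervalIntegral.integral_of_le pi_pos.le,
    intervalIntegral.integral_eq_sub_of_hasDerivAt_of_le pi_pos.le hcont hderiv
      ((intervalIntegrable_iff_integrableOn_Ioc_of_le pi_pos.le).2 hint)]
  have hr : sineRatio ν π = 1 := by
    have hs := sin_pos_of_pos_of_lt_pi (mul_pos h0 pi_pos) (by nlinarith [pi_pos])
    rw [sineRatio_eq pi_pos.ne', show (1 - ν) * π = π - ν * π by ring, sin_pi_sub, div_self hs.ne']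
  simp only [hΨ, hr, one_rpow, one_mul, zero_mul, mul_zero, Finset.sum_const_zero, sub_zero,
    Finset.mul_sum]
  refine Finset.sum_congr rfl fun j _ => ?_
  rw [mul_comm π (_ - _)]
  ring

/-- The functional equation for the entire function `1 / Γ`; it survives at the poles because
`Gamma` takes the value `0` there. -/
theorem inv_Gamma_eq (s : ℝ) : (Gamma s)⁻¹ = s * (Gamma (s + 1))⁻¹ := by
  rcases eq_or_ne s 0 with rfl | hs
  · simp
  · rw [Gamma_add_one hs, mul_inv, ← mul_assoc, mul_inv_cancel₀ hs, one_mul]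

/-- Interpolation of binomial coefficients at a real argument `a`. Both sides satisfy Pascal's rule
in `(n, a)`, and the case `n = 0` is the reflection formula. -/
theorem sum_choose_mul_sinc (n : ℕ) (a : ℝ) :
    ∑ j ∈ Finset.range (n + 1), (n.choose j : ℝ) * sinc (π * ((j : ℝ) - a)) =
      n.factorial * (Gamma (a + 1))⁻¹ * (Gamma (n - a + 1))⁻¹ := by
  induction n generalizing a with
  | zero =>
    have h := Gamma_mul_Gamma_one_sub a
    simp only [zero_add, Finset.range_one, Finset.sum_singleton, Nat.choose_self, Nat.cast_one,
      one_mul, Nat.cast_zero, zero_sub, Nat.factorial_zero, mul_neg, sinc_neg]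
    rcases eq_or_ne a 0 with rfl | ha
    · simp
    rw [sinc_of_ne_zero (mul_ne_zero pi_pos.ne' ha), Gamma_add_one ha, mul_inv, mul_assoc,
      ← mul_inv, show -a + 1 = 1 - a by ring, h, inv_div]
    field_simp
  | succ n ih =>
    have hp : ∑ j ∈ Finset.range (n + 1 + 1), ((n + 1).choose j : ℝ) * sinc (π * ((j : ℝ) - a)) =
        (∑ j ∈ Finset.range (n + 1), (n.choose j : ℝ) * sinc (π * ((j : ℝ) - a))) +
        ∑ j ∈ Finset.range (n + 1), (n.choose j : ℝ) * sinc (π * ((j : ℝ) - (a - 1))) := by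
      rw [Finset.sum_range_succ']
      have h1 : ∑ j ∈ Finset.range (n + 1), (n.choose j : ℝ) * sinc (π * ((j : ℝ) - a)) =
          ∑ j ∈ Finset.range (n + 1 + 1), (n.choose j : ℝ) * sinc (π * ((j : ℝ) - a)) := by
        rw [Finset.sum_range_succ _ (n + 1)]; simp
      rw [h1, Finset.sum_range_succ' _ (n + 1), add_right_comm, ← Finset.sum_add_distrib]
      congr 1
      · refine Finset.sum_congr rfl fun j _ => ?_
        rw [Nat.choose_succ_succ]
        push_cast
        rw [show (j : ℝ) - (a - 1) = j + 1 - a by ring]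
        ring
      · simp
    rw [hp, ih, ih, show a - 1 + 1 = a by ring, show (n : ℝ) - (a - 1) + 1 = n - a + 1 + 1 by ring,
      inv_Gamma_eq a, inv_Gamma_eq ((n : ℝ) - a + 1), Nat.factorial_succ]
    push_cast
    rw [show (n : ℝ) + 1 - a + 1 = n - a + 1 + 1 by ring]
    ring

end Kanter

/-! ### The law of the random time at time 1 -/

section WrightDensity

open Real Filter Topology

/-- The probability density on `(0, ∞)` with moments `n! / Γ(ν n + 1)`, by Kanter's formula. -/
noncomputable def wrightDensity (ν x : ℝ) : ℝ :=
  1 / (π * (1 - ν) * x) * ∫ φ in Ioo 0 π,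
    (x / kanter ν φ) ^ (1 / (1 - ν)) * exp (-(x / kanter ν φ) ^ (1 / (1 - ν)))

theorem mul_exp_neg_le_one (y : ℝ) : y * exp (-y) ≤ 1 := by
  have h := add_one_le_exp y
  have h2 := exp_pos y
  rw [exp_neg, ← div_eq_mul_inv, div_le_one h2]
  linarith

theorem norm_kanter_integrand_le {ν x φ : ℝ} (h0 : 0 < ν) (h1 : ν < 1) (hx : 0 < x)
    (hφ : φ ∈ Ioo 0 π) :
    ‖(x / kanter ν φ) ^ (1 / (1 - ν)) * exp (-(x / kanter ν φ) ^ (1 / (1 - ν)))‖ ≤ 1 := by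
  have hK := kanter_pos h0 h1 hφ
  rw [norm_of_nonneg (by positivity)]
  exact mul_exp_neg_le_one _

theorem integrableOn_kanter_integrand {ν x : ℝ} (h0 : 0 < ν) (h1 : ν < 1) (hx : 0 < x) :
    IntegrableOn (fun φ => (x / kanter ν φ) ^ (1 / (1 - ν)) *
      exp (-(x / kanter ν φ) ^ (1 / (1 - ν)))) (Ioo 0 π) := by
  have := measurable_kanter ν
  refine Integrable.mono' (g := fun _ => (1 : ℝ)) (by simp) ?_ ?_
  · exact Measurable.aestronglyMeasurable (by fun_prop)
  · exact (ae_restrict_iff' measurableSet_Ioo).2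
      (ae_of_all _ fun φ hφ => norm_kanter_integrand_le h0 h1 hx hφ)

theorem wrightDensity_nonneg {ν x : ℝ} (h0 : 0 < ν) (h1 : ν < 1) (hx : 0 < x) :
    0 ≤ wrightDensity ν x := by
  have h2 : 0 < 1 - ν := by linarith
  refine mul_nonneg (by positivity) (setIntegral_nonneg measurableSet_Ioo fun φ hφ => ?_)
  have hK := kanter_pos h0 h1 hφ
  positivity

/-- From `y exp (-y) ≤ 1` inside the integral. After scaling, this bound dominates the density of
the random time uniformly in `t`. -/
theorem wrightDensity_le {ν x : ℝ} (h0 : 0 < ν) (h1 : ν < 1) (hx : 0 < x) :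
    wrightDensity ν x ≤ 1 / (1 - ν) / x := by
  have h2 : 0 < 1 - ν := by linarith
  have h : ∫ φ in Ioo 0 π, (x / kanter ν φ) ^ (1 / (1 - ν)) *
      exp (-(x / kanter ν φ) ^ (1 / (1 - ν))) ≤ π := by
    have := norm_setIntegral_le_of_norm_le_const (μ := volume) (s := Ioo 0 π) (by simp)
      fun φ hφ => norm_kanter_integrand_le h0 h1 hx hφ
    rw [one_mul, Real.volume_real_Ioo_of_le pi_pos.le, sub_zero] at this
    exact (le_abs_self _).trans this
  calc wrightDensity ν x ≤ 1 / (π * (1 - ν) * x) * π := by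
        unfold wrightDensity; gcongr
    _ = 1 / (1 - ν) / x := by field_simp

theorem continuousOn_wrightDensity {ν : ℝ} (h0 : 0 < ν) (h1 : ν < 1) :
    ContinuousOn (wrightDensity ν) (Ioi 0) := by
  have hm := measurable_kanter ν
  have h2 : 0 < 1 - ν := by linarith
  refine ContinuousOn.mul (ContinuousOn.div continuousOn_const (by fun_prop) fun x hx => ?_) ?_
  · have : (0 : ℝ) < x := hx
    positivity
  refine continuousOn_of_dominated (bound := fun _ => 1)
    (fun x _ => Measurable.aestronglyMeasurable (by fun_prop)) (fun x hx => ?_) (by simp) ?_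
  · exact (ae_restrict_iff' measurableSet_Ioo).2
      (ae_of_all _ fun φ hφ => norm_kanter_integrand_le h0 h1 hx hφ)
  · refine (ae_restrict_iff' measurableSet_Ioo).2 (ae_of_all _ fun φ hφ => ?_)
    have hK := kanter_pos h0 h1 hφ
    have hp : 0 ≤ 1 / (1 - ν) := by positivity
    refine Continuous.continuousOn ?_
    have : Continuous fun x : ℝ => (x / kanter ν φ) ^ (1 / (1 - ν)) :=
      (continuous_id.div_const _).rpow_const fun _ => Or.inr hp
    fun_prop

/-- For fixed `k`, the integrand without `x ^ n` is `1 / π` times the density of `k W ^ (1 - ν)`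
with `W` standard exponential, whose `n`-th moment is `k ^ n Γ((1 - ν) n + 1)`. -/
theorem integral_rpow_kanter_integrand {ν k : ℝ} (h1 : ν < 1) (hν : 0 < ν) (hk : 0 < k) (n : ℕ) :
    IntegrableOn (fun x => x ^ n * (1 / (π * (1 - ν) * x) *
      ((x / k) ^ (1 / (1 - ν)) * exp (-(x / k) ^ (1 / (1 - ν)))))) (Ioi 0) ∧
    ∫ x in Ioi 0, x ^ n * (1 / (π * (1 - ν) * x) *
      ((x / k) ^ (1 / (1 - ν)) * exp (-(x / k) ^ (1 / (1 - ν))))) =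
      k ^ n * (Gamma ((1 - ν) * n + 1) / π) := by
  have h2 : 0 < 1 - ν := by linarith
  set p := 1 / (1 - ν) with hp
  have hp1 : 1 < p := by rw [hp, lt_div_iff₀ h2]; linarith
  have hp0 : 0 < p := by linarith
  have hval : ∫ x in Ioi 0, x ^ n * (1 / (π * (1 - ν) * x) *
      ((x / k) ^ p * exp (-(x / k) ^ p))) = k ^ n * (Gamma ((1 - ν) * n + 1) / π) := by
    have hcongr : ∀ x ∈ Ioi (0 : ℝ), x ^ n * (1 / (π * (1 - ν) * x) *
        ((x / k) ^ p * exp (-(x / k) ^ p))) =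
        p / π * k ^ (-p) * (x ^ ((n : ℝ) - 1 + p) * exp (-(k ^ (-p)) * x ^ p)) := by
      intro x hx
      have hx : 0 < x := hx
      rw [div_rpow hx.le hk.le, rpow_add hx, rpow_sub_one hx.ne', rpow_natCast, rpow_neg hk.le,
        show x ^ p / k ^ p = (k ^ p)⁻¹ * x ^ p by ring, neg_mul, hp]
      field_simp
    rw [setIntegral_congr_fun measurableSet_Ioi hcongr, integral_const_mul,
      integral_rpow_mul_exp_neg_mul_rpow hp0 (by have := n.cast_nonneg (α := ℝ); linarith)
        (rpow_pos_of_pos hk _), ← rpow_mul hk.le]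
    have e1 : -p * (-((n : ℝ) - 1 + p + 1) / p) = n + p := by field_simp; ring
    have e2 : ((n : ℝ) - 1 + p + 1) / p = (1 - ν) * n + 1 := by
      rw [hp]; field_simp; ring
    rw [e1, e2, rpow_add hk, rpow_natCast, rpow_neg hk.le]
    have := (rpow_pos_of_pos hk p).ne'
    field_simp
  refine ⟨?_, hval⟩
  refine Integrable.of_integral_ne_zero ?_
  rw [hval]
  have : 0 < Gamma ((1 - ν) * n + 1) := Gamma_pos_of_pos (by positivity)
  positivity

/-- Tonelli, then the conditional moment given `φ`. The factor `Γ((1 - ν) n + 1)` cancels against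
the one in the integral of `kanter ν φ ^ n`. -/
theorem lintegral_pow_mul_wrightDensity {ν : ℝ} (h0 : 0 < ν) (h1 : ν < 1) (n : ℕ) :
    ∫⁻ x in Ioi 0, ENNReal.ofReal (x ^ n * wrightDensity ν x) =
      ENNReal.ofReal (n.factorial / Gamma (ν * n + 1)) := by
  have hm := measurable_kanter ν
  have h2 : 0 < 1 - ν := by linarith
  have hG : 0 < Gamma ((1 - ν) * n + 1) := Gamma_pos_of_pos (by positivity)
  calc ∫⁻ x in Ioi 0, ENNReal.ofReal (x ^ n * wrightDensity ν x)
      = ∫⁻ x in Ioi 0, ∫⁻ φ in Ioo 0 π, ENNReal.ofReal (x ^ n * (1 / (π * (1 - ν) * x) *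
          ((x / kanter ν φ) ^ (1 / (1 - ν)) * exp (-(x / kanter ν φ) ^ (1 / (1 - ν)))))) := by
        refine setLIntegral_congr_fun measurableSet_Ioi fun x hx => ?_
        have hx : 0 < x := hx
        rw [wrightDensity, ← ofReal_integral_eq_lintegral_ofReal]
        · rw [integral_const_mul, integral_const_mul]
        · exact ((integrableOn_kanter_integrand h0 h1 hx).const_mul _).const_mul _
        · refine (ae_restrict_iff' measurableSet_Ioo).2 (ae_of_all _ fun φ hφ => ?_)
          have hK := kanter_pos h0 h1 hφ
          simp only [Pi.zero_apply]
          positivity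
    _ = ∫⁻ φ in Ioo 0 π, ∫⁻ x in Ioi 0, ENNReal.ofReal (x ^ n * (1 / (π * (1 - ν) * x) *
          ((x / kanter ν φ) ^ (1 / (1 - ν)) * exp (-(x / kanter ν φ) ^ (1 / (1 - ν)))))) := by
        refine lintegral_lintegral_swap (Measurable.aemeasurable ?_)
        unfold Function.uncurry
        fun_prop
    _ = ∫⁻ φ in Ioo 0 π, ENNReal.ofReal (kanter ν φ ^ n * (Gamma ((1 - ν) * n + 1) / π)) := by
        refine setLIntegral_congr_fun measurableSet_Ioo fun φ hφ => ?_
        have hK := kanter_pos h0 h1 hφ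
        obtain ⟨hi, he⟩ := integral_rpow_kanter_integrand h1 h0 hK n
        rw [← he, ofReal_integral_eq_lintegral_ofReal hi]
        refine (ae_restrict_iff' measurableSet_Ioi).2 (ae_of_all _ fun x hx => ?_)
        have hx : 0 < x := hx
        simp only [Pi.zero_apply]
        positivity
    _ = ENNReal.ofReal (n.factorial / Gamma (ν * n + 1)) := by
        obtain ⟨hi, he⟩ := integral_kanter_pow h0 h1 n
        rw [← ofReal_integral_eq_lintegral_ofReal (hi.mul_const _), integral_mul_const, he,
          sum_choose_mul_sinc, show (n : ℝ) - ν * n + 1 = (1 - ν) * n + 1 by ring]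
        · congr 1
          field_simp
        · refine (ae_restrict_iff' measurableSet_Ioo).2 (ae_of_all _ fun φ hφ => ?_)
          have hK := kanter_pos h0 h1 hφ
          simp only [Pi.zero_apply]
          positivity

/-- The law of the random time at time `1`. -/
noncomputable def timeLaw (ν : ℝ) : Measure ℝ :=
  if ν = 1 then Measure.dirac 1
  else (volume.restrict (Ioi 0)).withDensity fun x => ENNReal.ofReal (wrightDensity ν x)

theorem aemeasurable_wrightDensity {ν : ℝ} (h0 : 0 < ν) (h1 : ν < 1) :
    AEMeasurable (wrightDensity ν) (volume.restrict (Ioi 0)) :=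
  (continuousOn_wrightDensity h0 h1).aemeasurable measurableSet_Ioi

theorem lintegral_pow_timeLaw {ν : ℝ} (h0 : 0 < ν) (h1 : ν ≤ 1) (n : ℕ) :
    ∫⁻ x, ENNReal.ofReal (x ^ n) ∂(timeLaw ν) =
      ENNReal.ofReal (n.factorial / Gamma (ν * n + 1)) := by
  rcases h1.eq_or_lt with rfl | h1
  · simp only [timeLaw, if_true, one_mul, Gamma_nat_eq_factorial, lintegral_dirac]
    rw [one_pow, div_self (by positivity)]
  · rw [timeLaw, if_neg h1.ne, ← lintegral_pow_mul_wrightDensity h0 h1,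
      lintegral_withDensity_eq_lintegral_mul₀]
    · refine setLIntegral_congr_fun measurableSet_Ioi fun x hx => ?_
      have hx : 0 < x := hx
      dsimp only [Pi.mul_apply]
      rw [mul_comm, ENNReal.ofReal_mul (by positivity)]
    · exact (aemeasurable_wrightDensity h0 h1).ennreal_ofReal
    · exact Measurable.aemeasurable (by fun_prop)

theorem isProbabilityMeasure_timeLaw {ν : ℝ} (h0 : 0 < ν) (h1 : ν ≤ 1) :
    IsProbabilityMeasure (timeLaw ν) :=
  ⟨by simpa using lintegral_pow_timeLaw h0 h1 0⟩

theorem ae_timeLaw_pos (ν : ℝ) : ∀ᵐ x ∂(timeLaw ν), 0 < x := by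
  unfold timeLaw
  split_ifs
  · rw [ae_dirac_iff measurableSet_Ioi]; exact one_pos
  · exact (withDensity_absolutelyContinuous _ _).ae_le (ae_restrict_mem measurableSet_Ioi)

end WrightDensity

/-! ### Uniqueness of Laplace transforms, and the Laplace transform in time -/

section Laplace

open Real Filter Topology

/-- Finite measures on `[0, ∞)` whose moment generating functions are finite and agree on a
one-sided neighbourhood of the origin are equal. -/
theorem measure_ext_of_integral_exp {ρ σ : Measure ℝ} [IsFiniteMeasure ρ] [IsFiniteMeasure σ]
    {r : ℝ} (hr : 0 < r) (hρ0 : ∀ᵐ y ∂ρ, 0 ≤ y) (hσ0 : ∀ᵐ y ∂σ, 0 ≤ y)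
    (hρ : ∀ x ∈ Ioo 0 r, Integrable (fun y => exp (x * y)) ρ)
    (hσ : ∀ x ∈ Ioo 0 r, Integrable (fun y => exp (x * y)) σ)
    (h : ∀ x ∈ Ioo 0 r, ∫ y, exp (x * y) ∂ρ = ∫ y, exp (x * y) ∂σ) : ρ = σ := by
  have hsub : ∀ τ : Measure ℝ, IsFiniteMeasure τ → (∀ᵐ y ∂τ, 0 ≤ y) →
      (∀ x ∈ Ioo 0 r, Integrable (fun y => exp (x * y)) τ) →
      AnalyticOnNhd ℂ (complexMGF id τ) {z | z.re < r} := by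
    intro τ _ h0 hi
    have hI : Iio r ⊆ interior (integrableExpSet id τ) := by
      rw [isOpen_Iio.subset_interior_iff]
      intro x hx
      rcases le_or_gt x 0 with hx0 | hx0
      · refine Integrable.mono' (g := fun _ => (1 : ℝ)) (integrable_const _)
          (Measurable.aestronglyMeasurable (by fun_prop)) ?_
        filter_upwards [h0] with y hy
        rw [norm_of_nonneg (exp_pos _).le, exp_le_one_iff]
        exact mul_nonpos_of_nonpos_of_nonneg hx0 hy
      · exact hi x ⟨hx0, hx⟩
    exact analyticOnNhd_complexMGF.mono fun z hz => hI hz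
  -- Both complex generating functions are analytic on this half-plane and agree on real points near
  -- `r / 2`. The imaginary axis lies in the half-plane, so the characteristic functions agree.
  have hEq : EqOn (complexMGF id ρ) (complexMGF id σ) {z | z.re < r} := by
    refine AnalyticOnNhd.eqOn_of_preconnected_of_frequently_eq (hsub ρ ‹_› hρ0 hρ)
      (hsub σ ‹_› hσ0 hσ) (convex_halfSpace_re_lt r).isPreconnected (z₀ := ((r / 2 : ℝ) : ℂ))
      (by simp only [mem_ofPred_eq, Complex.ofReal_re]; linarith) ?_
    have hreal : ∀ᶠ x : ℝ in 𝓝[≠] (r / 2), complexMGF id ρ x = complexMGF id σ x := by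
      have : Ioo 0 r ∈ 𝓝 (r / 2) := Ioo_mem_nhds (by linarith) (by linarith)
      filter_upwards [nhdsWithin_le_nhds this] with x hx
      rw [complexMGF_ofReal, complexMGF_ofReal]
      exact congrArg _ (h x hx)
    have htend : Tendsto (fun x : ℝ => (x : ℂ)) (𝓝[≠] (r / 2)) (𝓝[≠] ((r / 2 : ℝ) : ℂ)) := by
      refine tendsto_nhdsWithin_iff.2 ⟨?_, ?_⟩
      · exact (Complex.continuous_ofReal.tendsto _).mono_left nhdsWithin_le_nhds
      · filter_upwards [self_mem_nhdsWithin] with x hx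
        exact fun hc => hx (Complex.ofReal_injective hc)
    exact htend.frequently hreal.frequently
  refine Measure.ext_of_charFun (funext fun t => ?_)
  rw [← complexMGF_id_mul_I, ← complexMGF_id_mul_I]
  exact hEq (by simpa using hr)

/-- The positive and negative parts of `G = exp (-t) F` are densities of finite measures on `(0,
∞)`. Their generating functions at `x < 1` differ by the transform of `F` at `μ = 1 - x`, which is
`0`, so the measures coincide. -/
theorem ae_eq_zero_of_laplace {F : ℝ → ℝ}
    (hint : ∀ μ : ℝ, 0 < μ → IntegrableOn (fun t => exp (-(μ * t)) * F t) (Ioi 0))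
    (h : ∀ μ : ℝ, 0 < μ → ∫ t in Ioi 0, exp (-(μ * t)) * F t = 0) :
    ∀ᵐ t ∂(volume.restrict (Ioi 0)), F t = 0 := by
  set G : ℝ → ℝ := fun t => exp (-(1 * t)) * F t with hG
  have hGi : IntegrableOn G (Ioi 0) := hint 1 one_pos
  have hGm : AEMeasurable G (volume.restrict (Ioi 0)) := hGi.aemeasurable
  set κ := volume.restrict (Ioi (0 : ℝ))
  have hfin : ∀ H : ℝ → ℝ, Integrable H κ →
      IsFiniteMeasure (κ.withDensity fun t => ENNReal.ofReal (H t)) := fun H hH =>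
    isFiniteMeasure_withDensity_ofReal hH.2
  have h0 : ∀ H : ℝ → ENNReal, ∀ᵐ y ∂(κ.withDensity H), (0 : ℝ) ≤ y := fun H => by
    refine (withDensity_absolutelyContinuous _ _).ae_le ?_
    filter_upwards [ae_restrict_mem measurableSet_Ioi] with y hy using le_of_lt hy
  have hexp : ∀ x : ℝ, x < 1 → Integrable (fun t => exp (x * t) * G t) κ := by
    intro x hx
    have := hint (1 - x) (by linarith)
    refine this.congr (ae_of_all _ fun t => ?_)
    simp only [hG]
    rw [← mul_assoc, ← exp_add]; congr 2; ring
  have hmax : ∀ x : ℝ, x < 1 → ∀ s : ℝ, s = 1 ∨ s = -1 →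
      Integrable (fun t => max (s * G t) 0 * exp (x * t)) κ := by
    intro x hx s hs
    have h2 := ((hexp x hx).const_mul s).pos_part
    refine h2.congr (ae_of_all _ fun t => ?_)
    dsimp only
    rw [max_mul_of_nonneg _ _ (exp_pos _).le, zero_mul]; ring_nf
  have key : (κ.withDensity fun t => ENNReal.ofReal (1 * G t)) =
      κ.withDensity fun t => ENNReal.ofReal (-1 * G t) := by
    have := hfin _ (hGi.const_mul 1)
    have := hfin _ (hGi.const_mul (-1))
    have hd : ∀ s : ℝ, ∀ᵐ t ∂κ, ENNReal.ofReal (s * G t) < ⊤ := fun s => by simp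
    have hI : ∀ s : ℝ, s = 1 ∨ s = -1 → ∀ x ∈ Ioo (0 : ℝ) 1, Integrable (fun y => exp (x * y))
        (κ.withDensity fun t => ENNReal.ofReal (s * G t)) := by
      intro s hs x hx
      rw [integrable_withDensity_iff_integrable_smul₀' (hGm.const_mul s).ennreal_ofReal (hd s)]
      simpa [ENNReal.toReal_ofReal'] using hmax x hx.2 s hs
    refine measure_ext_of_integral_exp one_pos (h0 _) (h0 _) (hI 1 (Or.inl rfl))
      (hI (-1) (Or.inr rfl)) fun x hx => ?_
    have hval : ∀ s : ℝ, ∫ y, exp (x * y) ∂(κ.withDensity fun t => ENNReal.ofReal (s * G t)) =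
        ∫ t, max (s * G t) 0 * exp (x * t) ∂κ := by
      intro s
      rw [integral_withDensity_eq_integral_toReal_smul₀ (hGm.const_mul s).ennreal_ofReal (hd s)]
      simp [ENNReal.toReal_ofReal']
    rw [hval, hval, ← sub_eq_zero, ← integral_sub (hmax x hx.2 1 (Or.inl rfl))
      (hmax x hx.2 (-1) (Or.inr rfl))]
    refine Eq.trans ?_ (h (1 - x) (by linarith [hx.2]))
    refine integral_congr_ae (ae_of_all _ fun t => ?_)
    dsimp only
    have e : exp (-((1 - x) * t)) * F t = G t * exp (x * t) := by
      simp only [hG]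
      rw [mul_right_comm, ← exp_add]; congr 2; ring
    rw [e, ← sub_mul]
    congr 1
    rcases le_total 0 (G t) with hg | hg
    · rw [max_eq_left (by linarith), max_eq_right (by linarith)]; ring
    · rw [max_eq_right (by linarith), max_eq_left (by linarith)]; ring
  have hae := (withDensity_eq_iff (hGm.const_mul 1).ennreal_ofReal
    (hGm.const_mul (-1)).ennreal_ofReal (by
      rw [← lt_top_iff_ne_top]
      exact (hasFiniteIntegral_iff_enorm.1 (hGi.const_mul 1).2).trans_le' (lintegral_mono fun t => by
        rw [← ofReal_norm]; exact ENNReal.ofReal_le_ofReal (le_abs_self _)))).1 key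
  filter_upwards [hae] with t ht
  have hG0 : G t = 0 := by
    rcases le_total 0 (G t) with hg | hg
    · rw [ENNReal.ofReal_of_nonpos (p := -1 * G t) (by linarith), ENNReal.ofReal_eq_zero] at ht
      linarith
    · rw [ENNReal.ofReal_of_nonpos (p := 1 * G t) (by linarith), eq_comm,
        ENNReal.ofReal_eq_zero] at ht
      linarith
  exact (mul_eq_zero.1 hG0).resolve_left (exp_pos _).ne'

theorem ae_eq_of_laplace {F G : ℝ → ℝ}
    (hF : ∀ μ : ℝ, 0 < μ → IntegrableOn (fun t => exp (-(μ * t)) * F t) (Ioi 0))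
    (hG : ∀ μ : ℝ, 0 < μ → IntegrableOn (fun t => exp (-(μ * t)) * G t) (Ioi 0))
    (h : ∀ μ : ℝ, 0 < μ → ∫ t in Ioi 0, exp (-(μ * t)) * F t =
      ∫ t in Ioi 0, exp (-(μ * t)) * G t) :
    F =ᵐ[volume.restrict (Ioi 0)] G := by
  have := ae_eq_zero_of_laplace (F := fun t => F t - G t)
    (fun μ hμ => by simpa only [mul_sub] using! (hF μ hμ).sub (hG μ hμ))
    (fun μ hμ => by simp only [mul_sub]; rw [integral_sub (hF μ hμ) (hG μ hμ), h μ hμ, sub_self])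
  filter_upwards [this] with t ht using sub_eq_zero.1 ht

theorem eqOn_of_laplace {F G : ℝ → ℝ} (hFc : ContinuousOn F (Ioi 0)) (hGc : ContinuousOn G (Ioi 0))
    (hF : ∀ μ : ℝ, 0 < μ → IntegrableOn (fun t => exp (-(μ * t)) * F t) (Ioi 0))
    (hG : ∀ μ : ℝ, 0 < μ → IntegrableOn (fun t => exp (-(μ * t)) * G t) (Ioi 0))
    (h : ∀ μ : ℝ, 0 < μ → ∫ t in Ioi 0, exp (-(μ * t)) * F t =
      ∫ t in Ioi 0, exp (-(μ * t)) * G t) : EqOn F G (Ioi 0) :=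
  Measure.eqOn_open_of_ae_eq (ae_eq_of_laplace hF hG h) isOpen_Ioi hFc hGc

theorem integrableOn_rpow_mul_exp {a μ : ℝ} (ha : 0 < a) (hμ : 0 < μ) :
    IntegrableOn (fun t => exp (-(μ * t)) * t ^ (a - 1)) (Ioi 0) := by
  refine Integrable.of_integral_ne_zero ?_
  simp_rw [mul_comm (exp _)]
  rw [integral_rpow_mul_exp_neg_mul_Ioi ha hμ]
  have := Gamma_pos_of_pos ha
  positivity

theorem integral_exp_mul_rpow {a μ : ℝ} (ha : 0 < a) (hμ : 0 < μ) :
    ∫ t in Ioi 0, exp (-(μ * t)) * t ^ (a - 1) = μ ^ (-a) * Gamma a := by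
  simp_rw [mul_comm (exp _)]
  rw [integral_rpow_mul_exp_neg_mul_Ioi ha hμ, one_div, inv_rpow hμ.le, rpow_neg hμ.le]

/-- The `n!` in the moments cancels the one in the exponential series. Working in `ENNReal` allows
the interchange before any convergence is known. -/
theorem lintegral_exp_timeLaw {ν : ℝ} (h0 : 0 < ν) (h1 : ν ≤ 1) {c : ℝ} (hc : 0 ≤ c) :
    ∫⁻ y, ENNReal.ofReal (exp (c * y)) ∂(timeLaw ν) =
      ∑' n : ℕ, ENNReal.ofReal (c ^ n / Gamma (ν * n + 1)) := by
  have h : ∀ᵐ y ∂(timeLaw ν), ENNReal.ofReal (exp (c * y)) =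
      ∑' n : ℕ, ENNReal.ofReal (c ^ n / n.factorial) * ENNReal.ofReal (y ^ n) := by
    filter_upwards [ae_timeLaw_pos ν] with y hy
    rw [Real.exp_eq_exp_ℝ, NormedSpace.exp_eq_tsum_div, ENNReal.ofReal_tsum_of_nonneg
      (fun n => by positivity) (summable_pow_div_factorial _)]
    refine tsum_congr fun n => ?_
    rw [← ENNReal.ofReal_mul (by positivity), mul_pow]
    congr 1; ring
  rw [lintegral_congr_ae h, lintegral_tsum fun n => Measurable.aemeasurable (by fun_prop)]
  refine tsum_congr fun n => ?_
  rw [lintegral_const_mul _ (by fun_prop), lintegral_pow_timeLaw h0 h1,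
    ← ENNReal.ofReal_mul (by positivity)]
  congr 1
  field_simp

/-- The measure `exp (-μ t) dt` on `(0, ∞)`. -/
noncomputable def expWeight (μ : ℝ) : Measure ℝ :=
  (volume.restrict (Ioi 0)).withDensity fun t => ENNReal.ofReal (exp (-(μ * t)))

theorem integrable_expWeight_iff {μ : ℝ} {F : ℝ → ℝ} :
    Integrable F (expWeight μ) ↔ IntegrableOn (fun t => exp (-(μ * t)) * F t) (Ioi 0) := by
  rw [expWeight, integrable_withDensity_iff_integrable_smul' (by fun_prop) (by simp), IntegrableOn]
  simp [ENNReal.toReal_ofReal (exp_pos _).le]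

theorem integral_expWeight {μ : ℝ} (F : ℝ → ℝ) :
    ∫ t, F t ∂(expWeight μ) = ∫ t in Ioi 0, exp (-(μ * t)) * F t := by
  rw [expWeight, integral_withDensity_eq_integral_toReal_smul (by fun_prop) (by simp)]
  simp [ENNReal.toReal_ofReal (exp_pos _).le]

theorem integrableOn_exp_neg_mul {μ : ℝ} (hμ : 0 < μ) :
    IntegrableOn (fun t => exp (-(μ * t))) (Ioi 0) := by
  simpa using integrableOn_rpow_mul_exp one_pos hμ

theorem integral_exp_neg_mul {μ : ℝ} (hμ : 0 < μ) :
    ∫ t in Ioi 0, exp (-(μ * t)) = μ⁻¹ := by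
  simpa [rpow_neg_one] using integral_exp_mul_rpow one_pos hμ

theorem isFiniteMeasure_expWeight {μ : ℝ} (hμ : 0 < μ) : IsFiniteMeasure (expWeight μ) :=
  isFiniteMeasure_withDensity_ofReal (integrableOn_exp_neg_mul hμ).2

theorem ae_expWeight_pos (μ : ℝ) : ∀ᵐ t ∂(expWeight μ), 0 < t :=
  (withDensity_absolutelyContinuous _ _).ae_le (ae_restrict_mem measurableSet_Ioi)

theorem lintegral_expWeight {μ : ℝ} {F : ℝ → ENNReal} (hF : Measurable F) :
    ∫⁻ t, F t ∂(expWeight μ) = ∫⁻ t in Ioi 0, ENNReal.ofReal (exp (-(μ * t))) * F t := by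
  rw [expWeight, lintegral_withDensity_eq_lintegral_mul _ (by fun_prop) hF]
  rfl

theorem lintegral_rpow_expWeight {μ a : ℝ} (hμ : 0 < μ) (ha : 0 ≤ a) :
    ∫⁻ t, ENNReal.ofReal (t ^ a) ∂(expWeight μ) = ENNReal.ofReal (μ ^ (-(a + 1)) * Gamma (a + 1)) := by
  have hi := integrableOn_rpow_mul_exp (a := a + 1) (by positivity) hμ
  rw [lintegral_expWeight (by fun_prop), ← integral_exp_mul_rpow (by positivity) hμ,
    ofReal_integral_eq_lintegral_ofReal hi]
  · simp_rw [add_sub_cancel_right, ENNReal.ofReal_mul (exp_pos _).le]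
  · filter_upwards [ae_restrict_mem measurableSet_Ioi] with t ht
    have ht : 0 < t := ht
    simp only [Pi.zero_apply]
    positivity

theorem lintegral_exp_expWeight {μ x : ℝ} (hx : x < μ) :
    ∫⁻ t, ENNReal.ofReal (exp (x * t)) ∂(expWeight μ) = ENNReal.ofReal (μ - x)⁻¹ := by
  rw [lintegral_expWeight (by fun_prop), ← integral_exp_neg_mul (sub_pos.2 hx),
    ofReal_integral_eq_lintegral_ofReal (integrableOn_exp_neg_mul (sub_pos.2 hx))
      (ae_of_all _ fun t => (exp_pos _).le)]
  refine lintegral_congr fun t => ?_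
  rw [← ENNReal.ofReal_mul (exp_pos _).le, ← exp_add]
  congr 2; ring

/-- The law of `t ^ ν * y`, with `t` distributed according to `exp (-μ t) dt` and `y` independent
of `t` with law `timeLaw ν`. -/
theorem map_expWeight_prod_timeLaw {ν : ℝ} (h0 : 0 < ν) (h1 : ν ≤ 1) {μ : ℝ} (hμ : 0 < μ) :
    ((expWeight μ).prod (timeLaw ν)).map (fun z : ℝ × ℝ => z.1 ^ ν * z.2) =
      ENNReal.ofReal (μ ^ (ν - 1)) • expWeight (μ ^ ν) := by
  have := isFiniteMeasure_expWeight hμ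
  have hμν : 0 < μ ^ ν := rpow_pos_of_pos hμ ν
  have := isFiniteMeasure_expWeight hμν
  have := isProbabilityMeasure_timeLaw h0 h1
  have : IsFiniteMeasure (ENNReal.ofReal (μ ^ (ν - 1)) • expWeight (μ ^ ν)) :=
    Measure.smul_finite _ ENNReal.ofReal_ne_top
  have hmeas : Measurable fun z : ℝ × ℝ => z.1 ^ ν * z.2 := by fun_prop
  have hL : ∀ x ∈ Ioo 0 (μ ^ ν), ∫⁻ y, ENNReal.ofReal (exp (x * y))
      ∂(((expWeight μ).prod (timeLaw ν)).map (fun z : ℝ × ℝ => z.1 ^ ν * z.2)) =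
      ENNReal.ofReal (μ ^ (ν - 1) * (μ ^ ν - x)⁻¹) := by
    intro x hx
    rw [lintegral_map (by fun_prop) hmeas, lintegral_prod _ (Measurable.aemeasurable (by fun_prop))]
    have h2 : ∀ᵐ t ∂(expWeight μ), ∫⁻ y, ENNReal.ofReal (exp (x * (t ^ ν * y))) ∂(timeLaw ν) =
        ∑' n : ℕ, ENNReal.ofReal (x ^ n / Gamma (ν * n + 1)) * ENNReal.ofReal (t ^ (ν * n)) := by
      filter_upwards [ae_expWeight_pos μ] with t ht
      simp_rw [← mul_assoc]
      rw [lintegral_exp_timeLaw h0 h1 (mul_nonneg hx.1.le (by positivity))]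
      refine tsum_congr fun n => ?_
      rw [rpow_mul ht.le, rpow_natCast, ← ENNReal.ofReal_mul, mul_pow]
      · congr 1; ring
      · have := Gamma_pos_of_pos (show 0 < ν * n + 1 by positivity)
        have := hx.1
        positivity
    rw [lintegral_congr_ae h2, lintegral_tsum fun n => Measurable.aemeasurable (by fun_prop)]
    -- Integrating `t ^ (ν n)` against `exp (-μ t)` produces `Γ(ν n + 1)`, which cancels the
    -- denominator and leaves a geometric series of ratio `x / μ ^ ν`.
    have h3 : ∀ n : ℕ, ∫⁻ t, ENNReal.ofReal (x ^ n / Gamma (ν * n + 1)) *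
        ENNReal.ofReal (t ^ (ν * n)) ∂(expWeight μ) =
        ENNReal.ofReal (μ⁻¹ * (x / μ ^ ν) ^ n) := by
      intro n
      have hG := Gamma_pos_of_pos (show 0 < ν * n + 1 by positivity)
      have := hx.1
      rw [lintegral_const_mul _ (by fun_prop), lintegral_rpow_expWeight hμ (by positivity),
        ← ENNReal.ofReal_mul (by positivity)]
      congr 1
      rw [neg_add, rpow_add hμ, rpow_neg_one, rpow_neg hμ.le, rpow_mul hμ.le, rpow_natCast, div_pow]
      field_simp
    have hlt : x / μ ^ ν < 1 := (div_lt_one hμν).2 hx.2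
    have hnn : 0 ≤ x / μ ^ ν := div_nonneg hx.1.le hμν.le
    simp_rw [h3]
    rw [← ENNReal.ofReal_tsum_of_nonneg (fun n => by positivity)
      ((summable_geometric_of_lt_one hnn hlt).mul_left _), tsum_mul_left,
      tsum_geometric_of_lt_one hnn hlt]
    congr 1
    have : μ ^ ν - x ≠ 0 := (sub_pos.2 hx.2).ne'
    have : 1 - x / μ ^ ν ≠ 0 := by rw [one_sub_div hμν.ne']; positivity
    rw [rpow_sub_one hμ.ne']
    field_simp
  have hR : ∀ x ∈ Ioo 0 (μ ^ ν), ∫⁻ y, ENNReal.ofReal (exp (x * y))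
      ∂(ENNReal.ofReal (μ ^ (ν - 1)) • expWeight (μ ^ ν)) =
      ENNReal.ofReal (μ ^ (ν - 1) * (μ ^ ν - x)⁻¹) := by
    intro x hx
    rw [lintegral_smul_measure, lintegral_exp_expWeight hx.2, smul_eq_mul,
      ← ENNReal.ofReal_mul (by positivity)]
  have hint : ∀ τ : Measure ℝ, (∀ x ∈ Ioo 0 (μ ^ ν), ∫⁻ y, ENNReal.ofReal (exp (x * y)) ∂τ =
      ENNReal.ofReal (μ ^ (ν - 1) * (μ ^ ν - x)⁻¹)) → ∀ x ∈ Ioo 0 (μ ^ ν),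
      Integrable (fun y => exp (x * y)) τ := by
    intro τ hτ x hx
    refine ⟨Measurable.aestronglyMeasurable (by fun_prop), ?_⟩
    rw [hasFiniteIntegral_iff_ofReal (ae_of_all _ fun y => (exp_pos _).le), hτ x hx]
    exact ENNReal.ofReal_lt_top
  refine measure_ext_of_integral_exp hμν ?_ ?_ (hint _ hL) (hint _ hR) fun x hx => ?_
  · rw [ae_map_iff hmeas.aemeasurable measurableSet_Ici]
    have hz : ∀ᵐ z ∂(expWeight μ).prod (timeLaw ν), 0 < z.1 ∧ 0 < z.2 := by
      refine (Measure.quasiMeasurePreserving_fst.ae (ae_expWeight_pos μ)).and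
        (Measure.quasiMeasurePreserving_snd.ae (ae_timeLaw_pos ν))
    filter_upwards [hz] with z hz
    have := hz.1
    have := hz.2
    positivity
  · refine Measure.ae_smul_measure ?_ _
    filter_upwards [ae_expWeight_pos (μ ^ ν)] with t ht using ht.le
  · rw [integral_eq_lintegral_of_nonneg_ae (ae_of_all _ fun y => (exp_pos _).le)
      (hint _ hL x hx).aestronglyMeasurable, integral_eq_lintegral_of_nonneg_ae
      (ae_of_all _ fun y => (exp_pos _).le) (hint _ hR x hx).aestronglyMeasurable, hL x hx, hR x hx]

/-- Fubini and the pushforward law `map_expWeight_prod_timeLaw`. No continuity of `q` is assumed, so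
that indicators of Borel sets are allowed. -/
theorem laplace_integral_timeLaw {ν : ℝ} (h0 : 0 < ν) (h1 : ν ≤ 1) {q : ℝ → ℝ} (hq : Measurable q)
    {C : ℝ} (hC : ∀ s, 0 < s → |q s| ≤ C) {μ : ℝ} (hμ : 0 < μ) :
    IntegrableOn (fun t => exp (-(μ * t)) * ∫ y, q (t ^ ν * y) ∂(timeLaw ν)) (Ioi 0) ∧
    ∫ t in Ioi 0, exp (-(μ * t)) * ∫ y, q (t ^ ν * y) ∂(timeLaw ν) =
      μ ^ (ν - 1) * ∫ s in Ioi 0, exp (-(μ ^ ν * s)) * q s := by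
  have := isFiniteMeasure_expWeight hμ
  have hμν : 0 < μ ^ ν := rpow_pos_of_pos hμ ν
  have := isFiniteMeasure_expWeight hμν
  have := isProbabilityMeasure_timeLaw h0 h1
  have hmeas : Measurable fun z : ℝ × ℝ => z.1 ^ ν * z.2 := by fun_prop
  have hm := map_expWeight_prod_timeLaw h0 h1 hμ
  have hqi : Integrable q (ENNReal.ofReal (μ ^ (ν - 1)) • expWeight (μ ^ ν)) := by
    refine Integrable.smul_measure ?_ ENNReal.ofReal_ne_top
    refine Integrable.mono' (integrable_const C) hq.aestronglyMeasurable ?_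
    filter_upwards [ae_expWeight_pos (μ ^ ν)] with s hs using hC s hs
  rw [← hm, integrable_map_measure hq.aestronglyMeasurable hmeas.aemeasurable] at hqi
  rw [← integrable_expWeight_iff, ← integral_expWeight]
  refine ⟨hqi.integral_prod_left, ?_⟩
  have h2 := integral_prod _ hqi
  simp only [Function.comp] at h2
  rw [← h2, ← integral_map (f := q) hmeas.aemeasurable hq.aestronglyMeasurable, hm,
    integral_smul_measure, integral_expWeight, ENNReal.toReal_ofReal (by positivity), smul_eq_mul]

end Laplace

/-! ### Caputo derivatives: Laplace criterion and Volterra equations -/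

section Caputo

open Real Filter Topology

theorem hasCaputoDeriv_iff_of_le_one {β : ℝ} (h0 : 0 < β) (h1 : β ≤ 1) {g h : ℝ → ℝ} :
    HasCaputoDeriv β g h ↔ ContinuousOn g (Ici 0) ∧ DifferentiableOn ℝ g (Ioi 0) ∧
      ∀ t : ℝ, 0 < t → (β = 1 → h t = deriv g t) ∧
        (β ≠ 1 → IntegrableOn (fun s => deriv g s * (t - s) ^ (-β)) (Ioo 0 t) ∧
          h t = 1 / Gamma (1 - β) * ∫ s in Ioo 0 t, deriv g s * (t - s) ^ (-β)) := by
  have hc : ⌈β⌉₊ = 1 := by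
    rw [Nat.ceil_eq_iff one_ne_zero]; simpa using ⟨h0, h1⟩
  have hE : (1 : ℝ) - β - 1 = -β := by ring
  simp [HasCaputoDeriv, hc, hE, iteratedDeriv_one]

theorem hasCaputoDeriv_add_one_iff {β : ℝ} (h0 : 0 < β) (h1 : β ≤ 1) {g h : ℝ → ℝ} :
    HasCaputoDeriv (β + 1) g h ↔ ContDiffOn ℝ 1 g (Ici 0) ∧ DifferentiableOn ℝ (deriv g) (Ioi 0) ∧
      ∀ t : ℝ, 0 < t → (β = 1 → h t = deriv (deriv g) t) ∧
        (β ≠ 1 → IntegrableOn (fun s => deriv (deriv g) s * (t - s) ^ (-β)) (Ioo 0 t) ∧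
          h t = 1 / Gamma (1 - β) * ∫ s in Ioo 0 t, deriv (deriv g) s * (t - s) ^ (-β)) := by
  have hc : ⌈β + 1⌉₊ = 2 := by
    rw [Nat.ceil_eq_iff two_ne_zero]; push_cast; constructor <;> linarith
  have hE : (1 : ℝ) - β - 1 = -β := by ring
  have hE' : (2 : ℝ) - (β + 1) = 1 - β := by ring
  have hE'' : β + 1 = 2 ↔ β = 1 := by constructor <;> intro h <;> linarith
  simp only [HasCaputoDeriv, hc, Nat.cast_ofNat, hE, hE', hE'', iteratedDeriv_succ (n := 1),
    iteratedDeriv_one, Nat.reduceSub, Nat.cast_one, ne_eq]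

/-- Iterated derivatives at `t > 0` are local, so values on the negative axis play no role. -/
theorem HasCaputoDeriv.congr {α : ℝ} {g₁ g₂ h₁ h₂ : ℝ → ℝ} (h : HasCaputoDeriv α g₁ h₁)
    (hg : ∀ t, 0 ≤ t → g₂ t = g₁ t) (hh : ∀ t, 0 < t → h₂ t = h₁ t) : HasCaputoDeriv α g₂ h₂ := by
  have hE : ∀ n : ℕ, ∀ t : ℝ, 0 < t → iteratedDeriv n g₂ t = iteratedDeriv n g₁ t := by
    intro n t ht
    refine Filter.EventuallyEq.iteratedDeriv_eq n ?_
    filter_upwards [Ioi_mem_nhds ht] with s hs using hg s (le_of_lt hs)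
  obtain ⟨ha, hb, hc⟩ := h
  refine ⟨ha.congr hg, hb.congr fun t ht => hE _ t ht, fun t ht => ?_⟩
  have hI : EqOn (fun s => iteratedDeriv ⌈α⌉₊ g₂ s * (t - s) ^ ((⌈α⌉₊ : ℝ) - α - 1))
      (fun s => iteratedDeriv ⌈α⌉₊ g₁ s * (t - s) ^ ((⌈α⌉₊ : ℝ) - α - 1)) (Ioo 0 t) := by
    intro s hs
    simp only [hE _ s hs.1]
  rw [hh t ht, hE _ t ht, integrableOn_congr_fun hI measurableSet_Ioo,
    setIntegral_congr_fun measurableSet_Ioo hI]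
  exact hc t ht

theorem integral_beta {a b t : ℝ} (ha : 0 < a) (hb : 0 < b) (ht : 0 < t) :
    IntegrableOn (fun s => s ^ (a - 1) * (t - s) ^ (b - 1)) (Ioo 0 t) ∧
    ∫ s in Ioo 0 t, s ^ (a - 1) * (t - s) ^ (b - 1) =
      t ^ (a + b - 1) * (Gamma a * Gamma b / Gamma (a + b)) := by
  have hval : ∫ s in Ioo 0 t, s ^ (a - 1) * (t - s) ^ (b - 1) =
      t ^ (a + b - 1) * (Gamma a * Gamma b / Gamma (a + b)) := by
    have h := Complex.betaIntegral_scaled a b ht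
    rw [Complex.betaIntegral_eq_Gamma_mul_div _ _ (by simpa using ha) (by simpa using hb),
      intervalIntegral.integral_of_le ht.le, integral_Ioc_eq_integral_Ioo] at h
    rw [← Complex.ofReal_inj, ← integral_complex_ofReal]
    rw [show ((t : ℂ) ^ ((a : ℂ) + b - 1)) = ((t ^ (a + b - 1) : ℝ) : ℂ) by
      rw [Complex.ofReal_cpow ht.le]; push_cast; rfl] at h
    rw [Complex.ofReal_mul, Complex.ofReal_div, Complex.ofReal_mul, ← Complex.Gamma_ofReal,
      ← Complex.Gamma_ofReal, ← Complex.Gamma_ofReal, Complex.ofReal_add, ← h]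
    refine setIntegral_congr_fun measurableSet_Ioo fun s hs => ?_
    have h2 : 0 ≤ t - s := by linarith [hs.2]
    rw [Complex.ofReal_mul, Complex.ofReal_cpow hs.1.le, Complex.ofReal_cpow h2]
    push_cast
    rfl
  refine ⟨Integrable.of_integral_ne_zero ?_, hval⟩
  rw [hval]
  have := Gamma_pos_of_pos ha
  have := Gamma_pos_of_pos hb
  have := Gamma_pos_of_pos (add_pos ha hb)
  positivity

/-- Integration by parts. The boundary term at infinity vanishes because `exp (-μ t) g` and its
derivative are both integrable. -/
theorem laplace_deriv {g g' : ℝ → ℝ} {μ : ℝ} (hg : ContinuousWithinAt g (Ici 0) 0)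
    (hd : ∀ t, 0 < t → HasDerivAt g (g' t) t)
    (hgi : IntegrableOn (fun t => exp (-(μ * t)) * g t) (Ioi 0))
    (hg'i : IntegrableOn (fun t => exp (-(μ * t)) * g' t) (Ioi 0)) :
    ∫ t in Ioi 0, exp (-(μ * t)) * g' t = μ * (∫ t in Ioi 0, exp (-(μ * t)) * g t) - g 0 := by
  have hD : ∀ t ∈ Ioi (0 : ℝ), HasDerivAt (fun t => exp (-(μ * t)) * g t)
      (exp (-(μ * t)) * g' t - μ * (exp (-(μ * t)) * g t)) t := by
    intro t ht
    have h1 : HasDerivAt (fun t => exp (-(μ * t))) (exp (-(μ * t)) * (-(μ * 1))) t :=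
      ((hasDerivAt_id t).const_mul μ).neg.exp
    refine (h1.mul (hd t ht)).congr_deriv ?_
    ring
  have hDi : IntegrableOn (fun t => exp (-(μ * t)) * g' t - μ * (exp (-(μ * t)) * g t)) (Ioi 0) :=
    hg'i.sub (hgi.const_mul μ)
  have hT := tendsto_zero_of_hasDerivAt_of_integrableOn_Ioi hD hDi hgi
  have hc : ContinuousWithinAt (fun t => exp (-(μ * t)) * g t) (Ici 0) 0 :=
    ContinuousWithinAt.mul (Continuous.continuousWithinAt (by fun_prop)) hg
  have := integral_Ioi_of_hasDerivAt_of_tendsto hc hD hDi hT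
  rw [integral_sub hg'i (hgi.const_mul μ), integral_const_mul] at this
  simp at this
  linarith

theorem integrableOn_exp_mul_of_bound {f : ℝ → ℝ} (hf : ContinuousOn f (Ioi 0)) {C a μ : ℝ}
    (ha : 0 < a) (hμ : 0 < μ) (hC : ∀ t, 0 < t → |f t| ≤ C * t ^ (a - 1)) :
    IntegrableOn (fun t => exp (-(μ * t)) * f t) (Ioi 0) := by
  refine Integrable.mono' ((integrableOn_rpow_mul_exp ha hμ).const_mul C)
    ((ContinuousOn.mul (by fun_prop) hf).aestronglyMeasurable measurableSet_Ioi) ?_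
  filter_upwards [ae_restrict_mem measurableSet_Ioi] with t ht
  rw [norm_mul, norm_of_nonneg (exp_pos _).le, norm_eq_abs, mul_left_comm]
  exact mul_le_mul_of_nonneg_left (hC t ht) (exp_pos _).le

section Convolution

variable {f : ℝ → ℝ} {C a b : ℝ}

theorem integrableOn_mul_rpow_of_bound (hf : ContinuousOn f (Ioi 0)) (ha : 0 < a) (hb : 0 < b)
    (hC : ∀ t, 0 < t → |f t| ≤ C * t ^ (a - 1)) {t : ℝ} (ht : 0 < t) :
    IntegrableOn (fun s => f s * (t - s) ^ (b - 1)) (Ioo 0 t) := by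
  refine Integrable.mono' ((integral_beta ha hb ht).1.const_mul C) ?_ ?_
  · refine ContinuousOn.aestronglyMeasurable ?_ measurableSet_Ioo
    refine (hf.mono fun s hs => hs.1).mul (ContinuousOn.rpow_const (by fun_prop) fun s hs => ?_)
    exact Or.inl (sub_pos.2 hs.2).ne'
  · filter_upwards [ae_restrict_mem measurableSet_Ioo] with s hs
    have h2 : 0 < t - s := sub_pos.2 hs.2
    rw [norm_mul, norm_of_nonneg (rpow_pos_of_pos h2 _).le, norm_eq_abs, ← mul_assoc]
    exact mul_le_mul_of_nonneg_right (hC s hs.1) (rpow_pos_of_pos h2 _).le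

/-- The substitution `s = t x` fixes the domain to `(0, 1)`. The normalization `t ^ (1 - a) f(t x)`
is bounded by `C x ^ (a - 1)`, so a Beta integrand independent of `t` dominates. -/
theorem continuousOn_integral_mul_rpow (hf : ContinuousOn f (Ioi 0)) (ha : 0 < a) (hb : 0 < b)
    (hC : ∀ t, 0 < t → |f t| ≤ C * t ^ (a - 1)) :
    ContinuousOn (fun t => ∫ s in Ioo 0 t, f s * (t - s) ^ (b - 1)) (Ioi 0) := by
  have hscale : ∀ t ∈ Ioi (0 : ℝ), ∫ s in Ioo 0 t, f s * (t - s) ^ (b - 1) =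
      t ^ b * t ^ (a - 1) * ∫ x in Ioo 0 1, t ^ (1 - a) * f (t * x) * (1 - x) ^ (b - 1) := by
    intro t ht
    have ht : 0 < t := ht
    have h1 := intervalIntegral.integral_comp_mul_left (a := 0) (b := 1)
      (fun s => f s * (t - s) ^ (b - 1)) ht.ne'
    rw [mul_zero, mul_one, smul_eq_mul, eq_inv_mul_iff_mul_eq₀ ht.ne',
      intervalIntegral.integral_of_le zero_le_one, intervalIntegral.integral_of_le ht.le,
      integral_Ioc_eq_integral_Ioo, integral_Ioc_eq_integral_Ioo] at h1
    rw [← h1, ← integral_const_mul, ← integral_const_mul]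
    refine setIntegral_congr_fun measurableSet_Ioo fun x hx => ?_
    have hx1 : 0 < 1 - x := sub_pos.2 hx.2
    rw [show t - t * x = t * (1 - x) by ring, mul_rpow ht.le hx1.le, rpow_sub_one ht.ne',
      show (1 - a) = -(a - 1) by ring, rpow_neg ht.le]
    have := (rpow_pos_of_pos ht (a - 1)).ne'
    field_simp
  refine ContinuousOn.congr ?_ hscale
  refine ContinuousOn.mul ?_ ?_
  · refine ContinuousOn.mul ?_ ?_ <;>
    exact continuousOn_id.rpow_const fun t ht => Or.inl (ne_of_gt ht)
  · refine continuousOn_of_dominated (bound := fun x => C * (x ^ (a - 1) * (1 - x) ^ (b - 1)))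
      (fun t ht => ?_) (fun t ht => ?_) ((integral_beta ha hb one_pos).1.const_mul C) ?_
    · have ht : 0 < t := ht
      refine ContinuousOn.aestronglyMeasurable ?_ measurableSet_Ioo
      refine (continuousOn_const.mul (hf.comp (by fun_prop) fun x hx => mul_pos ht hx.1)).mul
        (ContinuousOn.rpow_const (by fun_prop) fun x hx => ?_)
      exact Or.inl (sub_pos.2 hx.2).ne'
    · have ht : 0 < t := ht
      filter_upwards [ae_restrict_mem measurableSet_Ioo] with x hx
      have h2 : 0 < 1 - x := sub_pos.2 hx.2
      rw [norm_mul, norm_mul, norm_of_nonneg (rpow_pos_of_pos h2 _).le,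
        norm_of_nonneg (rpow_pos_of_pos ht _).le, norm_eq_abs, ← mul_assoc]
      refine mul_le_mul_of_nonneg_right ?_ (rpow_pos_of_pos h2 _).le
      have h3 := mul_le_mul_of_nonneg_left (hC (t * x) (mul_pos ht hx.1))
        (rpow_pos_of_pos ht (1 - a)).le
      refine h3.trans_eq ?_
      rw [mul_rpow ht.le hx.1.le, show (1 - a) = -(a - 1) by ring, rpow_neg ht.le]
      have := (rpow_pos_of_pos ht (a - 1)).ne'
      field_simp
    · filter_upwards [ae_restrict_mem measurableSet_Ioo] with x hx
      refine (ContinuousOn.mul ?_ ?_).mul continuousOn_const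
      · exact continuousOn_id.rpow_const fun t ht => Or.inl (ne_of_gt ht)
      · exact hf.comp (by fun_prop) fun t ht => mul_pos ht hx.1

theorem laplace_integral_mul_rpow {μ : ℝ} (hμ : 0 < μ) (hb : 0 < b)
    (hf : IntegrableOn (fun t => exp (-(μ * t)) * f t) (Ioi 0)) :
    IntegrableOn (fun t => exp (-(μ * t)) * ∫ s in Ioo 0 t, f s * (t - s) ^ (b - 1)) (Ioi 0) ∧
    ∫ t in Ioi 0, exp (-(μ * t)) * ∫ s in Ioo 0 t, f s * (t - s) ^ (b - 1) =
      (∫ t in Ioi 0, exp (-(μ * t)) * f t) * (μ ^ (-b) * Gamma b) := by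
  have hk := integrableOn_rpow_mul_exp hb hμ
  have hpt : ∀ t ∈ Ioi (0 : ℝ), exp (-(μ * t)) * ∫ s in Ioo 0 t, f s * (t - s) ^ (b - 1) =
      ∫ s in (0 : ℝ)..t, ContinuousLinearMap.mul ℝ ℝ (exp (-(μ * s)) * f s)
        (exp (-(μ * (t - s))) * (t - s) ^ (b - 1)) := by
    intro t ht
    have ht : 0 < t := ht
    rw [intervalIntegral.integral_of_le ht.le, integral_Ioc_eq_integral_Ioo, ← integral_const_mul]
    refine setIntegral_congr_fun measurableSet_Ioo fun s _ => ?_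
    simp only [ContinuousLinearMap.mul_apply']
    rw [show -(μ * t) = -(μ * s) + -(μ * (t - s)) by ring, exp_add]
    ring
  constructor
  · have h := (integrable_posConvolution hf hk (ContinuousLinearMap.mul ℝ ℝ)).integrableOn
      (s := Ioi 0)
    refine h.congr_fun (fun t ht => ?_) measurableSet_Ioi
    simp only [posConvolution]
    rw [indicator_of_mem ht, hpt t ht]
  · rw [setIntegral_congr_fun measurableSet_Ioi hpt,
      integral_posConvolution hf hk (ContinuousLinearMap.mul ℝ ℝ), integral_exp_mul_rpow hb hμ,
      ContinuousLinearMap.mul_apply']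

end Convolution

/-- The Laplace transform of the Caputo equation implies the equation. -/
theorem hasCaputoDeriv_of_laplace {β : ℝ} (h0 : 0 < β) (h1 : β ≤ 1) {g g' h : ℝ → ℝ}
    (hg : ContinuousOn g (Ici 0)) (hd : ∀ t, 0 < t → HasDerivAt g (g' t) t)
    (hg' : ContinuousOn g' (Ioi 0)) {C a : ℝ} (ha : 0 < a)
    (hC : ∀ t, 0 < t → |g' t| ≤ C * t ^ (a - 1))
    (hgi : ∀ μ : ℝ, 0 < μ → IntegrableOn (fun t => exp (-(μ * t)) * g t) (Ioi 0))
    (hh : ContinuousOn h (Ioi 0))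
    (hhi : ∀ μ : ℝ, 0 < μ → IntegrableOn (fun t => exp (-(μ * t)) * h t) (Ioi 0))
    (hL : ∀ μ : ℝ, 0 < μ → ∫ t in Ioi 0, exp (-(μ * t)) * g t =
      g 0 / μ + μ ^ (-β) * ∫ t in Ioi 0, exp (-(μ * t)) * h t) :
    HasCaputoDeriv β g h := by
  have hg'i := fun μ (hμ : 0 < μ) => integrableOn_exp_mul_of_bound hg' ha hμ hC
  -- Convolving with `t ^ (-β) / Γ(1 - β)` multiplies transforms by `μ ^ (β - 1)`, which undoes the
  -- factor found here. The Caputo integral of `g'` and `h` thus have equal transforms, and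
  -- continuity turns that into equality at every `t > 0`.
  have hLg' : ∀ μ : ℝ, 0 < μ → ∫ t in Ioi 0, exp (-(μ * t)) * g' t =
      μ ^ (1 - β) * ∫ t in Ioi 0, exp (-(μ * t)) * h t := by
    intro μ hμ
    rw [laplace_deriv (hg 0 self_mem_Ici) hd (hgi μ hμ) (hg'i μ hμ), hL μ hμ,
      sub_eq_add_neg 1 β, rpow_add hμ, rpow_one]
    field_simp
    ring
  have hder : ∀ t, 0 < t → deriv g t = g' t := fun t ht => (hd t ht).deriv
  rw [hasCaputoDeriv_iff_of_le_one h0 h1]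
  refine ⟨hg, fun t ht => (hd t ht).differentiableAt.differentiableWithinAt, fun t ht =>
    ⟨?_, fun hβ => ?_⟩⟩
  · rintro rfl
    rw [hder t ht]
    refine (eqOn_of_laplace hg' hh hg'i hhi (fun μ hμ => ?_) ht).symm
    simp [hLg' μ hμ]
  · have hb : 0 < 1 - β := sub_pos.2 (lt_of_le_of_ne h1 hβ)
    have hbe : -β = (1 - β) - 1 := by ring
    have hcongr : EqOn (fun s => deriv g s * (t - s) ^ (-β))
        (fun s => g' s * (t - s) ^ ((1 - β) - 1)) (Ioo 0 t) := by
      intro s hs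
      simp only [hder s hs.1, hbe]
    rw [integrableOn_congr_fun hcongr measurableSet_Ioo,
      setIntegral_congr_fun measurableSet_Ioo hcongr]
    refine ⟨integrableOn_mul_rpow_of_bound hg' ha hb hC ht, ?_⟩
    have hG := Gamma_pos_of_pos hb
    refine eqOn_of_laplace (F := h) (G := fun t => 1 / Gamma (1 - β) *
      ∫ s in Ioo 0 t, g' s * (t - s) ^ ((1 - β) - 1)) hh
      (continuousOn_const.mul (continuousOn_integral_mul_rpow hg' ha hb hC)) hhi
      (fun μ hμ => ?_) (fun μ hμ => ?_) ht
    · simp_rw [mul_left_comm (exp _)]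
      exact (laplace_integral_mul_rpow hμ hb (hg'i μ hμ)).1.const_mul _
    · simp_rw [mul_left_comm (exp _)]
      rw [integral_const_mul, (laplace_integral_mul_rpow hμ hb (hg'i μ hμ)).2, hLg' μ hμ,
        rpow_neg hμ.le]
      have := (rpow_pos_of_pos hμ (1 - β)).ne'
      field_simp

/-- Reduces an order in `(1, 2]` to an order in `(0, 1]` for the derivative, with one-sided
differentiability at `0`. -/
theorem HasCaputoDeriv.of_deriv {β : ℝ} (h0 : 0 < β) (h1 : β ≤ 1) {g k h : ℝ → ℝ}
    (hk : HasCaputoDeriv β k h) (hg : ∀ t, 0 ≤ t → HasDerivWithinAt g (k t) (Ici 0) t) :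
    HasCaputoDeriv (β + 1) g h := by
  rw [hasCaputoDeriv_iff_of_le_one h0 h1] at hk
  obtain ⟨hc, hdk, hE⟩ := hk
  have hder : ∀ t, 0 < t → deriv g t = k t := fun t ht =>
    ((hg t ht.le).hasDerivAt (Ici_mem_nhds ht)).deriv
  have hder2 : ∀ t, 0 < t → deriv (deriv g) t = deriv k t := fun t ht => by
    refine Filter.EventuallyEq.deriv_eq ?_
    filter_upwards [Ioi_mem_nhds ht] with s hs using hder s hs
  rw [hasCaputoDeriv_add_one_iff h0 h1]
  refine ⟨?_, hdk.congr fun t ht => hder t ht, fun t ht => ?_⟩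
  · rw [contDiffOn_one_iff_derivWithin (uniqueDiffOn_Ici 0)]
    refine ⟨fun t ht => (hg t ht).differentiableWithinAt, hc.congr fun t ht => ?_⟩
    exact (hg t ht).derivWithin (uniqueDiffOn_Ici 0 t ht)
  · have hcongr : EqOn (fun s => deriv (deriv g) s * (t - s) ^ (-β))
        (fun s => deriv k s * (t - s) ^ (-β)) (Ioo 0 t) := by
      intro s hs
      simp only [hder2 s hs.1]
    rw [integrableOn_congr_fun hcongr measurableSet_Ioo,
      setIntegral_congr_fun measurableSet_Ioo hcongr, hder2 t ht]
    exact hE t ht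

/-- The converse reduction, for uniqueness. `derivWithin` is needed because `deriv g 0` would depend
on values at negative times. -/
theorem HasCaputoDeriv.derivWithin {β : ℝ} (h0 : 0 < β) (h1 : β ≤ 1) {g h : ℝ → ℝ}
    (hg : HasCaputoDeriv (β + 1) g h) :
    HasCaputoDeriv β (derivWithin g (Ici 0)) h ∧
      ∀ t, 0 ≤ t → g t = g 0 + ∫ s in Ioo 0 t, derivWithin g (Ici 0) s := by
  rw [hasCaputoDeriv_add_one_iff h0 h1] at hg
  obtain ⟨hc, hdk, hE⟩ := hg
  rw [contDiffOn_one_iff_derivWithin (uniqueDiffOn_Ici 0)] at hc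
  set k := _root_.derivWithin g (Ici 0) with hkdef
  have hder : ∀ t, 0 < t → deriv g t = k t := fun t ht =>
    (derivWithin_of_mem_nhds (Ici_mem_nhds ht)).symm
  have hder2 : ∀ t, 0 < t → deriv (deriv g) t = deriv k t := fun t ht => by
    refine Filter.EventuallyEq.deriv_eq ?_
    filter_upwards [Ioi_mem_nhds ht] with s hs using hder s hs
  constructor
  · rw [hasCaputoDeriv_iff_of_le_one h0 h1]
    refine ⟨hc.2, hdk.congr fun t ht => (hder t ht).symm, fun t ht => ?_⟩
    have hcongr : EqOn (fun s => deriv (deriv g) s * (t - s) ^ (-β))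
        (fun s => deriv k s * (t - s) ^ (-β)) (Ioo 0 t) := by
      intro s hs
      simp only [hder2 s hs.1]
    have := hE t ht
    rwa [integrableOn_congr_fun hcongr measurableSet_Ioo,
      setIntegral_congr_fun measurableSet_Ioo hcongr, hder2 t ht] at this
  · intro t ht
    rw [← integral_Ioc_eq_integral_Ioo, ← intervalIntegral.integral_of_le ht,
      intervalIntegral.integral_eq_sub_of_hasDerivAt_of_le (f := g) ht
        (hc.1.continuousOn.mono Icc_subset_Ici_self) (fun s hs => ?_)
        (ContinuousOn.intervalIntegrable_of_Icc ht (hc.2.mono Icc_subset_Ici_self))]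
    · ring
    · exact (hc.1 s hs.1.le).hasDerivWithinAt.hasDerivAt (Ici_mem_nhds hs.1)

/-- A Caputo equation of order at most one is equivalent to a Volterra integral equation. -/
theorem HasCaputoDeriv.eq_add_integral {β : ℝ} (h0 : 0 < β) (h1 : β ≤ 1) {g h : ℝ → ℝ}
    (hg : HasCaputoDeriv β g h) (hh : ContinuousOn h (Ici 0)) {t : ℝ} (ht : 0 ≤ t) :
    g t = g 0 + 1 / Gamma β * ∫ s in Ioo 0 t, h s * (t - s) ^ (β - 1) := by
  rcases ht.eq_or_lt with rfl | ht
  · simp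
  rw [hasCaputoDeriv_iff_of_le_one h0 h1] at hg
  obtain ⟨hc, hd, hE⟩ := hg
  have hD : ∀ s ∈ Ioo 0 t, HasDerivAt g (deriv g s) s := fun s hs =>
    (hd.differentiableAt (Ioi_mem_nhds hs.1)).hasDerivAt
  have hFTC : IntegrableOn (deriv g) (Ioo 0 t) → ∫ s in Ioo 0 t, deriv g s = g t - g 0 := by
    intro hi
    rw [← integral_Ioc_eq_integral_Ioo, ← intervalIntegral.integral_of_le ht.le]
    refine intervalIntegral.integral_eq_sub_of_hasDerivAt_of_le ht.le
      (hc.mono Icc_subset_Ici_self) hD ?_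
    rwa [intervalIntegrable_iff_integrableOn_Ioo_of_le ht.le]
  rcases eq_or_ne β 1 with rfl | hβ
  · have hcongr : EqOn (fun s => h s * (t - s) ^ ((1 : ℝ) - 1)) (deriv g) (Ioo 0 t) := by
      intro s hs
      simp only [sub_self, rpow_zero, mul_one]
      exact (hE s hs.1).1 rfl
    have hi : IntegrableOn (deriv g) (Ioo 0 t) := by
      rw [← integrableOn_congr_fun hcongr measurableSet_Ioo]
      simp only [sub_self, rpow_zero, mul_one]
      exact ((hh.mono Icc_subset_Ici_self).integrableOn_Icc).mono_set Ioo_subset_Icc_self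
    rw [setIntegral_congr_fun measurableSet_Ioo hcongr, hFTC hi, Gamma_one]
    ring
  have hb : 0 < 1 - β := sub_pos.2 (lt_of_le_of_ne h1 hβ)
  have hG := Gamma_pos_of_pos hb
  have hGβ := Gamma_pos_of_pos h0
  -- The kernel `(t - s) ^ (-β)` is at least `t ^ (-β)` on `(0, t)`, so integrability against it is
  -- stronger.
  have hi : IntegrableOn (deriv g) (Ioo 0 t) := by
    have hit := ((hE t ht).2 hβ).1
    refine Integrable.mono' (hit.norm.const_mul (t ^ β))
      (measurable_deriv g).aestronglyMeasurable ?_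
    filter_upwards [ae_restrict_mem measurableSet_Ioo] with s hs
    have h2 : 0 < t - s := sub_pos.2 hs.2
    rw [norm_mul, norm_of_nonneg (rpow_pos_of_pos h2 _).le, mul_left_comm, rpow_neg h2.le,
      ← div_eq_mul_inv]
    refine le_mul_of_one_le_right (norm_nonneg _) ?_
    rw [one_le_div (rpow_pos_of_pos h2 _)]
    exact rpow_le_rpow h2.le (by linarith [hs.1]) h0.le
  -- Abel inversion: the two fractional kernels are placed on the triangle `r < s < t`. Integrating
  -- over `s` first gives the constant `Γ(1 - β) Γ(β)` and leaves `∫ g' = g t - g 0`; integrating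
  -- over `r` first gives the Volterra integral of `h`.
  set F : ℝ × ℝ → ℝ := fun z => indicator {z : ℝ × ℝ | z.1 < z.2}
    (fun z => deriv g z.1 * ((z.2 - z.1) ^ (-β) * (t - z.2) ^ (β - 1))) z with hF
  have hFm : Measurable F := by
    refine Measurable.indicator ?_ (measurableSet_lt measurable_fst measurable_snd)
    have := measurable_deriv g
    fun_prop
  have hker : ∀ r ∈ Ioo 0 t,
      IntegrableOn (fun s => (s - r) ^ (-β) * (t - s) ^ (β - 1)) (Ioo r t) ∧
      ∫ s in Ioo r t, (s - r) ^ (-β) * (t - s) ^ (β - 1) = Gamma (1 - β) * Gamma β := by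
    intro r hr
    have hval : ∫ s in Ioo r t, (s - r) ^ (-β) * (t - s) ^ (β - 1) = Gamma (1 - β) * Gamma β := by
      have hB := (integral_beta hb h0 (sub_pos.2 hr.2)).2
      rw [sub_add_cancel, sub_self, rpow_zero, one_mul, Gamma_one, div_one] at hB
      rw [← hB, ← integral_Ioc_eq_integral_Ioo, ← integral_Ioc_eq_integral_Ioo,
        ← intervalIntegral.integral_of_le hr.2.le,
        ← intervalIntegral.integral_of_le (sub_pos.2 hr.2).le]
      have := intervalIntegral.integral_comp_sub_right
        (fun x => x ^ (1 - β - 1) * (t - r - x) ^ (β - 1)) r (a := r) (b := t)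
      rw [sub_self] at this
      rw [← this]
      refine intervalIntegral.integral_congr fun s _ => ?_
      rw [show 1 - β - 1 = -β by ring, show t - r - (s - r) = t - s by ring]
    refine ⟨Integrable.of_integral_ne_zero ?_, hval⟩
    rw [hval]
    positivity
  have hset : ∀ r ∈ Ioo 0 t, Ioo 0 t ∩ Ioi r = Ioo r t := by
    intro r hr
    ext s
    simp only [mem_inter_iff, mem_Ioo, mem_Ioi]
    constructor
    · rintro ⟨⟨_, h2⟩, h3⟩; exact ⟨h3, h2⟩
    · rintro ⟨h2, h3⟩; exact ⟨⟨hr.1.trans h2, h3⟩, h2⟩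
  have hslice : ∀ r, (fun s => F (r, s)) = indicator (Ioi r)
      (fun s => deriv g r * ((s - r) ^ (-β) * (t - s) ^ (β - 1))) := by
    intro r; funext s
    simp only [hF, indicator, mem_ofPred_eq, mem_Ioi]
  have hslice_int : ∀ r ∈ Ioo 0 t, IntegrableOn (fun s => F (r, s)) (Ioo 0 t) ∧
      ∫ s in Ioo 0 t, F (r, s) = deriv g r * (Gamma (1 - β) * Gamma β) ∧
      ∫ s in Ioo 0 t, ‖F (r, s)‖ = ‖deriv g r‖ * (Gamma (1 - β) * Gamma β) := by
    intro r hr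
    obtain ⟨hk1, hk2⟩ := hker r hr
    have hnorm : (fun s => ‖F (r, s)‖) = indicator (Ioi r)
        (fun s => ‖deriv g r * ((s - r) ^ (-β) * (t - s) ^ (β - 1))‖) := by
      funext s
      rw [congrFun (hslice r) s, norm_indicator_eq_indicator_norm]
    refine ⟨?_, ?_, ?_⟩
    · rw [hslice, IntegrableOn, integrable_indicator_iff measurableSet_Ioi, IntegrableOn,
        Measure.restrict_restrict measurableSet_Ioi, inter_comm, hset r hr]
      exact hk1.const_mul _
    · rw [hslice, setIntegral_indicator measurableSet_Ioi, hset r hr, integral_const_mul, hk2]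
    · rw [hnorm, setIntegral_indicator measurableSet_Ioi, hset r hr, ← hk2, ← integral_const_mul]
      refine setIntegral_congr_fun measurableSet_Ioo fun s hs => ?_
      have h2 : 0 < s - r := sub_pos.2 hs.1
      have h3 : 0 < t - s := sub_pos.2 hs.2
      rw [norm_mul, norm_of_nonneg (by positivity : 0 ≤ (s - r) ^ (-β) * (t - s) ^ (β - 1))]
  have hFi : Integrable F ((volume.restrict (Ioo 0 t)).prod (volume.restrict (Ioo 0 t))) := by
    rw [integrable_prod_iff hFm.aestronglyMeasurable]
    refine ⟨?_, ?_⟩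
    · filter_upwards [ae_restrict_mem measurableSet_Ioo] with r hr using (hslice_int r hr).1
    · refine (hi.norm.mul_const (Gamma (1 - β) * Gamma β)).congr ?_
      filter_upwards [ae_restrict_mem measurableSet_Ioo] with r hr using (hslice_int r hr).2.2.symm
  have hswap := integral_integral_swap (f := fun r s => F (r, s)) hFi
  rw [setIntegral_congr_fun measurableSet_Ioo fun r hr => (hslice_int r hr).2.1,
    integral_mul_const, hFTC hi] at hswap
  have hrhs : ∀ s ∈ Ioo 0 t, ∫ r in Ioo 0 t, F (r, s) =
      Gamma (1 - β) * (h s * (t - s) ^ (β - 1)) := by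
    intro s hs
    have he : (fun r => F (r, s)) = indicator (Iio s)
        (fun r => deriv g r * ((s - r) ^ (-β) * (t - s) ^ (β - 1))) := by
      funext r
      simp only [hF, indicator, mem_ofPred_eq, mem_Iio]
    have hs2 : Ioo 0 t ∩ Iio s = Ioo 0 s := by
      ext r
      simp only [mem_inter_iff, mem_Ioo, mem_Iio]
      constructor
      · rintro ⟨⟨h2, _⟩, h3⟩; exact ⟨h2, h3⟩
      · rintro ⟨h2, h3⟩; exact ⟨⟨h2, h3.trans hs.2⟩, h3⟩
    rw [he, setIntegral_indicator measurableSet_Iio, hs2, ((hE s hs.1).2 hβ).2]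
    simp_rw [← mul_assoc]
    rw [integral_mul_const]
    field_simp
  rw [setIntegral_congr_fun measurableSet_Ioo hrhs, integral_const_mul] at hswap
  have : ∫ s in Ioo 0 t, h s * (t - s) ^ (β - 1) = Gamma β * (g t - g 0) := by
    have hne := hG.ne'
    apply mul_left_cancel₀ hne
    rw [← hswap]; ring
  rw [this]
  field_simp
  ring

/-! ### Uniqueness for Volterra equations by exponential weights -/

theorem exists_weight {β : ℝ} (h0 : 0 < β) (c : ℝ) :
    ∃ M : ℝ, 1 ≤ M ∧ |c| * M ^ (-β) ≤ 1 / 2 := by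
  have hb : (1 : ℝ) ≤ 2 * (|c| + 1) := by linarith [abs_nonneg c]
  refine ⟨(2 * (|c| + 1)) ^ (1 / β), one_le_rpow hb (by positivity), ?_⟩
  rw [← rpow_mul (by linarith), show 1 / β * -β = -1 by field_simp, rpow_neg_one]
  have : (0 : ℝ) < |c| + 1 := by linarith [abs_nonneg c]
  rw [mul_inv, ← mul_assoc, mul_comm |c|, mul_assoc, ← div_eq_mul_inv |c|]
  have h2 : |c| / (|c| + 1) ≤ 1 := (div_le_one this).2 (by linarith)
  linarith

/-- In the norm weighted by `exp (-M s)`, convolution with `s ^ (β - 1)` costs at most `∫ exp (-M r)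
r ^ (β - 1) dr`, small for large `M`. -/
theorem abs_integral_mul_rpow_le {β M S t : ℝ} (h0 : 0 < β) (hM : 0 < M) {f : ℝ → ℝ}
    (hS : 0 ≤ S) (hf : ∀ s ∈ Ioo 0 t, |f s| ≤ S * exp (M * s)) :
    |∫ s in Ioo 0 t, f s * (t - s) ^ (β - 1)| ≤ S * exp (M * t) * (M ^ (-β) * Gamma β) := by
  rcases le_or_gt t 0 with ht | ht
  · have := Gamma_pos_of_pos h0
    rw [Ioo_eq_empty (not_lt.2 ht)]
    simp only [Measure.restrict_empty, integral_zero_measure, abs_zero]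
    positivity
  have hk := integrableOn_rpow_mul_exp h0 hM
  have hkt : IntegrableOn (fun s => exp (-(M * (t - s))) * (t - s) ^ (β - 1)) (Ioo 0 t) := by
    have h1 : IntervalIntegrable (fun r => exp (-(M * r)) * r ^ (β - 1)) volume 0 t := by
      rw [intervalIntegrable_iff_integrableOn_Ioo_of_le ht.le]
      exact hk.mono_set Ioo_subset_Ioi_self
    have h2 := (h1.comp_sub_left t).symm
    rwa [sub_self, sub_zero, intervalIntegrable_iff_integrableOn_Ioo_of_le ht.le] at h2
  have hval : ∫ s in Ioo 0 t, exp (-(M * (t - s))) * (t - s) ^ (β - 1) ≤ M ^ (-β) * Gamma β := by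
    rw [← integral_Ioc_eq_integral_Ioo, ← intervalIntegral.integral_of_le ht.le,
      intervalIntegral.integral_comp_sub_left (fun r => exp (-(M * r)) * r ^ (β - 1)), sub_self,
      sub_zero, ← integral_exp_mul_rpow h0 hM, intervalIntegral.integral_of_le ht.le]
    refine setIntegral_mono_set hk ?_ (Ioc_subset_Ioi_self.eventuallyLE)
    filter_upwards [ae_restrict_mem measurableSet_Ioi] with r hr
    have hr : 0 < r := hr
    simp only [Pi.zero_apply]
    positivity
  calc |∫ s in Ioo 0 t, f s * (t - s) ^ (β - 1)|
      ≤ ∫ s in Ioo 0 t, S * exp (M * t) * (exp (-(M * (t - s))) * (t - s) ^ (β - 1)) := by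
        rw [← norm_eq_abs]
        refine norm_integral_le_of_norm_le (hkt.const_mul _) ?_
        filter_upwards [ae_restrict_mem measurableSet_Ioo] with s hs
        have h2 : 0 < t - s := sub_pos.2 hs.2
        rw [norm_mul, norm_of_nonneg (rpow_pos_of_pos h2 _).le, norm_eq_abs, ← mul_assoc,
          mul_assoc S, ← exp_add, show M * t + -(M * (t - s)) = M * s by ring]
        exact mul_le_mul_of_nonneg_right (hf s hs) (rpow_pos_of_pos h2 _).le
    _ ≤ S * exp (M * t) * (M ^ (-β) * Gamma β) := by
        rw [integral_const_mul]
        exact mul_le_mul_of_nonneg_left hval (by positivity)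

/-- The weighted supremum over `[0, t]` is attained by compactness, and the hypothesis makes it at
most half of itself. -/
theorem eq_zero_of_weighted_bound {g : ℝ → ℝ} (hg : ContinuousOn g (Ici 0)) {M : ℝ}
    (h : ∀ T S : ℝ, 0 ≤ S → (∀ s ∈ Icc 0 T, |g s| ≤ S * exp (M * s)) →
      ∀ s ∈ Icc 0 T, |g s| ≤ S / 2 * exp (M * s)) {t : ℝ} (ht : 0 ≤ t) : g t = 0 := by
  have hc : ContinuousOn (fun s => |g s| * exp (-(M * s))) (Icc 0 t) :=
    (hg.mono Icc_subset_Ici_self).abs.mul (by fun_prop)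
  obtain ⟨x, hx, hmax⟩ := isCompact_Icc.exists_isMaxOn (nonempty_Icc.2 ht) hc
  set S := |g x| * exp (-(M * x)) with hS
  have hS0 : 0 ≤ S := by positivity
  have hle : ∀ s ∈ Icc 0 t, |g s| ≤ S * exp (M * s) := by
    intro s hs
    have := mul_le_mul_of_nonneg_right (hmax hs) (exp_pos (M * s)).le
    simp only [mul_assoc, ← exp_add] at this
    simpa [hS, mul_assoc, ← exp_add] using this
  have h2 := h t S hS0 hle x hx
  have h3 : S ≤ S / 2 := by
    have := mul_le_mul_of_nonneg_right h2 (exp_pos (-(M * x))).le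
    rwa [mul_assoc, ← exp_add, add_neg_cancel, exp_zero, mul_one] at this
  have h4 : S = 0 := by linarith
  have := hle t ⟨ht, le_rfl⟩
  rw [h4, zero_mul] at this
  exact abs_nonpos_iff.1 this

theorem volterra_unique {β c : ℝ} (h0 : 0 < β) {g : ℝ → ℝ} (hg : ContinuousOn g (Ici 0))
    (h : ∀ t, 0 ≤ t → g t = 1 / Gamma β * ∫ s in Ioo 0 t, (c * g s) * (t - s) ^ (β - 1))
    {t : ℝ} (ht : 0 ≤ t) : g t = 0 := by
  obtain ⟨M, hM1, hM⟩ := exists_weight h0 c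
  have hG := Gamma_pos_of_pos h0
  refine eq_zero_of_weighted_bound hg (M := M) (fun T S hS hb s hs => ?_) ht
  rw [h s hs.1, abs_mul, abs_of_pos (by positivity)]
  have := abs_integral_mul_rpow_le (f := fun s => c * g s) (S := |c| * S) (t := s) h0
    (by linarith : 0 < M) (by positivity) (fun r hr => by
      rw [abs_mul, mul_assoc]
      exact mul_le_mul_of_nonneg_left (hb r ⟨hr.1.le, hr.2.le.trans hs.2⟩) (abs_nonneg _))
  calc 1 / Gamma β * |∫ r in Ioo 0 s, (c * g r) * (s - r) ^ (β - 1)|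
      ≤ 1 / Gamma β * (|c| * S * exp (M * s) * (M ^ (-β) * Gamma β)) := by gcongr
    _ = (|c| * M ^ (-β)) * (S * exp (M * s)) := by field_simp
    _ ≤ 1 / 2 * (S * exp (M * s)) := by gcongr
    _ = S / 2 * exp (M * s) := by ring

/-- The contraction happens in the passage from `g` to `k`; the extra integration costs a factor
`M⁻¹`, harmless since `1 ≤ M`. -/
theorem volterra_unique_of_deriv {β c : ℝ} (h0 : 0 < β) {g k : ℝ → ℝ}
    (hg : ContinuousOn g (Ici 0))
    (hk : ∀ t, 0 ≤ t → k t = 1 / Gamma β * ∫ s in Ioo 0 t, (c * g s) * (t - s) ^ (β - 1))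
    (hgk : ∀ t, 0 ≤ t → g t = ∫ s in Ioo 0 t, k s) {t : ℝ} (ht : 0 ≤ t) : g t = 0 := by
  obtain ⟨M, hM1, hM⟩ := exists_weight h0 c
  have hM0 : 0 < M := by linarith
  have hG := Gamma_pos_of_pos h0
  refine eq_zero_of_weighted_bound hg (M := M) (fun T S hS hb s hs => ?_) ht
  have hkb : ∀ r ∈ Icc 0 T, |k r| ≤ S / 2 * exp (M * r) := by
    intro s hs
    rw [hk s hs.1, abs_mul, abs_of_pos (by positivity)]
    have := abs_integral_mul_rpow_le (f := fun s => c * g s) (S := |c| * S) (t := s) h0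
      (by linarith : 0 < M) (by positivity) (fun r hr => by
        rw [abs_mul, mul_assoc]
        exact mul_le_mul_of_nonneg_left (hb r ⟨hr.1.le, hr.2.le.trans hs.2⟩) (abs_nonneg _))
    calc 1 / Gamma β * |∫ r in Ioo 0 s, (c * g r) * (s - r) ^ (β - 1)|
        ≤ 1 / Gamma β * (|c| * S * exp (M * s) * (M ^ (-β) * Gamma β)) := by gcongr
      _ = (|c| * M ^ (-β)) * (S * exp (M * s)) := by field_simp
      _ ≤ 1 / 2 * (S * exp (M * s)) := by gcongr
      _ = S / 2 * exp (M * s) := by ring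
  have := abs_integral_mul_rpow_le (β := 1) (f := k) (S := S / 2) (t := s) one_pos hM0
    (by positivity) fun r hr => hkb r ⟨hr.1.le, hr.2.le.trans hs.2⟩
  simp only [sub_self, rpow_zero, mul_one, Gamma_one, rpow_neg_one] at this
  rw [hgk s hs.1]
  refine this.trans ?_
  refine mul_le_of_le_one_right (by positivity) ?_
  exact inv_le_one_of_one_le₀ hM1

end Caputo

/-! ### Averages over the random time and the derivatives they satisfy -/

section Subordination

open Real Filter Topology

theorem integrable_pow_timeLaw {ν : ℝ} (h0 : 0 < ν) (h1 : ν ≤ 1) (n : ℕ) :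
    Integrable (fun y => y ^ n) (timeLaw ν) := by
  refine ⟨Measurable.aestronglyMeasurable (by fun_prop), ?_⟩
  rw [hasFiniteIntegral_iff_ofReal, lintegral_pow_timeLaw h0 h1]
  · exact ENNReal.ofReal_lt_top
  · filter_upwards [ae_timeLaw_pos ν] with y hy
    exact pow_nonneg hy.le n

/-- The mean of `y ^ j * q (t ^ ν * y)`, where `y` has the law of the random time at time `1`. -/
noncomputable def timeMean (ν : ℝ) (j : ℕ) (q : ℝ → ℝ) (t : ℝ) : ℝ :=
  ∫ y, y ^ j * q (t ^ ν * y) ∂(timeLaw ν)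

section TimeMean

variable {ν : ℝ} {q q' : ℝ → ℝ} {C : ℝ}

theorem norm_pow_mul_le (hC : ∀ s, 0 ≤ s → |q s| ≤ C) (j : ℕ) {t y : ℝ} (ht : 0 ≤ t)
    (hy : 0 < y) : ‖y ^ j * q (t ^ ν * y)‖ ≤ y ^ j * C := by
  rw [norm_mul, norm_of_nonneg (pow_nonneg hy.le j), norm_eq_abs]
  exact mul_le_mul_of_nonneg_left (hC _ (by positivity)) (by positivity)

theorem integrable_pow_mul (h0 : 0 < ν) (h1 : ν ≤ 1) (hq : Continuous q)
    (hC : ∀ s, 0 ≤ s → |q s| ≤ C) (j : ℕ) {t : ℝ} (ht : 0 ≤ t) :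
    Integrable (fun y => y ^ j * q (t ^ ν * y)) (timeLaw ν) := by
  refine Integrable.mono' ((integrable_pow_timeLaw h0 h1 j).mul_const C)
    (Continuous.aestronglyMeasurable (by fun_prop)) ?_
  filter_upwards [ae_timeLaw_pos ν] with y hy using norm_pow_mul_le hC j ht hy

theorem abs_timeMean_le (h0 : 0 < ν) (h1 : ν ≤ 1) (hC : ∀ s, 0 ≤ s → |q s| ≤ C) (j : ℕ)
    {t : ℝ} (ht : 0 ≤ t) : |timeMean ν j q t| ≤ (∫ y, y ^ j ∂(timeLaw ν)) * C := by
  rw [← integral_mul_const, ← norm_eq_abs]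
  refine norm_integral_le_of_norm_le ((integrable_pow_timeLaw h0 h1 j).mul_const C) ?_
  filter_upwards [ae_timeLaw_pos ν] with y hy using norm_pow_mul_le hC j ht hy

theorem timeMean_zero (h0 : 0 < ν) (h1 : ν ≤ 1) : timeMean ν 0 q 0 = q 0 := by
  have := isProbabilityMeasure_timeLaw h0 h1
  simp [timeMean, zero_rpow h0.ne']

theorem continuousOn_timeMean (h0 : 0 < ν) (h1 : ν ≤ 1) (hq : Continuous q)
    (hC : ∀ s, 0 ≤ s → |q s| ≤ C) (j : ℕ) : ContinuousOn (timeMean ν j q) (Ici 0) := by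
  refine continuousOn_of_dominated (bound := fun y => y ^ j * C)
    (fun t _ => Continuous.aestronglyMeasurable (by fun_prop)) (fun t ht => ?_)
    ((integrable_pow_timeLaw h0 h1 j).mul_const C) (ae_of_all _ fun y => ?_)
  · filter_upwards [ae_timeLaw_pos ν] with y hy using norm_pow_mul_le hC j ht hy
  · have : Continuous fun t : ℝ => t ^ ν := continuous_id.rpow_const fun _ => Or.inr h0.le
    exact Continuous.continuousOn (by fun_prop)

/-- The chain rule brings down a factor `y`, which is why `timeMean` carries a power `j`. -/
theorem hasDerivAt_timeMean (h0 : 0 < ν) (h1 : ν ≤ 1) (hq : ∀ s, HasDerivAt q (q' s) s)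
    (hq' : Continuous q') {C' : ℝ} (hC : ∀ s, 0 ≤ s → |q s| ≤ C)
    (hC' : ∀ s, 0 ≤ s → |q' s| ≤ C') (j : ℕ) {t : ℝ} (ht : 0 < t) :
    HasDerivAt (timeMean ν j q) (ν * t ^ (ν - 1) * timeMean ν (j + 1) q' t) t := by
  have hqc : Continuous q := continuous_iff_continuousAt.2 fun s => (hq s).continuousAt
  have h := hasDerivAt_integral_of_dominated_loc_of_deriv_le (μ := timeLaw ν)
    (F := fun t y => y ^ j * q (t ^ ν * y))
    (F' := fun t y => y ^ j * (q' (t ^ ν * y) * (ν * t ^ (ν - 1) * y)))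
    -- As `ν - 1 ≤ 0`, staying above `t / 2` bounds the possibly singular factor `s ^ (ν - 1)`.
    (bound := fun y => y ^ (j + 1) * (C' * (ν * (t / 2) ^ (ν - 1)))) (s := Ioi (t / 2))
    (Ioi_mem_nhds (by linarith : t / 2 < t))
    (Eventually.of_forall fun t => Continuous.aestronglyMeasurable (by fun_prop))
    (integrable_pow_mul h0 h1 hqc hC j ht.le)
    (Continuous.aestronglyMeasurable (by fun_prop)) ?_
    ((integrable_pow_timeLaw h0 h1 (j + 1)).mul_const _) ?_
  · refine h.2.congr_deriv ?_
    rw [timeMean, ← integral_const_mul]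
    congr 1; funext y; ring
  · filter_upwards [ae_timeLaw_pos ν] with y hy s hs
    have hs0 : 0 < s := lt_trans (by linarith) hs
    have h3 : s ^ (ν - 1) ≤ (t / 2) ^ (ν - 1) :=
      rpow_le_rpow_of_nonpos (by linarith) (le_of_lt hs) (by linarith)
    have h4 : |q' (s ^ ν * y)| ≤ C' := hC' _ (by positivity)
    have h5 : 0 ≤ C' := (abs_nonneg _).trans h4
    rw [norm_mul, norm_mul, norm_of_nonneg (pow_nonneg hy.le j), norm_eq_abs,
      norm_of_nonneg (by positivity : 0 ≤ ν * s ^ (ν - 1) * y)]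
    calc y ^ j * (|q' (s ^ ν * y)| * (ν * s ^ (ν - 1) * y))
        ≤ y ^ j * (C' * (ν * (t / 2) ^ (ν - 1) * y)) := by gcongr
      _ = y ^ (j + 1) * (C' * (ν * (t / 2) ^ (ν - 1))) := by ring
  · refine ae_of_all _ fun y s hs => HasDerivAt.const_mul _ ?_
    have hs0 : 0 < s := lt_trans (by linarith) hs
    have h2 : HasDerivAt (fun t : ℝ => t ^ ν * y) (ν * s ^ (ν - 1) * y) s :=
      (hasDerivAt_rpow_const (Or.inl hs0.ne')).mul_const y
    exact (hq _).comp s h2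

theorem laplace_timeMean (h0 : 0 < ν) (h1 : ν ≤ 1) (hq : Measurable q)
    (hC : ∀ s, 0 ≤ s → |q s| ≤ C) {μ : ℝ} (hμ : 0 < μ) :
    IntegrableOn (fun t => exp (-(μ * t)) * timeMean ν 0 q t) (Ioi 0) ∧
    ∫ t in Ioi 0, exp (-(μ * t)) * timeMean ν 0 q t =
      μ ^ (ν - 1) * ∫ s in Ioi 0, exp (-(μ ^ ν * s)) * q s := by
  simpa [timeMean] using laplace_integral_timeLaw h0 h1 hq (fun s hs => hC s hs.le) hμ

theorem laplace_deriv_of_bounded (hq : ∀ s, HasDerivAt q (q' s) s) (hq' : Continuous q')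
    {C' : ℝ} (hC : ∀ s, 0 ≤ s → |q s| ≤ C) (hC' : ∀ s, 0 ≤ s → |q' s| ≤ C') {μ : ℝ} (hμ : 0 < μ) :
    ∫ s in Ioi 0, exp (-(μ * s)) * q s = (q 0 + ∫ s in Ioi 0, exp (-(μ * s)) * q' s) / μ := by
  have hqc : Continuous q := continuous_iff_continuousAt.2 fun s => (hq s).continuousAt
  rw [laplace_deriv hqc.continuousWithinAt (fun t _ => hq t)
    (integrableOn_exp_mul_of_bound hqc.continuousOn one_pos hμ (C := C)
      fun t ht => by simpa using hC t ht.le)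
    (integrableOn_exp_mul_of_bound hq'.continuousOn one_pos hμ (C := C')
      fun t ht => by simpa using hC' t ht.le)]
  field_simp
  ring

theorem abs_deriv_timeMean_le (h0 : 0 < ν) (h1 : ν ≤ 1) (hC : ∀ s, 0 ≤ s → |q s| ≤ C)
    (j : ℕ) {t : ℝ} (ht : 0 < t) : |ν * t ^ (ν - 1) * timeMean ν j q t| ≤
      ν * ((∫ y, y ^ j ∂(timeLaw ν)) * C) * t ^ (ν - 1) := by
  rw [abs_mul, abs_of_pos (by positivity), mul_right_comm]
  exact mul_le_mul_of_nonneg_right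
    (mul_le_mul_of_nonneg_left (abs_timeMean_le h0 h1 hC j ht.le) h0.le) (by positivity)

theorem continuousOn_deriv_timeMean (h0 : 0 < ν) (h1 : ν ≤ 1) (hq : Continuous q)
    (hC : ∀ s, 0 ≤ s → |q s| ≤ C) (j : ℕ) :
    ContinuousOn (fun t => ν * t ^ (ν - 1) * timeMean ν j q t) (Ioi 0) :=
  (continuousOn_const.mul (continuousOn_id.rpow_const fun _ ht => Or.inl (ne_of_gt ht))).mul
    ((continuousOn_timeMean h0 h1 hq hC j).mono Ioi_subset_Ici_self)

/-- The random time turns the first derivative into the Caputo derivative of order `ν`. -/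
theorem hasCaputoDeriv_timeMean (h0 : 0 < ν) (h1 : ν ≤ 1) (hq : ∀ s, HasDerivAt q (q' s) s)
    (hq' : Continuous q') {C' : ℝ} (hC : ∀ s, 0 ≤ s → |q s| ≤ C)
    (hC' : ∀ s, 0 ≤ s → |q' s| ≤ C') :
    HasCaputoDeriv ν (timeMean ν 0 q) (timeMean ν 0 q') := by
  have hqc : Continuous q := continuous_iff_continuousAt.2 fun s => (hq s).continuousAt
  refine hasCaputoDeriv_of_laplace h0 h1 (continuousOn_timeMean h0 h1 hqc hC 0)
    (fun t ht => hasDerivAt_timeMean h0 h1 hq hq' hC hC' 0 ht)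
    (continuousOn_deriv_timeMean h0 h1 hq' hC' 1) h0
    (fun t ht => abs_deriv_timeMean_le h0 h1 hC' 1 ht)
    (fun μ hμ => (laplace_timeMean h0 h1 hqc.measurable hC hμ).1)
    ((continuousOn_timeMean h0 h1 hq' hC' 0).mono Ioi_subset_Ici_self)
    (fun μ hμ => (laplace_timeMean h0 h1 hq'.measurable hC' hμ).1) fun μ hμ => ?_
  have hμν : 0 < μ ^ ν := rpow_pos_of_pos hμ ν
  rw [(laplace_timeMean h0 h1 hqc.measurable hC hμ).2,
    (laplace_timeMean h0 h1 hq'.measurable hC' hμ).2,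
    laplace_deriv_of_bounded hq hq' hC hC' hμν, timeMean_zero h0 h1, rpow_sub_one hμ.ne',
    rpow_neg hμ.le]
  field_simp

variable {q'' : ℝ → ℝ} {C' C'' : ℝ}

theorem laplace_timeMean_second (h0 : 0 < ν) (h1 : ν ≤ 1) (hq : ∀ s, HasDerivAt q (q' s) s)
    (hq' : ∀ s, HasDerivAt q' (q'' s) s) (hq'' : Continuous q'') (hq'0 : q' 0 = 0)
    (hC : ∀ s, 0 ≤ s → |q s| ≤ C) (hC' : ∀ s, 0 ≤ s → |q' s| ≤ C')
    (hC'' : ∀ s, 0 ≤ s → |q'' s| ≤ C'') {μ : ℝ} (hμ : 0 < μ) :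
    ∫ t in Ioi 0, exp (-(μ * t)) * timeMean ν 0 q t = timeMean ν 0 q 0 / μ +
      μ ^ (-(2 * ν)) * ∫ t in Ioi 0, exp (-(μ * t)) * timeMean ν 0 q'' t := by
  have hqc : Continuous q := continuous_iff_continuousAt.2 fun s => (hq s).continuousAt
  have hqc' : Continuous q' := continuous_iff_continuousAt.2 fun s => (hq' s).continuousAt
  have hμν : 0 < μ ^ ν := rpow_pos_of_pos hμ ν
  rw [(laplace_timeMean h0 h1 hqc.measurable hC hμ).2,
    (laplace_timeMean h0 h1 hq''.measurable hC'' hμ).2,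
    laplace_deriv_of_bounded hq hqc' hC hC' hμν, laplace_deriv_of_bounded hq' hq'' hC' hC'' hμν,
    timeMean_zero h0 h1, rpow_sub_one hμ.ne', rpow_neg hμ.le, two_mul, rpow_add hμ, hq'0]
  field_simp
  ring

/-- Linear decay of `q'` at the origin becomes a factor `t ^ ν`, which compensates the singular `t ^
(ν - 1)` in the time derivative. -/
theorem abs_timeMean_succ_le (h0 : 0 < ν) (h1 : ν ≤ 1)
    (hlin : ∀ s, 0 ≤ s → |q' s| ≤ C'' * s) (j : ℕ) {t : ℝ} (ht : 0 ≤ t) :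
    |timeMean ν j q' t| ≤ C'' * (∫ y, y ^ (j + 1) ∂(timeLaw ν)) * t ^ ν := by
  rw [mul_right_comm, ← integral_const_mul, ← norm_eq_abs]
  refine norm_integral_le_of_norm_le ((integrable_pow_timeLaw h0 h1 (j + 1)).const_mul _) ?_
  filter_upwards [ae_timeLaw_pos ν] with y hy
  rw [norm_mul, norm_of_nonneg (pow_nonneg hy.le j), norm_eq_abs]
  have := mul_le_mul_of_nonneg_left (hlin (t ^ ν * y) (by positivity)) (pow_nonneg hy.le j)
  refine this.trans_eq ?_
  ring

/-- The random time turns the second derivative into the Caputo derivative of order `2 ν`, on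
functions with vanishing derivative at the origin. -/
theorem hasCaputoDeriv_timeMean_second (h0 : 0 < ν) (h1 : ν ≤ 1)
    (hq : ∀ s, HasDerivAt q (q' s) s)
    (hq' : ∀ s, HasDerivAt q' (q'' s) s) (hq'' : Continuous q'') (hq'0 : q' 0 = 0)
    (hC : ∀ s, 0 ≤ s → |q s| ≤ C) (hC' : ∀ s, 0 ≤ s → |q' s| ≤ C')
    (hC'' : ∀ s, 0 ≤ s → |q'' s| ≤ C'') :
    HasCaputoDeriv (2 * ν) (timeMean ν 0 q) (timeMean ν 0 q'') ∧
      (1 / 2 < ν → HasDerivWithinAt (timeMean ν 0 q) 0 (Ici 0) 0) := by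
  have hqc : Continuous q := continuous_iff_continuousAt.2 fun s => (hq s).continuousAt
  have hqc' : Continuous q' := continuous_iff_continuousAt.2 fun s => (hq' s).continuousAt
  have hL := fun (μ : ℝ) (hμ : 0 < μ) =>
    laplace_timeMean_second h0 h1 hq hq' hq'' hq'0 hC hC' hC'' hμ
  have hgi := fun (μ : ℝ) (hμ : 0 < μ) => (laplace_timeMean h0 h1 hqc.measurable hC hμ).1
  have hhi := fun (μ : ℝ) (hμ : 0 < μ) => (laplace_timeMean h0 h1 hq''.measurable hC'' hμ).1
  have hhc := (continuousOn_timeMean h0 h1 hq'' hC'' 0).mono Ioi_subset_Ici_self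
  have hgc := continuousOn_timeMean h0 h1 hqc hC 0
  have hgd := fun t (ht : 0 < t) => hasDerivAt_timeMean h0 h1 hq hqc' hC hC' 0 ht
  rcases le_or_gt (2 * ν) 1 with h2 | h2
  -- For `2 ν ≤ 1` only one classical derivative enters, so the Laplace criterion applies directly.
  · refine ⟨hasCaputoDeriv_of_laplace (by linarith) h2 hgc hgd
      (continuousOn_deriv_timeMean h0 h1 hqc' hC' 1) h0
      (fun t ht => abs_deriv_timeMean_le h0 h1 hC' 1 ht) hgi hhc hhi hL, fun h => ?_⟩
    linarith
  have hC''0 : 0 ≤ C'' := (abs_nonneg _).trans (hC'' 0 le_rfl)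
  have hlin : ∀ s, 0 ≤ s → |q' s| ≤ C'' * s := by
    intro s hs
    have := (convex_Ici (0 : ℝ)).norm_image_sub_le_of_norm_hasDerivWithin_le
      (fun x _ => (hq' x).hasDerivWithinAt) (fun x hx => hC'' x hx) self_mem_Ici
      (mem_Ici.2 hs)
    simpa [hq'0, abs_of_nonneg hs] using this
  -- For `2 ν > 1`, `k` is the time derivative of the mean. From `q' 0 = 0` it is `O(t ^ (2 ν -
  -- 1))`, hence continuous with value `0` at the origin, and the Laplace criterion is applied to it
  -- with order `2 ν - 1`.
  set k : ℝ → ℝ := fun t => ν * t ^ (ν - 1) * timeMean ν 1 q' t with hk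
  set k' : ℝ → ℝ := fun t => ν * ((ν - 1) * t ^ (ν - 1 - 1)) * timeMean ν 1 q' t +
    ν * t ^ (ν - 1) * (ν * t ^ (ν - 1) * timeMean ν 2 q'' t) with hk'
  set A := ∫ y, y ^ 2 ∂(timeLaw ν) with hA
  have hA0 : 0 ≤ A := integral_nonneg fun y => sq_nonneg y
  have hk0 : k 0 = 0 := by
    simp only [hk, timeMean, zero_rpow h0.ne', zero_mul, hq'0, mul_zero, integral_zero]
  have hkb : ∀ t, 0 < t → |k t| ≤ ν * (C'' * A) * t ^ (2 * ν - 1) := by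
    intro t ht
    have := abs_timeMean_succ_le h0 h1 hlin 1 ht.le
    simp only [hk]
    rw [abs_mul, abs_of_pos (by positivity)]
    calc ν * t ^ (ν - 1) * |timeMean ν 1 q' t| ≤ ν * t ^ (ν - 1) * (C'' * A * t ^ ν) := by
          gcongr
      _ = ν * (C'' * A) * t ^ (2 * ν - 1) := by
          rw [show 2 * ν - 1 = (ν - 1) + ν by ring, rpow_add ht]; ring
  have hkd : ∀ t, 0 < t → HasDerivAt k (k' t) t := by
    intro t ht
    exact ((hasDerivAt_rpow_const (Or.inl ht.ne')).const_mul ν).mul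
      (hasDerivAt_timeMean h0 h1 hq' hq'' hC' hC'' 1 ht)
  have hk'b : ∀ t, 0 < t →
      |k' t| ≤ (ν * |ν - 1| * (C'' * A) + ν * ν * (A * C'')) * t ^ ((2 * ν - 1) - 1) := by
    intro t ht
    have e1 := abs_timeMean_succ_le h0 h1 hlin 1 ht.le
    have e2 := abs_timeMean_le h0 h1 hC'' 2 ht.le
    have p1 := rpow_pos_of_pos ht (ν - 1 - 1)
    have p2 := rpow_pos_of_pos ht (ν - 1)
    calc |k' t| ≤ |ν * ((ν - 1) * t ^ (ν - 1 - 1)) * timeMean ν 1 q' t| +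
          |ν * t ^ (ν - 1) * (ν * t ^ (ν - 1) * timeMean ν 2 q'' t)| := abs_add_le _ _
      _ = ν * |ν - 1| * t ^ (ν - 1 - 1) * |timeMean ν 1 q' t| +
          ν * ν * (t ^ (ν - 1) * t ^ (ν - 1)) * |timeMean ν 2 q'' t| := by
          simp only [abs_mul, abs_of_pos h0, abs_of_pos p1, abs_of_pos p2]; ring
      _ ≤ ν * |ν - 1| * t ^ (ν - 1 - 1) * (C'' * A * t ^ ν) +
          ν * ν * (t ^ (ν - 1) * t ^ (ν - 1)) * (A * C'') := by gcongr
      _ = (ν * |ν - 1| * (C'' * A) + ν * ν * (A * C'')) * t ^ ((2 * ν - 1) - 1) := by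
          rw [← rpow_add ht, show 2 * ν - 1 - 1 = (ν - 1 - 1) + ν by ring,
            show ν - 1 + (ν - 1) = (ν - 1 - 1) + ν by ring, rpow_add ht]; ring
  have hpow : ∀ c : ℝ, ContinuousOn (fun t : ℝ => t ^ c) (Ioi 0) := fun c =>
    continuousOn_id.rpow_const fun t ht => Or.inl (ne_of_gt ht)
  have hkc : ContinuousOn k (Ici 0) := by
    intro t ht
    rcases (mem_Ici.1 ht).eq_or_lt with rfl | ht
    · rw [ContinuousWithinAt, hk0]
      refine squeeze_zero_norm' (a := fun t : ℝ => ν * (C'' * A) * t ^ (2 * ν - 1)) ?_ ?_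
      · filter_upwards [self_mem_nhdsWithin] with t ht
        rcases (mem_Ici.1 ht).eq_or_lt with rfl | ht
        · rw [hk0, norm_zero, zero_rpow (by linarith), mul_zero]
        · exact hkb t ht
      · have hc : Continuous fun t : ℝ => ν * (C'' * A) * t ^ (2 * ν - 1) :=
          continuous_const.mul (continuous_id.rpow_const fun _ => Or.inr (by linarith))
        have := hc.tendsto 0
        rw [zero_rpow (by linarith), mul_zero] at this
        exact this.mono_left nhdsWithin_le_nhds
    · exact (hkd t ht).continuousAt.continuousWithinAt
  have hk'c : ContinuousOn k' (Ioi 0) :=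
    ((continuousOn_const.mul (continuousOn_const.mul (hpow _))).mul
      ((continuousOn_timeMean h0 h1 hqc' hC' 1).mono Ioi_subset_Ici_self)).add
    ((continuousOn_const.mul (hpow _)).mul (continuousOn_deriv_timeMean h0 h1 hq'' hC'' 2))
  have hki : ∀ μ : ℝ, 0 < μ → IntegrableOn (fun t => exp (-(μ * t)) * k t) (Ioi 0) :=
    fun μ hμ => integrableOn_exp_mul_of_bound (hkc.mono Ioi_subset_Ici_self)
      (by linarith : 0 < 2 * ν) hμ hkb
  have hcap : HasCaputoDeriv (2 * ν - 1) k (timeMean ν 0 q'') := by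
    refine hasCaputoDeriv_of_laplace (by linarith) (by linarith) hkc hkd hk'c
      (by linarith : 0 < 2 * ν - 1) hk'b hki hhc hhi fun μ hμ => ?_
    rw [laplace_deriv (hgc 0 self_mem_Ici) hgd (hgi μ hμ) (hki μ hμ), hL μ hμ, hk0, neg_sub,
      sub_eq_add_neg 1, rpow_add hμ, rpow_one]
    field_simp
    ring
  -- At `t = 0` the one-sided derivative is obtained as the limit of the derivatives at positive
  -- times.
  have hg0 : ∀ t, 0 ≤ t → HasDerivWithinAt (timeMean ν 0 q) (k t) (Ici 0) t := by
    intro t ht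
    rcases ht.eq_or_lt with rfl | ht
    · refine hasDerivWithinAt_Ici_of_tendsto_deriv (s := Ioi 0)
        (fun t ht => (hgd t ht).differentiableAt.differentiableWithinAt)
        ((hgc 0 self_mem_Ici).mono Ioi_subset_Ici_self) self_mem_nhdsWithin ?_
      have := (hkc 0 self_mem_Ici).mono_left (nhdsWithin_mono _ Ioi_subset_Ici_self)
      refine this.congr' ?_
      filter_upwards [self_mem_nhdsWithin] with t ht using (hgd t ht).deriv.symm
    · exact (hgd t ht).hasDerivWithinAt
  refine ⟨?_, fun _ => ?_⟩
  · have := HasCaputoDeriv.of_deriv (by linarith) (by linarith) hcap hg0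
    rwa [sub_add_cancel] at this
  · have := hg0 0 le_rfl
    rwa [hk0] at this

end TimeMean

section Uniqueness

theorem integrableOn_continuousOn_mul_rpow {f : ℝ → ℝ} (hf : ContinuousOn f (Ici 0)) {b t : ℝ}
    (hb : 0 < b) : IntegrableOn (fun s => f s * (t - s) ^ (b - 1)) (Ioo 0 t) := by
  rcases le_or_gt t 0 with ht | ht
  · rw [Ioo_eq_empty (not_lt.2 ht)]; simp
  have h1 := (integral_beta one_pos hb ht).1
  simp only [sub_self, rpow_zero, one_mul] at h1
  rw [← integrableOn_Icc_iff_integrableOn_Ioo] at h1 ⊢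
  exact h1.continuousOn_mul (hf.mono Icc_subset_Ici_self) isCompact_Icc

/-- The difference of the two Volterra equations is homogeneous. The forcing `r` accommodates the
preceding state of the birth equations. -/
theorem caputo_unique {β c : ℝ} (h0 : 0 < β) (h1 : β ≤ 1) {g₁ g₂ r : ℝ → ℝ}
    (hr : ContinuousOn r (Ici 0)) (hg₁ : HasCaputoDeriv β g₁ fun t => c * g₁ t + r t)
    (hg₂ : HasCaputoDeriv β g₂ fun t => c * g₂ t + r t) (hg0 : g₁ 0 = g₂ 0) {t : ℝ} (ht : 0 ≤ t) :
    g₁ t = g₂ t := by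
  have c₁ := ((hasCaputoDeriv_iff_of_le_one h0 h1).1 hg₁).1
  have c₂ := ((hasCaputoDeriv_iff_of_le_one h0 h1).1 hg₂).1
  have d₁ : ContinuousOn (fun t => c * g₁ t + r t) (Ici 0) := (continuousOn_const.mul c₁).add hr
  have d₂ : ContinuousOn (fun t => c * g₂ t + r t) (Ici 0) := (continuousOn_const.mul c₂).add hr
  refine sub_eq_zero.1 (volterra_unique (c := c) (g := fun t => g₁ t - g₂ t) h0 (c₁.sub c₂)
    (fun t ht => ?_) ht)
  rw [hg₁.eq_add_integral h0 h1 d₁ ht, hg₂.eq_add_integral h0 h1 d₂ ht, hg0, add_sub_add_left_eq_sub,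
    ← mul_sub, ← integral_sub (integrableOn_continuousOn_mul_rpow d₁ h0)
      (integrableOn_continuousOn_mul_rpow d₂ h0)]
  congr 2; funext s; ring

theorem caputo_unique_of_derivWithin {β c : ℝ} (h0 : 0 < β) (h1 : β ≤ 1) {g₁ g₂ : ℝ → ℝ}
    (hg₁ : HasCaputoDeriv (β + 1) g₁ fun t => c * g₁ t)
    (hg₂ : HasCaputoDeriv (β + 1) g₂ fun t => c * g₂ t) (hg0 : g₁ 0 = g₂ 0)
    (hd : derivWithin g₁ (Ici 0) 0 = derivWithin g₂ (Ici 0) 0) {t : ℝ} (ht : 0 ≤ t) :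
    g₁ t = g₂ t := by
  have c₁ := ((hasCaputoDeriv_add_one_iff h0 h1).1 hg₁).1.continuousOn
  have c₂ := ((hasCaputoDeriv_add_one_iff h0 h1).1 hg₂).1.continuousOn
  obtain ⟨k₁, i₁⟩ := hg₁.derivWithin h0 h1
  obtain ⟨k₂, i₂⟩ := hg₂.derivWithin h0 h1
  have ck₁ := ((hasCaputoDeriv_iff_of_le_one h0 h1).1 k₁).1
  have ck₂ := ((hasCaputoDeriv_iff_of_le_one h0 h1).1 k₂).1
  have d₁ : ContinuousOn (fun t => c * g₁ t) (Ici 0) := continuousOn_const.mul c₁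
  have d₂ : ContinuousOn (fun t => c * g₂ t) (Ici 0) := continuousOn_const.mul c₂
  refine sub_eq_zero.1 (volterra_unique_of_deriv (c := c) (g := fun t => g₁ t - g₂ t)
    (k := fun t => derivWithin g₁ (Ici 0) t - derivWithin g₂ (Ici 0) t) h0 (c₁.sub c₂)
    (fun t ht => ?_) (fun t ht => ?_) ht)
  · rw [k₁.eq_add_integral h0 h1 d₁ ht, k₂.eq_add_integral h0 h1 d₂ ht, hd,
      add_sub_add_left_eq_sub, ← mul_sub, ← integral_sub (integrableOn_continuousOn_mul_rpow d₁ h0)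
      (integrableOn_continuousOn_mul_rpow d₂ h0)]
    congr 2; funext s; ring
  · have hi : ∀ k : ℝ → ℝ, ContinuousOn k (Ici 0) → IntegrableOn k (Ioo 0 t) := fun k hk =>
      ((hk.mono Icc_subset_Ici_self).integrableOn_Icc).mono_set Ioo_subset_Icc_self
    rw [i₁ t ht, i₂ t ht, hg0, add_sub_add_left_eq_sub, ← integral_sub (hi _ ck₁) (hi _ ck₂)]

end Uniqueness

end Subordination

/-! ### The fundamental solution and its uniqueness -/

section FundamentalSolution

open Real Filter Topology

/-- The law of the random time at time `t`. -/
noncomputable def randomLaw (ν t : ℝ) : Measure ℝ := (timeLaw ν).map fun y => t ^ ν * y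

/-- The symmetrized law of the random time at time `t`. -/
noncomputable def symLaw (ν t : ℝ) : Measure ℝ :=
  (2⁻¹ : NNReal) • (randomLaw ν t + (timeLaw ν).map fun y => -(t ^ ν * y))

instance {ν t : ℝ} [IsFiniteMeasure (timeLaw ν)] : IsFiniteMeasure (randomLaw ν t) := by
  unfold randomLaw; infer_instance

instance {ν t : ℝ} [IsFiniteMeasure (timeLaw ν)] : IsFiniteMeasure (symLaw ν t) := by
  unfold symLaw; infer_instance

theorem integral_randomLaw {ν t : ℝ} {q : ℝ → ℝ} (hq : Measurable q) :
    ∫ s, q s ∂(randomLaw ν t) = timeMean ν 0 q t := by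
  rw [randomLaw, integral_map (by fun_prop) hq.aestronglyMeasurable]
  simp [timeMean]

theorem integral_symLaw {ν t : ℝ} [IsFiniteMeasure (timeLaw ν)] {φ : ℝ → ℝ} (hφ : Continuous φ)
    {C : ℝ} (hC : ∀ x, |φ x| ≤ C) :
    ∫ x, φ x ∂(symLaw ν t) = timeMean ν 0 (fun s => (φ s + φ (-s)) / 2) t := by
  have hi : ∀ ρ : Measure ℝ, IsFiniteMeasure ρ → ∀ f : ℝ → ℝ, Continuous f →
      Integrable (fun x => φ (f x)) ρ := fun ρ _ f hf =>
    Integrable.mono' (integrable_const C) (by fun_prop) (ae_of_all _ fun x => hC _)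
  have hi' : ∀ ρ : Measure ℝ, IsFiniteMeasure ρ → Integrable φ ρ := fun ρ h =>
    hi ρ h _ continuous_id
  rw [symLaw, integral_smul_nnreal_measure, integral_add_measure (hi' _ inferInstance)
    (hi' _ inferInstance), randomLaw, integral_map (by fun_prop) (by fun_prop),
    integral_map (by fun_prop) (by fun_prop), ← integral_add (hi _ inferInstance _ (by fun_prop))
    (hi _ inferInstance _ (by fun_prop)), timeMean, NNReal.smul_def,
    smul_eq_mul, ← integral_const_mul]
  refine integral_congr_ae (ae_of_all _ fun y => ?_)
  simp only [NNReal.coe_inv, NNReal.coe_ofNat, pow_zero, one_mul]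
  ring

/-- The fundamental solution: the symmetrized law of the random time. -/
noncomputable def fundamentalSolution (ν : ℝ) [IsFiniteMeasure (timeLaw ν)] (t : ℝ) :
    SignedMeasure ℝ := (symLaw ν t).toSignedMeasure

theorem IsTestFunction.hasDerivAt {φ : ℝ → ℝ} (hφ : IsTestFunction φ) (n : ℕ) (x : ℝ) :
    HasDerivAt (iteratedDeriv n φ) (iteratedDeriv (n + 1) φ x) x := by
  rw [iteratedDeriv_succ]
  exact ((hφ.1.differentiable_iteratedDeriv n (by exact_mod_cast WithTop.coe_lt_top n)) x).hasDerivAt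

theorem isFundamentalSolution_fundamentalSolution {ν : ℝ} (h0 : 0 < ν) (h1 : ν ≤ 1)
    [IsFiniteMeasure (timeLaw ν)] : IsFundamentalSolution ν (fundamentalSolution ν) := by
  have key : ∀ φ : ℝ → ℝ, IsTestFunction φ →
      HasCaputoDeriv (2 * ν) (fun t => ∫ᵛ x, φ x ∂<•(fundamentalSolution ν t))
        (fun t => ∫ᵛ x, iteratedDeriv 2 φ x ∂<•(fundamentalSolution ν t)) ∧
      (1 / 2 < ν → HasDerivWithinAt (fun t => ∫ᵛ x, φ x ∂<•(fundamentalSolution ν t)) 0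
        (Ici 0) 0) := by
    intro φ hφ
    have hd0 : ∀ x, HasDerivAt φ (iteratedDeriv 1 φ x) x := fun x => by
      simpa using hφ.hasDerivAt 0 x
    have hd1 := hφ.hasDerivAt 1
    have hc0 : Continuous φ := hφ.1.continuous
    have hc2 : Continuous (iteratedDeriv 2 φ) :=
      continuous_iff_continuousAt.2 fun x => (hφ.hasDerivAt 2 x).continuousAt
    obtain ⟨C0, hC0⟩ := hφ.2 0
    obtain ⟨C1, hC1⟩ := hφ.2 1
    obtain ⟨C2, hC2⟩ := hφ.2 2
    rw [iteratedDeriv_zero] at hC0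
    have hb : ∀ a b C : ℝ, |a| ≤ C → |b| ≤ C → |(a + b) / 2| ≤ C := by
      intro a b C ha hb
      rw [abs_div, abs_two, div_le_iff₀ two_pos]
      exact (abs_add_le a b).trans (by linarith)
    -- Symmetrizing the measure replaces `φ` by its even part, whose derivative vanishes at the
    -- origin; this supplies the hypothesis on `q' 0`.
    have h := hasCaputoDeriv_timeMean_second (ν := ν) h0 h1
      (q := fun s => (φ s + φ (-s)) / 2)
      (q' := fun s => (iteratedDeriv 1 φ s + -iteratedDeriv 1 φ (-s)) / 2)
      (q'' := fun s => (iteratedDeriv 2 φ s + iteratedDeriv 2 φ (-s)) / 2)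
      (C := C0) (C' := C1) (C'' := C2)
      (fun s => by
        have := ((hd0 s).add ((hd0 (-s)).comp s (hasDerivAt_neg s))).div_const 2
        simpa using! this)
      (fun s => by
        have := ((hd1 s).add ((hd1 (-s)).comp s (hasDerivAt_neg s)).neg).div_const 2
        simpa using! this)
      (by fun_prop) (by simp) (fun s _ => hb _ _ _ (hC0 _) (hC0 _))
      (fun s _ => hb _ _ _ (hC1 _) (by rw [abs_neg]; exact hC1 _))
      (fun s _ => hb _ _ _ (hC2 _) (hC2 _))
    have e0 : ∀ t, ∫ᵛ x, φ x ∂<•(fundamentalSolution ν t) =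
        timeMean ν 0 (fun s => (φ s + φ (-s)) / 2) t := fun t => by
      rw [fundamentalSolution, VectorMeasure.integral_toSignedMeasure, integral_symLaw hc0 hC0]
    have e2 : ∀ t, ∫ᵛ x, iteratedDeriv 2 φ x ∂<•(fundamentalSolution ν t) =
        timeMean ν 0 (fun s => (iteratedDeriv 2 φ s + iteratedDeriv 2 φ (-s)) / 2) t := fun t => by
      rw [fundamentalSolution, VectorMeasure.integral_toSignedMeasure, integral_symLaw hc2 hC2]
    simp only [e0, e2]
    exact h
  refine ⟨?_, fun φ hφ => (key φ hφ).1, fun hν φ hφ =>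
    ((key φ hφ).2 hν).derivWithin (uniqueDiffOn_Ici 0 0 self_mem_Ici)⟩
  have := isProbabilityMeasure_timeLaw h0 h1
  have hs : symLaw ν 0 = Measure.dirac 0 := by
    simp only [symLaw, randomLaw, zero_rpow h0.ne', zero_mul, neg_zero, Measure.map_const,
      measure_univ, one_smul]
    rw [← two_smul NNReal, smul_smul]
    simp
  simp only [fundamentalSolution, hs]

/-- For `t > 0` the law of the random time lives on `(0, ∞)` and its reflection gives that set no
mass, so doubling undoes the factor `1 / 2`. -/
theorem isFoldedLaw_randomLaw {ν : ℝ} (h0 : 0 < ν) (h1 : ν ≤ 1) [IsFiniteMeasure (timeLaw ν)] :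
    IsFoldedLaw (fundamentalSolution ν) (randomLaw ν) := by
  have := isProbabilityMeasure_timeLaw h0 h1
  refine ⟨?_, fun t _ => Measure.isProbabilityMeasure_map (by fun_prop), fun t ht B hB => ?_⟩
  · simp [randomLaw, zero_rpow h0.ne']
  · have hBI := hB.inter (measurableSet_Ioi (a := (0 : ℝ)))
    have htν := rpow_pos_of_pos ht ν
    have m1 : (randomLaw ν t).real (B ∩ Ioi 0) = (randomLaw ν t).real B := by
      refine measureReal_congr ?_
      have : ∀ᵐ x ∂(randomLaw ν t), x ∈ Ioi (0 : ℝ) := by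
        rw [randomLaw, ae_map_iff (p := fun x => x ∈ Ioi (0 : ℝ)) (by fun_prop) measurableSet_Ioi]
        filter_upwards [ae_timeLaw_pos ν] with y hy using mul_pos htν hy
      filter_upwards [this] with x hx
      exact propext ⟨fun h => h.1, fun h => ⟨h, hx⟩⟩
    have m2 : ((timeLaw ν).map fun y => -(t ^ ν * y)).real (B ∩ Ioi 0) = 0 := by
      rw [measureReal_def, Measure.map_apply (by fun_prop) hBI]
      have : (timeLaw ν) ((fun y => -(t ^ ν * y)) ⁻¹' (B ∩ Ioi 0)) = 0 := by
        refine measure_mono_null (fun y hy => ?_) (ae_iff.1 (ae_timeLaw_pos ν))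
        have h2 : 0 < -(t ^ ν * y) := hy.2
        intro h3
        have := mul_pos htν h3
        linarith
      rw [this, ENNReal.toReal_zero]
    rw [fundamentalSolution, Measure.toSignedMeasure_apply_measurable hBI, symLaw,
      measureReal_nnreal_smul_apply, measureReal_add_apply, m1, m2]
    push_cast
    ring

theorem iteratedDeriv_trig (ξ : ℝ) (n : ℕ) (a b : ℝ) : ∃ a' b' : ℝ,
    iteratedDeriv n (fun x => a * cos (ξ * x) + b * sin (ξ * x)) =
      fun x => a' * cos (ξ * x) + b' * sin (ξ * x) := by
  induction n generalizing a b with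
  | zero => exact ⟨a, b, by simp⟩
  | succ n ih =>
    rw [iteratedDeriv_succ']
    have : deriv (fun x => a * cos (ξ * x) + b * sin (ξ * x)) =
        fun x => (b * ξ) * cos (ξ * x) + (-a * ξ) * sin (ξ * x) := by
      funext x
      have h := (hasDerivAt_id x).const_mul ξ
      have := (h.cos.const_mul a).add (h.sin.const_mul b)
      refine HasDerivAt.deriv (this.congr_deriv ?_)
      simp only [id]
      ring
    rw [this]
    exact ih _ _

theorem isTestFunction_trig (ξ a b : ℝ) :
    IsTestFunction fun x => a * cos (ξ * x) + b * sin (ξ * x) := by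
  refine ⟨by fun_prop, fun n => ?_⟩
  obtain ⟨a', b', h⟩ := iteratedDeriv_trig ξ n a b
  refine ⟨|a'| + |b'|, fun x => ?_⟩
  rw [h]
  refine (abs_add_le _ _).trans ?_
  rw [abs_mul, abs_mul]
  exact add_le_add (mul_le_of_le_one_right (abs_nonneg _) (abs_cos_le_one _))
    (mul_le_of_le_one_right (abs_nonneg _) (abs_sin_le_one _))

theorem iteratedDeriv_two_trig (ξ a b : ℝ) :
    iteratedDeriv 2 (fun x => a * cos (ξ * x) + b * sin (ξ * x)) =
      fun x => -ξ ^ 2 * (a * cos (ξ * x) + b * sin (ξ * x)) := by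
  have hd : ∀ a b : ℝ, deriv (fun x => a * cos (ξ * x) + b * sin (ξ * x)) =
      fun x => (b * ξ) * cos (ξ * x) + (-a * ξ) * sin (ξ * x) := by
    intro a b
    funext x
    have h := (hasDerivAt_id x).const_mul ξ
    have := (h.cos.const_mul a).add (h.sin.const_mul b)
    refine HasDerivAt.deriv (this.congr_deriv ?_)
    simp only [id]
    ring
  rw [iteratedDeriv_succ, iteratedDeriv_one, hd, hd]
  funext x; ring

/-- Trigonometric functions are test functions and eigenfunctions of `d²/ds²` with eigenvalue `-ξ ^
2`, so each pairing solves a scalar Caputo equation with fixed initial data. -/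
theorem IsFundamentalSolution.integral_trig_eq {ν : ℝ} (h0 : 0 < ν) (h1 : ν ≤ 1)
    {u v : ℝ → SignedMeasure ℝ} (hu : IsFundamentalSolution ν u) (hv : IsFundamentalSolution ν v)
    (ξ a b : ℝ) {t : ℝ} (ht : 0 ≤ t) :
    ∫ᵛ x, (a * cos (ξ * x) + b * sin (ξ * x)) ∂<•(v t) =
      ∫ᵛ x, (a * cos (ξ * x) + b * sin (ξ * x)) ∂<•(u t) := by
  have hφ := isTestFunction_trig ξ a b
  have hE : ∀ w : ℝ → SignedMeasure ℝ, IsFundamentalSolution ν w → HasCaputoDeriv (2 * ν)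
      (fun t => ∫ᵛ x, (a * cos (ξ * x) + b * sin (ξ * x)) ∂<•(w t))
      (fun t => -ξ ^ 2 * ∫ᵛ x, (a * cos (ξ * x) + b * sin (ξ * x)) ∂<•(w t)) := by
    intro w hw
    have := hw.equation _ hφ
    rw [iteratedDeriv_two_trig] at this
    convert this using 2 with t
    exact (VectorMeasure.integral_fun_smul (μ := w t) _ (-ξ ^ 2) _).symm
  have hi : (fun t => ∫ᵛ x, (a * cos (ξ * x) + b * sin (ξ * x)) ∂<•(v t)) 0 =
      (fun t => ∫ᵛ x, (a * cos (ξ * x) + b * sin (ξ * x)) ∂<•(u t)) 0 := by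
    simp only [hu.initial, hv.initial]
  set gv := fun t => ∫ᵛ x, (a * cos (ξ * x) + b * sin (ξ * x)) ∂<•(v t) with hgv
  set gu := fun t => ∫ᵛ x, (a * cos (ξ * x) + b * sin (ξ * x)) ∂<•(u t) with hgu
  rcases le_or_gt (2 * ν) 1 with h2 | h2
  · have h3 : 0 < 2 * ν := by linarith
    refine caputo_unique (g₁ := gv) (g₂ := gu) (r := fun _ => 0) (c := -ξ ^ 2) h3 h2
      continuousOn_const ?_ ?_ hi ht
    · simpa using hE v hv
    · simpa using hE u hu
  · have h3 : 0 < 2 * ν - 1 := by linarith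
    have h4 : 2 * ν - 1 ≤ 1 := by linarith
    refine caputo_unique_of_derivWithin (g₁ := gv) (g₂ := gu) (β := 2 * ν - 1) (c := -ξ ^ 2)
      h3 h4 ?_ ?_ hi ?_ ht
    · rw [sub_add_cancel]; exact hE v hv
    · rw [sub_add_cancel]; exact hE u hu
    · rw [hv.initial_velocity (by linarith) _ hφ, hu.initial_velocity (by linarith) _ hφ]

theorem charFun_eq_of_integral_trig {ρ σ : Measure ℝ} [IsFiniteMeasure ρ] [IsFiniteMeasure σ]
    (h : ∀ ξ a b : ℝ, ∫ x, (a * cos (ξ * x) + b * sin (ξ * x)) ∂ρ =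
      ∫ x, (a * cos (ξ * x) + b * sin (ξ * x)) ∂σ) : ρ = σ := by
  refine Measure.ext_of_charFun (funext fun ξ => ?_)
  have hI : ∀ τ : Measure ℝ, IsFiniteMeasure τ → charFun τ ξ =
      ((∫ x, cos (ξ * x) ∂τ : ℝ) : ℂ) + ((∫ x, sin (ξ * x) ∂τ : ℝ) : ℂ) * Complex.I := by
    intro τ _
    have hc : Integrable (fun x => cos (ξ * x)) τ := Integrable.mono' (integrable_const 1)
      (by fun_prop) (ae_of_all _ fun x => abs_cos_le_one _)
    have hs : Integrable (fun x => sin (ξ * x)) τ := Integrable.mono' (integrable_const 1)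
      (by fun_prop) (ae_of_all _ fun x => abs_sin_le_one _)
    rw [charFun_apply_real, ← integral_complex_ofReal, ← integral_complex_ofReal,
      ← integral_mul_const, ← integral_add hc.ofReal (hs.ofReal.mul_const _)]
    refine integral_congr_ae (ae_of_all _ fun x => ?_)
    simp only
    rw [← Complex.ofReal_mul, Complex.exp_mul_I, ← Complex.ofReal_cos, ← Complex.ofReal_sin]
  rw [hI ρ ‹_›, hI σ ‹_›]
  have hc := h ξ 1 0
  have hs := h ξ 0 1
  simp only [one_mul, zero_mul, add_zero, zero_add] at hc hs
  rw [hc, hs]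

theorem IsFundamentalSolution.unique {ν : ℝ} (h0 : 0 < ν) (h1 : ν ≤ 1)
    [IsFiniteMeasure (timeLaw ν)] {v : ℝ → SignedMeasure ℝ} (hv : IsFundamentalSolution ν v)
    {t : ℝ} (ht : 0 ≤ t) : v t = fundamentalSolution ν t := by
  set P := (v t).toJordanDecomposition.posPart with hP
  set N := (v t).toJordanDecomposition.negPart with hN
  have hvPN : v t = P.toSignedMeasure - N.toSignedMeasure :=
    (SignedMeasure.toSignedMeasure_toJordanDecomposition (v t)).symm
  -- Moving the negative Jordan part to the other side leaves positive finite measures, to which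
  -- uniqueness of characteristic functions applies.
  have key : P = symLaw ν t + N := by
    refine charFun_eq_of_integral_trig fun ξ a b => ?_
    obtain ⟨C, hC⟩ := (isTestFunction_trig ξ a b).2 0
    rw [iteratedDeriv_zero] at hC
    have hi : ∀ τ : Measure ℝ, IsFiniteMeasure τ →
        Integrable (fun x => a * cos (ξ * x) + b * sin (ξ * x)) τ := fun τ _ =>
      Integrable.mono' (integrable_const C) (by fun_prop) (ae_of_all _ hC)
    have h := (isFundamentalSolution_fundamentalSolution h0 h1).integral_trig_eq h0 h1 hv ξ a b ht
    rw [fundamentalSolution, VectorMeasure.integral_toSignedMeasure, hvPN,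
      VectorMeasure.integral_sub_vectorMeasure, VectorMeasure.integral_toSignedMeasure,
      VectorMeasure.integral_toSignedMeasure] at h
    · rw [integral_add_measure (hi _ inferInstance) (hi _ inferInstance)]
      linarith
    · rw [VectorMeasure.Integrable, Measure.variation_toSignedMeasure]
      exact hi _ inferInstance
    · rw [VectorMeasure.Integrable, Measure.variation_toSignedMeasure]
      exact hi _ inferInstance
  have h2 : P.toSignedMeasure = (symLaw ν t).toSignedMeasure + N.toSignedMeasure := by
    rw [← Measure.toSignedMeasure_add]
    congr 1
  rw [hvPN, h2, add_sub_cancel_right, fundamentalSolution]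

end FundamentalSolution

/-! ### Density of the random time and its Laplace transform -/

section RandomTimeDensity

open Real Filter Topology

theorem measurable_wrightDensity (ν : ℝ) : Measurable (wrightDensity ν) := by
  have := measurable_kanter ν
  unfold wrightDensity
  refine Measurable.mul (by fun_prop) ?_
  have h : Measurable fun z : ℝ × ℝ => (z.1 / kanter ν z.2) ^ (1 / (1 - ν)) *
      exp (-(z.1 / kanter ν z.2) ^ (1 / (1 - ν))) := by fun_prop
  exact (h.stronglyMeasurable.integral_prod_right' (ν := volume.restrict (Ioo 0 π))).measurable

/-- The density of the random time at time `t`. -/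
noncomputable def timeDensity (ν s t : ℝ) : ℝ := t ^ (-ν) * wrightDensity ν (s * t ^ (-ν))

variable {ν : ℝ}

theorem measurable_timeDensity (ν : ℝ) : Measurable fun z : ℝ × ℝ => timeDensity ν z.1 z.2 := by
  have := measurable_wrightDensity ν
  unfold timeDensity
  fun_prop

theorem timeDensity_nonneg (h0 : 0 < ν) (h1 : ν < 1) {s t : ℝ} (hs : 0 < s) (ht : 0 < t) :
    0 ≤ timeDensity ν s t :=
  mul_nonneg (by positivity) (wrightDensity_nonneg h0 h1 (by positivity))

theorem mul_timeDensity_le (h0 : 0 < ν) (h1 : ν < 1) {s t : ℝ} (hs : 0 < s) (ht : 0 < t) :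
    s * timeDensity ν s t ≤ 1 / (1 - ν) := by
  have htν := rpow_pos_of_pos ht (-ν)
  have h := wrightDensity_le h0 h1 (mul_pos hs htν)
  rw [le_div_iff₀ (mul_pos hs htν)] at h
  refine le_trans (le_of_eq ?_) h
  unfold timeDensity; ring

theorem continuousOn_timeDensity (h0 : 0 < ν) (h1 : ν < 1) :
    ContinuousOn (fun z : ℝ × ℝ => timeDensity ν z.1 z.2) (Ioi 0 ×ˢ Ioi 0) := by
  have hp : ContinuousOn (fun z : ℝ × ℝ => z.2 ^ (-ν)) (Ioi 0 ×ˢ Ioi 0) :=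
    continuousOn_snd.rpow_const fun z hz => Or.inl (ne_of_gt hz.2)
  refine hp.mul ((continuousOn_wrightDensity h0 h1).comp (continuousOn_fst.mul hp) fun z hz => ?_)
  exact mul_pos hz.1 (rpow_pos_of_pos hz.2 _)

theorem randomLaw_eq_withDensity (h1 : ν < 1) {t : ℝ} (ht : 0 < t) :
    randomLaw ν t = (volume.restrict (Ioi 0)).withDensity
      fun s => ENNReal.ofReal (timeDensity ν s t) := by
  have hw := measurable_wrightDensity ν
  have hm : Measurable fun s => timeDensity ν s t := by unfold timeDensity; fun_prop
  have htν := rpow_pos_of_pos ht ν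
  ext B hB
  have hpre : MeasurableSet ((fun y => t ^ ν * y) ⁻¹' B) :=
    hB.preimage (by fun_prop)
  rw [randomLaw, Measure.map_apply (by fun_prop) hB, timeLaw, if_neg h1.ne,
    withDensity_apply _ hpre, withDensity_apply _ hB, Measure.restrict_restrict hpre,
    Measure.restrict_restrict hB, ← lintegral_indicator (hpre.inter measurableSet_Ioi),
    ← lintegral_indicator (hB.inter measurableSet_Ioi)]
  -- Change of variables `s = t ^ ν y`, in the form of the scaling property of Lebesgue measure.
  conv_rhs => rw [← Real.smul_map_volume_mul_left htν.ne']
  rw [lintegral_smul_measure, lintegral_map (by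
    refine Measurable.indicator (by fun_prop) (hB.inter measurableSet_Ioi)) (by fun_prop),
    smul_eq_mul, ← lintegral_const_mul' _ _ ENNReal.ofReal_ne_top]
  refine lintegral_congr fun y => ?_
  by_cases hy : y ∈ (fun y => t ^ ν * y) ⁻¹' B ∩ Ioi 0
  · have hy2 : t ^ ν * y ∈ B ∩ Ioi 0 := ⟨hy.1, mul_pos htν hy.2⟩
    rw [indicator_of_mem hy, indicator_of_mem hy2, abs_of_pos htν,
      ← ENNReal.ofReal_mul htν.le]
    congr 1
    unfold timeDensity
    rw [rpow_neg ht.le]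
    field_simp
  · have hy2 : t ^ ν * y ∉ B ∩ Ioi 0 := fun h =>
      hy ⟨h.1, (mul_pos_iff_of_pos_left htν).1 h.2⟩
    rw [indicator_of_notMem hy, indicator_of_notMem hy2, mul_zero]

theorem integrableOn_exp_mul_timeDensity (h0 : 0 < ν) (h1 : ν < 1) {s μ : ℝ} (hs : 0 < s)
    (hμ : 0 < μ) : IntegrableOn (fun t => exp (-(μ * t)) * timeDensity ν s t) (Ioi 0) := by
  have hm : Measurable fun t => timeDensity ν s t :=
    (measurable_timeDensity ν).comp (measurable_const.prodMk measurable_id)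
  refine Integrable.mono' ((integrableOn_exp_neg_mul hμ).mul_const (1 / (1 - ν) / s))
    (Measurable.aestronglyMeasurable (by fun_prop)) ?_
  filter_upwards [ae_restrict_mem measurableSet_Ioi] with t ht
  rw [norm_mul, norm_of_nonneg (exp_pos _).le, norm_of_nonneg (timeDensity_nonneg h0 h1 hs ht)]
  refine mul_le_mul_of_nonneg_left ?_ (exp_pos _).le
  rw [le_div_iff₀ hs, mul_comm]
  exact mul_timeDensity_le h0 h1 hs ht

/-- Multiplying by `s` makes the integrand bounded by a multiple of `exp (-μ t)` uniformly in `s`;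
dividing by `s` afterwards is continuous on `(0, ∞)`. -/
theorem continuousOn_laplace_timeDensity (h0 : 0 < ν) (h1 : ν < 1) {μ : ℝ} (hμ : 0 < μ) :
    ContinuousOn (fun s => ∫ t in Ioi 0, exp (-(μ * t)) * timeDensity ν s t) (Ioi 0) := by
  have h : ContinuousOn (fun s => ∫ t in Ioi 0, exp (-(μ * t)) * (s * timeDensity ν s t))
      (Ioi 0) := by
    refine continuousOn_of_dominated (bound := fun t => exp (-(μ * t)) * (1 / (1 - ν)))
      (fun s _ => ?_) (fun s hs => ?_) ((integrableOn_exp_neg_mul hμ).mul_const _) ?_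
    · have hm : Measurable fun t => timeDensity ν s t :=
        (measurable_timeDensity ν).comp (measurable_const.prodMk measurable_id)
      exact Measurable.aestronglyMeasurable (by fun_prop)
    · have hs : 0 < s := hs
      filter_upwards [ae_restrict_mem measurableSet_Ioi] with t ht
      rw [norm_mul, norm_of_nonneg (exp_pos _).le,
        norm_of_nonneg (mul_nonneg hs.le (timeDensity_nonneg h0 h1 hs ht))]
      exact mul_le_mul_of_nonneg_left (mul_timeDensity_le h0 h1 hs ht) (exp_pos _).le
    · filter_upwards [ae_restrict_mem measurableSet_Ioi] with t ht
      refine continuousOn_const.mul (continuousOn_id.mul ?_)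
      exact (continuousOn_timeDensity h0 h1).comp (f := fun s : ℝ => (s, t))
        (by fun_prop) fun s hs => ⟨hs, ht⟩
  refine (h.div continuousOn_id fun s hs => ne_of_gt hs).congr fun s hs => ?_
  have hs : s ≠ 0 := ne_of_gt hs
  rw [Pi.div_apply]
  simp_rw [mul_left_comm (exp _)]
  rw [integral_const_mul, id, mul_div_cancel_left₀ _ hs]

/-- Both sides, integrated over a Borel set of `s`, give its mass under
`map_expWeight_prod_timeLaw`. Hence they agree almost everywhere, and by continuity in `s`
everywhere. -/
theorem laplace_timeDensity (h0 : 0 < ν) (h1 : ν < 1) {s μ : ℝ} (hs : 0 < s) (hμ : 0 < μ) :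
    ∫ t in Ioi 0, exp (-(μ * t)) * timeDensity ν s t =
      μ ^ (ν - 1) * exp (-(s * μ ^ ν)) := by
  have := isProbabilityMeasure_timeLaw h0 h1.le
  have := isFiniteMeasure_expWeight hμ
  have hf := measurable_timeDensity ν
  set κ := volume.restrict (Ioi (0 : ℝ)) with hκ
  have hjm : Measurable fun z : ℝ × ℝ => ENNReal.ofReal (exp (-(μ * z.2)) * timeDensity ν z.1 z.2) := by
    fun_prop
  have hae : (fun s => ∫⁻ t, ENNReal.ofReal (exp (-(μ * t)) * timeDensity ν s t) ∂κ) =ᵐ[κ]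
      fun s => ENNReal.ofReal (μ ^ (ν - 1)) * ENNReal.ofReal (exp (-(μ ^ ν * s))) := by
    refine ae_eq_of_forall_setLIntegral_eq_of_sigmaFinite hjm.lintegral_prod_right'
      (by fun_prop) fun B hB _ => ?_
    have hR := congrArg (fun τ : Measure ℝ => τ B) (map_expWeight_prod_timeLaw h0 h1.le hμ)
    have hmeas : Measurable fun z : ℝ × ℝ => z.1 ^ ν * z.2 := by fun_prop
    rw [Measure.map_apply hmeas hB, Measure.prod_apply (hB.preimage hmeas), Measure.smul_apply,
      smul_eq_mul, lintegral_expWeight (measurable_measure_prodMk_left (hB.preimage hmeas)),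
      expWeight, withDensity_apply _ hB] at hR
    rw [lintegral_const_mul _ (by fun_prop), ← hR,
      lintegral_lintegral_swap (f := fun s t => ENNReal.ofReal (exp (-(μ * t)) * timeDensity ν s t))
      hjm.aemeasurable]
    refine setLIntegral_congr_fun measurableSet_Ioi fun t ht => ?_
    have ht : 0 < t := ht
    have hmt : Measurable fun s => timeDensity ν s t :=
      (measurable_timeDensity ν).comp (measurable_id.prodMk measurable_const)
    simp_rw [ENNReal.ofReal_mul (exp_pos _).le]
    rw [lintegral_const_mul _ (by fun_prop)]
    congr 1
    rw [← withDensity_apply _ hB, hκ, ← randomLaw_eq_withDensity h1 ht, randomLaw,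
      Measure.map_apply (by fun_prop) hB]
    rfl
  have hae2 : (fun s => ∫ t in Ioi 0, exp (-(μ * t)) * timeDensity ν s t) =ᵐ[κ]
      fun s => μ ^ (ν - 1) * exp (-(s * μ ^ ν)) := by
    filter_upwards [hae, ae_restrict_mem measurableSet_Ioi] with s hs hs0
    rw [integral_eq_lintegral_of_nonneg_ae ?_
      (integrableOn_exp_mul_timeDensity h0 h1 hs0 hμ).aestronglyMeasurable, hs,
      ← ENNReal.ofReal_mul (by positivity), ENNReal.toReal_ofReal (by positivity), mul_comm s]
    filter_upwards [ae_restrict_mem measurableSet_Ioi] with t ht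
    exact mul_nonneg (exp_pos _).le (timeDensity_nonneg h0 h1 hs0 ht)
  exact Measure.eqOn_open_of_ae_eq hae2 isOpen_Ioi (continuousOn_laplace_timeDensity h0 h1 hμ)
    (by fun_prop) hs

theorem laplace_randomLaw (h0 : 0 < ν) (h1 : ν ≤ 1) {μ : ℝ} (hμ : 0 < μ) {B : Set ℝ}
    (hB : MeasurableSet B) (hB0 : B ⊆ Ioi 0) :
    IntegrableOn (fun t => exp (-(μ * t)) * (randomLaw ν t).real B) (Ioi 0) ∧
    ∫ t in Ioi 0, exp (-(μ * t)) * (randomLaw ν t).real B =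
      ∫ s in B, μ ^ (ν - 1) * exp (-(s * μ ^ ν)) := by
  have := isProbabilityMeasure_timeLaw h0 h1
  have hq : Measurable (B.indicator (fun _ => (1 : ℝ))) := measurable_const.indicator hB
  have h := laplace_timeMean h0 h1 hq (C := 1) (fun s _ => by
    by_cases hs : s ∈ B <;> simp [hs]) hμ
  have he : ∀ t, timeMean ν 0 (B.indicator fun _ => (1 : ℝ)) t = (randomLaw ν t).real B := by
    intro t
    rw [← integral_randomLaw hq, integral_indicator_const _ hB, smul_eq_mul, mul_one]
  simp only [he] at h
  refine ⟨h.1, h.2.trans ?_⟩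
  rw [← integral_const_mul, ← inter_eq_right.2 hB0, ← setIntegral_indicator hB]
  refine setIntegral_congr_fun measurableSet_Ioi fun s hs0 => ?_
  by_cases hs : s ∈ B
  · simp [hs, mul_comm s, mem_Ioi.1 hs0]
  · simp [hs]

theorem randomLaw_one {t : ℝ} : randomLaw 1 t = Measure.dirac t := by
  rw [randomLaw, timeLaw, if_pos rfl, Measure.map_dirac' (by fun_prop)]
  simp

end RandomTimeDensity

/-! ### Classical birth equations -/

section BirthProb

open Real Filter Topology

/-- The state probabilities of the classical birth process with rates `lam`, started from one
individual, obtained by solving the birth equations recursively. -/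
noncomputable def birthProb (lam : ℕ → ℝ) : ℕ → ℝ → ℝ
  | 0, _ => 0
  | k + 1, s => exp (-(lam (k + 1) * s)) * ((if k = 0 then 1 else 0) +
      ∫ r in (0 : ℝ)..s, exp (lam (k + 1) * r) * (lam k * birthProb lam k r))

theorem birthProb_succ (lam : ℕ → ℝ) (k : ℕ) : birthProb lam (k + 1) = fun s =>
    exp (-(lam (k + 1) * s)) * ((if k = 0 then 1 else 0) +
      ∫ r in (0 : ℝ)..s, exp (lam (k + 1) * r) * (lam k * birthProb lam k r)) := by
  funext s
  rw [birthProb]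

theorem continuous_birthProb (lam : ℕ → ℝ) : ∀ k, Continuous (birthProb lam k)
  | 0 => continuous_const
  | k + 1 => by
    have h := continuous_birthProb lam k
    have h2 : Continuous fun s : ℝ =>
        ∫ r in (0 : ℝ)..s, exp (lam (k + 1) * r) * (lam k * birthProb lam k r) :=
      intervalIntegral.continuous_primitive
        (fun a b => Continuous.intervalIntegrable (by fun_prop) a b) 0
    rw [birthProb_succ]
    fun_prop

theorem birthProb_succ_zero (lam : ℕ → ℝ) (k : ℕ) :
    birthProb lam (k + 1) 0 = if k = 0 then 1 else 0 := by
  simp [birthProb]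

theorem hasDerivAt_birthProb (lam : ℕ → ℝ) (k : ℕ) (s : ℝ) :
    HasDerivAt (birthProb lam k)
      (-(lam k) * birthProb lam k s + lam (k - 1) * birthProb lam (k - 1) s) s := by
  cases k with
  | zero =>
    have : birthProb lam 0 = fun _ => 0 := rfl
    simpa [this] using hasDerivAt_const s (0 : ℝ)
  | succ k =>
    have hc := continuous_birthProb lam k
    have hcI : Continuous fun r => exp (lam (k + 1) * r) * (lam k * birthProb lam k r) := by
      fun_prop
    have h1 := (intervalIntegral.integral_hasDerivAt_right (hcI.intervalIntegrable 0 s)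
      (hcI.stronglyMeasurableAtFilter _ _) hcI.continuousAt).const_add (if k = 0 then (1 : ℝ) else 0)
    have h2 := (((hasDerivAt_id s).const_mul (lam (k + 1))).neg).exp.mul h1
    rw [birthProb_succ]
    convert! h2 using 1
    simp only [Pi.neg_apply, id, add_tsub_cancel_right, mul_one]
    rw [← mul_assoc (exp (-_)) (exp _), ← exp_add, neg_add_cancel, exp_zero]
    ring

variable {lam : ℕ → ℝ}

theorem birthProb_nonneg (hlam : ∀ k, 1 ≤ k → 0 < lam k) :
    ∀ (k : ℕ) {s : ℝ}, 0 ≤ s → 0 ≤ birthProb lam k s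
  | 0, s, _ => le_rfl
  | k + 1, s, hs => by
    rw [birthProb]
    refine mul_nonneg (exp_pos _).le (add_nonneg (by split_ifs <;> norm_num) ?_)
    refine intervalIntegral.integral_nonneg hs fun r hr => mul_nonneg (exp_pos _).le ?_
    rcases Nat.eq_zero_or_pos k with rfl | hk
    · simp [birthProb]
    · exact mul_nonneg (hlam k hk).le (birthProb_nonneg hlam k hr.1)

/-- The birth equations telescope: probability leaves the first `K` states only through state `K`.
Partial sums therefore decrease from `1`, which bounds every state probability. -/
theorem hasDerivAt_sum_birthProb (lam : ℕ → ℝ) (K : ℕ) (s : ℝ) :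
    HasDerivAt (fun s => ∑ k ∈ Finset.range (K + 1), birthProb lam k s)
      (-(lam K) * birthProb lam K s) s := by
  induction K with
  | zero =>
    simp only [zero_add, Finset.sum_range_one]
    simpa [birthProb] using hasDerivAt_birthProb lam 0 s
  | succ K ih =>
    simp_rw [Finset.sum_range_succ _ (K + 1)]
    convert! ih.add (hasDerivAt_birthProb lam (K + 1) s) using 1
    simp

theorem sum_birthProb_zero (lam : ℕ → ℝ) (K : ℕ) :
    ∑ k ∈ Finset.range (K + 1 + 1), birthProb lam k 0 = 1 := by
  rw [Finset.sum_range_succ']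
  simp [birthProb]

theorem antitoneOn_sum_birthProb (hlam : ∀ k, 1 ≤ k → 0 < lam k) (K : ℕ) :
    AntitoneOn (fun s => ∑ k ∈ Finset.range (K + 1), birthProb lam k s) (Ici 0) := by
  refine antitoneOn_of_deriv_nonpos (convex_Ici 0)
    (fun s _ => (hasDerivAt_sum_birthProb lam K s).continuousAt.continuousWithinAt)
    (fun s _ => (hasDerivAt_sum_birthProb lam K s).differentiableAt.differentiableWithinAt)
    fun s hs => ?_
  rw [interior_Ici] at hs
  rw [(hasDerivAt_sum_birthProb lam K s).deriv, neg_mul, neg_nonpos]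
  rcases Nat.eq_zero_or_pos K with rfl | hK
  · simp [birthProb]
  · exact mul_nonneg (hlam K hK).le (birthProb_nonneg hlam K (le_of_lt hs))

theorem sum_birthProb_le_one (hlam : ∀ k, 1 ≤ k → 0 < lam k) (K : ℕ) {s : ℝ} (hs : 0 ≤ s) :
    ∑ k ∈ Finset.range (K + 1), birthProb lam k s ≤ 1 := by
  cases K with
  | zero => simp [birthProb]
  | succ K =>
    rw [← sum_birthProb_zero lam K]
    exact antitoneOn_sum_birthProb hlam (K + 1) (mem_Ici.2 le_rfl) hs hs

theorem sum_birthProb_nonneg (hlam : ∀ k, 1 ≤ k → 0 < lam k) (K : ℕ) {s : ℝ} (hs : 0 ≤ s) :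
    0 ≤ ∑ k ∈ Finset.range (K + 1), birthProb lam k s :=
  Finset.sum_nonneg fun k _ => birthProb_nonneg hlam k hs

theorem abs_birthProb_le (hlam : ∀ k, 1 ≤ k → 0 < lam k) (k : ℕ) {s : ℝ} (hs : 0 ≤ s) :
    |birthProb lam k s| ≤ 1 := by
  rw [abs_of_nonneg (birthProb_nonneg hlam k hs)]
  exact (Finset.single_le_sum (f := fun k => birthProb lam k s)
    (fun j _ => birthProb_nonneg hlam j hs) (Finset.self_mem_range_succ k)).trans
    (sum_birthProb_le_one hlam k hs)

theorem abs_deriv_birthProb_le (hlam : ∀ k, 1 ≤ k → 0 < lam k) (k : ℕ) {s : ℝ} (hs : 0 ≤ s) :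
    |-(lam k) * birthProb lam k s + lam (k - 1) * birthProb lam (k - 1) s| ≤
      |lam k| + |lam (k - 1)| := by
  refine (abs_add_le _ _).trans (add_le_add ?_ ?_)
  · rw [abs_mul, abs_neg]
    exact mul_le_of_le_one_right (abs_nonneg _) (abs_birthProb_le hlam k hs)
  · rw [abs_mul]
    exact mul_le_of_le_one_right (abs_nonneg _) (abs_birthProb_le hlam (k - 1) hs)

theorem integrableOn_exp_mul_birthProb (hlam : ∀ k, 1 ≤ k → 0 < lam k) (k : ℕ) {μ : ℝ}
    (hμ : 0 < μ) : IntegrableOn (fun s => exp (-(μ * s)) * birthProb lam k s) (Ioi 0) :=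
  integrableOn_exp_mul_of_bound (continuous_birthProb lam k).continuousOn one_pos hμ (C := 1)
    fun s hs => by simpa using abs_birthProb_le hlam k hs.le

theorem laplace_birthProb_succ (hlam : ∀ k, 1 ≤ k → 0 < lam k) (k : ℕ) {μ : ℝ} (hμ : 0 < μ) :
    (μ + lam (k + 1)) * ∫ s in Ioi 0, exp (-(μ * s)) * birthProb lam (k + 1) s =
      (if k = 0 then 1 else 0) + lam k * ∫ s in Ioi 0, exp (-(μ * s)) * birthProb lam k s := by
  have hc : Continuous fun s => -(lam (k + 1)) * birthProb lam (k + 1) s +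
      lam (k + 1 - 1) * birthProb lam (k + 1 - 1) s :=
    (continuous_const.mul (continuous_birthProb lam _)).add
      (continuous_const.mul (continuous_birthProb lam _))
  have h := laplace_deriv_of_bounded (hasDerivAt_birthProb lam (k + 1)) hc
    (fun s hs => abs_birthProb_le hlam (k + 1) hs)
    (fun s hs => abs_deriv_birthProb_le hlam (k + 1) hs) hμ
  have e : ∫ s in Ioi 0, exp (-(μ * s)) * (-(lam (k + 1)) * birthProb lam (k + 1) s +
      lam (k + 1 - 1) * birthProb lam (k + 1 - 1) s) =
      -(lam (k + 1)) * (∫ s in Ioi 0, exp (-(μ * s)) * birthProb lam (k + 1) s) +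
      lam k * ∫ s in Ioi 0, exp (-(μ * s)) * birthProb lam k s := by
    rw [← integral_const_mul, ← integral_const_mul, ← integral_add
      ((integrableOn_exp_mul_birthProb hlam _ hμ).const_mul _)
      ((integrableOn_exp_mul_birthProb hlam _ hμ).const_mul _)]
    refine integral_congr_ae (ae_of_all _ fun s => ?_)
    simp only [add_tsub_cancel_right]
    ring
  rw [e, birthProb_succ_zero, eq_div_iff hμ.ne'] at h
  linarith

/-- Probabilistically, `lam (k + 1) * birthProb lam (k + 1)` is the density of a sum of `k + 1`
independent exponential times, and the right side is the product of their transforms. The proof uses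
only the recursion. -/
theorem laplace_birthProb (hlam : ∀ k, 1 ≤ k → 0 < lam k) (k : ℕ) {μ : ℝ} (hμ : 0 < μ) :
    lam (k + 1) * ∫ s in Ioi 0, exp (-(μ * s)) * birthProb lam (k + 1) s =
      ∏ j ∈ Finset.range (k + 1), lam (j + 1) / (μ + lam (j + 1)) := by
  induction k with
  | zero =>
    have h := laplace_birthProb_succ hlam 0 hμ
    have h1 := hlam 1 le_rfl
    have h0 : ∫ s in Ioi 0, exp (-(μ * s)) * birthProb lam 0 s = 0 := by simp [birthProb]
    rw [h0, mul_zero, if_pos rfl, add_zero, mul_comm, ← eq_div_iff (by positivity)] at h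
    rw [h]
    simp [div_eq_mul_inv]
  | succ k ih =>
    have h := laplace_birthProb_succ hlam (k + 1) hμ
    have h1 := hlam (k + 1 + 1) (by lia)
    rw [ih, if_neg (by lia), zero_add, mul_comm, ← eq_div_iff (by positivity)] at h
    rw [Finset.prod_range_succ, h]
    ring

end BirthProb

/-! ### Solution of the fractional birth equations -/

section FractionalBirth

open Real Filter Topology

variable {ν : ℝ} {lam : ℕ → ℝ}

/-- The state probabilities of the fractional birth process. -/
noncomputable def fractionalBirthProb (ν : ℝ) (lam : ℕ → ℝ) (k : ℕ) : ℝ → ℝ :=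
  timeMean ν 0 (birthProb lam k)

theorem integrable_comp_timeLaw (h0 : 0 < ν) (h1 : ν ≤ 1) {q : ℝ → ℝ} {C : ℝ} (hq : Continuous q)
    (hC : ∀ s, 0 ≤ s → |q s| ≤ C) {t : ℝ} (ht : 0 ≤ t) :
    Integrable (fun y => q (t ^ ν * y)) (timeLaw ν) := by
  simpa using integrable_pow_mul h0 h1 hq hC 0 ht

theorem solvesFractionalBirth_fractionalBirthProb (h0 : 0 < ν) (h1 : ν ≤ 1)
    (hlam : ∀ k, 1 ≤ k → 0 < lam k) :
    SolvesFractionalBirth ν lam (fractionalBirthProb ν lam) where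
  zero t _ := by simp [fractionalBirthProb, timeMean, birthProb]
  initial k hk := by
    obtain ⟨k, rfl⟩ := Nat.exists_eq_add_of_le' hk
    rw [fractionalBirthProb, timeMean_zero h0 h1, birthProb_succ_zero]
    simp
  equation k hk := by
    refine (hasCaputoDeriv_timeMean h0 h1 (hasDerivAt_birthProb lam k)
      ((continuous_const.mul (continuous_birthProb lam _)).add
      (continuous_const.mul (continuous_birthProb lam _)))
      (fun s hs => abs_birthProb_le hlam k hs)
      (fun s hs => abs_deriv_birthProb_le hlam k hs)).congr (fun _ _ => rfl) fun t ht => ?_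
    have hi := fun j => integrable_comp_timeLaw h0 h1 (continuous_birthProb lam j)
      (fun s hs => abs_birthProb_le hlam j hs) ht.le
    simp only [fractionalBirthProb, timeMean, pow_zero, one_mul]
    rw [integral_add ((hi k).const_mul _) ((hi (k - 1)).const_mul _), integral_const_mul,
      integral_const_mul]

/-- The system is triangular: by induction the previous state is a known continuous forcing term,
and the scalar uniqueness applies. -/
theorem SolvesFractionalBirth.eq_fractionalBirthProb (h0 : 0 < ν) (h1 : ν ≤ 1)
    (hlam : ∀ k, 1 ≤ k → 0 < lam k) {q : ℕ → ℝ → ℝ} (hq : SolvesFractionalBirth ν lam q) (k : ℕ)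
    {t : ℝ} (ht : 0 ≤ t) : q k t = fractionalBirthProb ν lam k t := by
  have hp := solvesFractionalBirth_fractionalBirthProb h0 h1 hlam
  induction k generalizing t with
  | zero => rw [hq.zero t ht, hp.zero t ht]
  | succ k ih =>
    have hk : 1 ≤ k + 1 := by lia
    refine caputo_unique h0 h1 (c := -(lam (k + 1)))
      (r := fun t => lam k * fractionalBirthProb ν lam k t)
      (continuousOn_const.mul (continuousOn_timeMean h0 h1 (continuous_birthProb lam k)
        (fun s hs => abs_birthProb_le hlam k hs) 0)) ?_ ?_ ?_ ht
    · refine (hq.equation (k + 1) hk).congr (fun _ _ => rfl) fun s hs => ?_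
      simp [ih hs.le]
    · exact hp.equation (k + 1) hk
    · rw [hq.initial _ hk, hp.initial _ hk]

theorem fractionalBirthProb_nonneg (hlam : ∀ k, 1 ≤ k → 0 < lam k) (k : ℕ) {t : ℝ} (ht : 0 ≤ t) :
    0 ≤ fractionalBirthProb ν lam k t := by
  refine integral_nonneg_of_ae ?_
  filter_upwards [ae_timeLaw_pos ν] with y hy
  simpa using birthProb_nonneg hlam k (by positivity)

end FractionalBirth

/-! ### The non-explosion criterion -/

section NonExplosion

open Real Filter Topology

theorem sum_le_prod_one_add {ι : Type*} (s : Finset ι) {a : ι → ℝ} (ha : ∀ i ∈ s, 0 ≤ a i) :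
    ∑ i ∈ s, a i ≤ ∏ i ∈ s, (1 + a i) := by
  classical
  suffices h : 1 + ∑ i ∈ s, a i ≤ ∏ i ∈ s, (1 + a i) by linarith
  induction s using Finset.induction_on with
  | empty => simp
  | insert i s hi ih =>
    have h := ih fun j hj => ha j (Finset.mem_insert_of_mem hj)
    have hi0 := ha i (Finset.mem_insert_self i s)
    have hs : 0 ≤ ∑ j ∈ s, a j := Finset.sum_nonneg fun j hj => ha j (Finset.mem_insert_of_mem hj)
    rw [Finset.sum_insert hi, Finset.prod_insert hi]
    nlinarith [mul_le_mul_of_nonneg_left h (by linarith : 0 ≤ 1 + a i), mul_nonneg hi0 hs]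

/-- The reciprocal product `∏ (1 + 1 / a j)` lies between `∑ 1 / a j` and `exp (∑ 1 / a j)`. -/
theorem tendsto_prod_div_one_add_iff {a : ℕ → ℝ} (ha : ∀ n, 0 < a n) :
    Tendsto (fun K => ∏ j ∈ Finset.range K, a j / (1 + a j)) atTop (𝓝 0) ↔
      ¬ Summable fun n => 1 / a n := by
  have hb : ∀ n, 0 ≤ 1 / a n := fun n => (one_div_pos.2 (ha n)).le
  have e : ∀ K, ∏ j ∈ Finset.range K, a j / (1 + a j) =
      (∏ j ∈ Finset.range K, (1 + 1 / a j))⁻¹ := by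
    intro K
    rw [← Finset.prod_inv_distrib]
    refine Finset.prod_congr rfl fun j _ => ?_
    have := ha j
    field_simp
    ring
  simp_rw [e]
  constructor
  · intro h hs
    have hle : ∀ K, exp (-∑' n, 1 / a n) ≤ (∏ j ∈ Finset.range K, (1 + 1 / a j))⁻¹ := by
      intro K
      rw [exp_neg]
      refine inv_anti₀ (Finset.prod_pos fun j _ => by have := hb j; linarith) ?_
      calc _ ≤ exp (∑ j ∈ Finset.range K, 1 / a j) :=
            prod_one_add_le_exp_sum _ hb
        _ ≤ _ := exp_le_exp.2 (hs.sum_le_tsum _ fun j _ => hb j)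
    exact absurd (ge_of_tendsto' h hle) (not_le.2 (exp_pos _))
  · intro hs
    refine tendsto_inv_atTop_zero.comp (tendsto_atTop_mono (fun K => ?_)
      ((not_summable_iff_tendsto_nat_atTop_of_nonneg hb).1 hs))
    exact sum_le_prod_one_add _ fun j _ => hb j

variable {ν : ℝ} {lam : ℕ → ℝ}

/-- The partial sums of the classical state probabilities. -/
noncomputable def birthSum (lam : ℕ → ℝ) (K : ℕ) (s : ℝ) : ℝ :=
  ∑ k ∈ Finset.range (K + 1), birthProb lam k s

theorem hasDerivAt_birthSum (lam : ℕ → ℝ) (K : ℕ) (s : ℝ) :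
    HasDerivAt (birthSum lam K) (-(lam K) * birthProb lam K s) s :=
  hasDerivAt_sum_birthProb lam K s

theorem continuous_birthSum (lam : ℕ → ℝ) (K : ℕ) : Continuous (birthSum lam K) :=
  continuous_finsetSum _ fun k _ => continuous_birthProb lam k

theorem birthSum_nonneg (hlam : ∀ k, 1 ≤ k → 0 < lam k) (K : ℕ) {s : ℝ} (hs : 0 ≤ s) :
    0 ≤ birthSum lam K s :=
  sum_birthProb_nonneg hlam K hs

theorem abs_birthSum_le (hlam : ∀ k, 1 ≤ k → 0 < lam k) (K : ℕ) {s : ℝ} (hs : 0 ≤ s) :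
    |birthSum lam K s| ≤ 1 :=
  abs_le.2 ⟨by linarith [birthSum_nonneg hlam K hs],
    sum_birthProb_le_one hlam K hs⟩

/-- The derivative of the partial sum is minus the density whose transform is `laplace_birthProb`.
The index `K + 1` guarantees that state `1` is included, so the sum starts from `1`. -/
theorem one_sub_laplace_birthSum (hlam : ∀ k, 1 ≤ k → 0 < lam k) (K : ℕ) :
    1 - ∫ s in Ioi 0, exp (-(1 * s)) * birthSum lam (K + 1) s =
      ∏ j ∈ Finset.range (K + 1), lam (j + 1) / (1 + lam (j + 1)) := by
  have h := laplace_deriv_of_bounded (hasDerivAt_birthSum lam (K + 1))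
    (continuous_const.mul (continuous_birthProb lam _)) (C' := lam (K + 1))
    (fun s hs => abs_birthSum_le hlam (K + 1) hs) (fun s hs => by
      rw [abs_mul, abs_neg, abs_of_pos (hlam (K + 1) (by lia))]
      exact mul_le_of_le_one_right (hlam (K + 1) (by lia)).le (abs_birthProb_le hlam _ hs))
    one_pos
  rw [← laplace_birthProb hlam K one_pos, h, div_one, birthSum, sum_birthProb_zero,
    ← integral_const_mul, sub_add_cancel_left, ← integral_neg]
  refine integral_congr_ae (ae_of_all _ fun s => ?_)
  simp only
  ring

theorem timeMean_birthSum (h0 : 0 < ν) (h1 : ν ≤ 1) (hlam : ∀ k, 1 ≤ k → 0 < lam k) (K : ℕ)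
    {t : ℝ} (ht : 0 ≤ t) : timeMean ν 0 (birthSum lam K) t =
      ∑ k ∈ Finset.range K, fractionalBirthProb ν lam (k + 1) t := by
  have e : timeMean ν 0 (birthSum lam K) t =
      ∑ k ∈ Finset.range (K + 1), fractionalBirthProb ν lam k t := by
    simp only [fractionalBirthProb, timeMean, pow_zero, one_mul, birthSum]
    exact integral_finsetSum _ fun k _ => integrable_comp_timeLaw h0 h1
      (continuous_birthProb lam k) (fun s hs => abs_birthProb_le hlam k hs) ht
  rw [e, Finset.sum_range_succ', (solvesFractionalBirth_fractionalBirthProb h0 h1 hlam).zero t ht,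
    add_zero]

theorem antitoneOn_timeMean_birthSum (h0 : 0 < ν) (h1 : ν ≤ 1) (hlam : ∀ k, 1 ≤ k → 0 < lam k)
    (K : ℕ) : AntitoneOn (timeMean ν 0 (birthSum lam K)) (Ici 0) := by
  intro s hs t ht hst
  have hs : 0 ≤ s := hs
  have hi := fun r (hr : 0 ≤ r) => integrable_comp_timeLaw h0 h1 (continuous_birthSum lam K)
      (fun s hs => abs_birthSum_le hlam K hs) hr
  simp only [timeMean, pow_zero, one_mul]
  refine integral_mono_ae (hi t ht) (hi s hs) ?_
  filter_upwards [ae_timeLaw_pos ν] with y hy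
  refine antitoneOn_sum_birthProb hlam K (mem_Ici.2 (by positivity)) (mem_Ici.2 (by
    have : 0 ≤ t := ht
    positivity)) ?_
  gcongr

theorem timeMean_birthSum_mem (h0 : 0 < ν) (h1 : ν ≤ 1) (hlam : ∀ k, 1 ≤ k → 0 < lam k) (K : ℕ)
    {t : ℝ} (ht : 0 ≤ t) : timeMean ν 0 (birthSum lam K) t ∈ Icc 0 1 := by
  have := isProbabilityMeasure_timeLaw h0 h1
  refine ⟨?_, ?_⟩
  · rw [timeMean_birthSum h0 h1 hlam K ht]
    exact Finset.sum_nonneg fun k _ => fractionalBirthProb_nonneg hlam _ ht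
  · refine (le_abs_self _).trans ((abs_timeMean_le h0 h1
      (fun s hs => abs_birthSum_le hlam K hs) 0 ht).trans (by simp))

theorem integral_exp_mul_one_sub_timeMean (h0 : 0 < ν) (h1 : ν ≤ 1)
    (hlam : ∀ k, 1 ≤ k → 0 < lam k) (K : ℕ) :
    IntegrableOn (fun t => exp (-(1 * t)) * (1 - timeMean ν 0 (birthSum lam (K + 1)) t)) (Ioi 0) ∧
    ∫ t in Ioi 0, exp (-(1 * t)) * (1 - timeMean ν 0 (birthSum lam (K + 1)) t) =
      ∏ j ∈ Finset.range (K + 1), lam (j + 1) / (1 + lam (j + 1)) := by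
  have h := laplace_timeMean h0 h1 (continuous_birthSum lam (K + 1)).measurable
    (fun s hs => abs_birthSum_le hlam (K + 1) hs) one_pos
  simp_rw [mul_sub, mul_one]
  refine ⟨(integrableOn_exp_neg_mul one_pos).sub h.1, ?_⟩
  rw [integral_sub (integrableOn_exp_neg_mul one_pos) h.1, h.2, integral_exp_neg_mul one_pos,
    one_rpow, one_rpow, one_mul, inv_one, one_sub_laplace_birthSum hlam]

/-- Convergence at every `t` gives convergence of the transforms at `μ = 1` by dominated
convergence. Conversely, monotonicity in time recovers each fixed `t` from that single transform. -/
theorem tendsto_timeMean_birthSum_iff (h0 : 0 < ν) (h1 : ν ≤ 1)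
    (hlam : ∀ k, 1 ≤ k → 0 < lam k) :
    (∀ t, 0 < t → Tendsto (fun K => timeMean ν 0 (birthSum lam (K + 1)) t) atTop (𝓝 1)) ↔
      ¬ Summable fun k => 1 / lam (k + 1) := by
  rw [← tendsto_prod_div_one_add_iff fun n => hlam (n + 1) (by lia), ← tendsto_add_atTop_iff_nat 1]
  have hI := fun K => integral_exp_mul_one_sub_timeMean h0 h1 hlam K
  simp_rw [← (hI _).2]
  constructor
  · intro h
    have h2 := tendsto_integral_of_dominated_convergence (μ := volume.restrict (Ioi (0 : ℝ)))
      (F := fun K t => exp (-(1 * t)) * (1 - timeMean ν 0 (birthSum lam (K + 1)) t))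
      (f := fun _ => 0) (fun t => exp (-(1 * t))) (fun K => (hI K).1.aestronglyMeasurable)
      (integrableOn_exp_neg_mul one_pos) (fun K => ?_) ?_
    · simpa using h2
    · filter_upwards [ae_restrict_mem measurableSet_Ioi] with t ht
      obtain ⟨h3, h4⟩ := timeMean_birthSum_mem h0 h1 hlam (K + 1) (le_of_lt ht)
      rw [norm_mul, norm_of_nonneg (exp_pos _).le, norm_of_nonneg (by linarith)]
      exact mul_le_of_le_one_right (exp_pos _).le (by linarith)
    · filter_upwards [ae_restrict_mem measurableSet_Ioi] with t ht
      simpa using ((h t ht).const_sub 1).const_mul (exp (-(1 * t)))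
  · intro h t ht
    -- The defect `1 - timeMean` is non-decreasing in time, so its value at `t` times `∫_t^∞ exp
    -- (-s) ds = exp (-t)` is at most the whole transform.
    have hle : ∀ K, 1 - exp t * (∫ s in Ioi 0,
        exp (-(1 * s)) * (1 - timeMean ν 0 (birthSum lam (K + 1)) s)) ≤
        timeMean ν 0 (birthSum lam (K + 1)) t := by
      intro K
      have hsub : Ioi t ⊆ Ioi 0 := Ioi_subset_Ioi ht.le
      have h5 : ∫ s in Ioi t, exp (-(1 * s)) * (1 - timeMean ν 0 (birthSum lam (K + 1)) t) ≤
          ∫ s in Ioi 0, exp (-(1 * s)) * (1 - timeMean ν 0 (birthSum lam (K + 1)) s) := by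
        refine (setIntegral_mono_on (((integrableOn_exp_neg_mul one_pos).mono_set hsub).mul_const _)
          ((hI K).1.mono_set hsub) measurableSet_Ioi fun s hs => ?_).trans
          (setIntegral_mono_set (hI K).1 ?_ (Eventually.of_forall hsub))
        · have h6 := antitoneOn_timeMean_birthSum h0 h1 hlam (K + 1) (mem_Ici.2 ht.le)
            (mem_Ici.2 (ht.trans hs).le) (le_of_lt hs)
          exact mul_le_mul_of_nonneg_left (by linarith) (exp_pos _).le
        · filter_upwards [ae_restrict_mem measurableSet_Ioi] with s hs
          obtain ⟨h3, h4⟩ := timeMean_birthSum_mem h0 h1 hlam (K + 1) (le_of_lt hs)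
          exact mul_nonneg (exp_pos _).le (by linarith)
      have h7 : ∫ s in Ioi t, exp (-(1 * s)) = exp (-t) := by
        simpa using integral_exp_neg_Ioi t
      rw [integral_mul_const, h7, exp_neg, inv_mul_eq_div, div_le_iff₀' (exp_pos t)] at h5
      linarith
    refine tendsto_of_tendsto_of_tendsto_of_le_of_le ?_ tendsto_const_nhds hle
      fun K => (timeMean_birthSum_mem h0 h1 hlam (K + 1) ht.le).2
    simpa using (h.const_mul (exp t)).const_sub 1

theorem hasSum_fractionalBirthProb_iff (h0 : 0 < ν) (h1 : ν ≤ 1)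
    (hlam : ∀ k, 1 ≤ k → 0 < lam k) :
    (∀ t, 0 < t → HasSum (fun k => fractionalBirthProb ν lam (k + 1) t) 1) ↔
      ¬ Summable fun k => 1 / lam (k + 1) := by
  rw [← tendsto_timeMean_birthSum_iff h0 h1 hlam]
  refine forall₂_congr fun t ht => ?_
  rw [hasSum_iff_tendsto_nat_of_nonneg fun k => fractionalBirthProb_nonneg hlam _ ht.le,
    ← tendsto_add_atTop_iff_nat 1]
  simp_rw [timeMean_birthSum h0 h1 hlam _ ht.le]

end NonExplosion

/-! ### Mittag-Leffler functions and the explicit formula -/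

section ExplicitFormula

open Real Filter Topology

variable {ν : ℝ} {lam : ℕ → ℝ}

/-- Keep only `t > R` in the Gamma integral. With `R` free, this shows that `Γ(ν n + 1)` outgrows
every geometric sequence. -/
theorem rpow_mul_exp_le_Gamma {a R : ℝ} (ha : 0 ≤ a) (hR : 0 < R) :
    R ^ a * exp (-R) ≤ Gamma (a + 1) := by
  have h1 := integrableOn_rpow_mul_exp (a := a + 1) (by linarith) one_pos
  have h2 := integral_exp_mul_rpow (a := a + 1) (by linarith) one_pos
  simp only [one_rpow, one_mul, add_sub_cancel_right] at h1 h2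
  have hsub : Ioi R ⊆ Ioi 0 := Ioi_subset_Ioi hR.le
  have h3 : IntegrableOn (fun t => exp (-t)) (Ioi R) := by
    have := (integrableOn_exp_neg_mul one_pos).mono_set hsub
    simpa using this
  rw [← h2, ← integral_exp_neg_Ioi R, ← integral_const_mul]
  refine (setIntegral_mono_on (h3.const_mul _) (h1.mono_set hsub) measurableSet_Ioi
    fun t ht => ?_).trans (setIntegral_mono_set h1 ?_ (Eventually.of_forall hsub))
  · rw [mul_comm]
    exact mul_le_mul_of_nonneg_left (rpow_le_rpow hR.le (le_of_lt ht) ha) (exp_pos _).le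
  · filter_upwards [ae_restrict_mem measurableSet_Ioi] with t ht
    have : 0 < t := ht
    positivity

theorem summable_pow_div_Gamma (h0 : 0 < ν) {c : ℝ} (hc : 0 ≤ c) :
    Summable fun n : ℕ => c ^ n / Gamma (ν * n + 1) := by
  have hc1 : 0 < 2 * (c + 1) := by linarith
  -- Chosen so that `R ^ ν = 2 (c + 1)`; the terms are then at most `exp R * (1 / 2) ^ n`.
  set R := (2 * (c + 1)) ^ (1 / ν) with hRdef
  have hR : 0 < R := rpow_pos_of_pos hc1 _
  have hRν : R ^ ν = 2 * (c + 1) := by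
    rw [hRdef, ← rpow_mul hc1.le, one_div_mul_cancel h0.ne', rpow_one]
  have hg : ∀ n : ℕ, 0 < Gamma (ν * n + 1) := fun n => Gamma_pos_of_pos (by positivity)
  refine Summable.of_nonneg_of_le (fun n => div_nonneg (pow_nonneg hc n) (hg n).le) (fun n => ?_)
    ((summable_geometric_of_lt_one (r := (1 / 2 : ℝ)) (by norm_num) (by norm_num)).mul_left (exp R))
  have h := rpow_mul_exp_le_Gamma (a := ν * n) (by positivity) hR
  rw [rpow_mul hR.le, rpow_natCast, hRν, exp_neg] at h
  rw [div_le_iff₀ (hg n)]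
  have h2 : c ^ n ≤ (c + 1) ^ n := pow_le_pow_left₀ hc (by linarith) n
  have h3 : (c + 1) ^ n = exp R * (1 / 2) ^ n * ((2 * (c + 1)) ^ n * (exp R)⁻¹) := by
    rw [mul_pow, one_div, inv_pow]
    have := exp_pos R
    field_simp
  rw [h3] at h2
  exact h2.trans (mul_le_mul_of_nonneg_left h (by positivity))

theorem integral_pow_timeLaw (h0 : 0 < ν) (h1 : ν ≤ 1) (n : ℕ) :
    ∫ y, y ^ n ∂(timeLaw ν) = n.factorial / Gamma (ν * n + 1) := by
  have : 0 < Gamma (ν * n + 1) := Gamma_pos_of_pos (by positivity)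
  rw [integral_eq_lintegral_of_nonneg_ae ?_ (integrable_pow_timeLaw h0 h1 n).aestronglyMeasurable,
    lintegral_pow_timeLaw h0 h1, ENNReal.toReal_ofReal (by positivity)]
  filter_upwards [ae_timeLaw_pos ν] with y hy
  exact pow_nonneg hy.le n

theorem integral_exp_mul_timeLaw (h0 : 0 < ν) (h1 : ν ≤ 1) (x : ℝ) :
    ∫ y, exp (x * y) ∂(timeLaw ν) = mittagLeffler ν x := by
  have hF : ∀ (z : ℝ) (n : ℕ), ∫ y, (z ^ n / n.factorial) * y ^ n ∂(timeLaw ν) =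
      z ^ n / Gamma (ν * n + 1) := by
    intro z n
    rw [integral_const_mul, integral_pow_timeLaw h0 h1]
    field_simp
  have h := hasSum_integral_of_summable_integral_norm (μ := timeLaw ν)
    (F := fun (n : ℕ) y => (x ^ n / n.factorial) * y ^ n)
    (fun n => (integrable_pow_timeLaw h0 h1 n).const_mul _) ?_
  · simp_rw [hF] at h
    rw [mittagLeffler, h.tsum_eq]
    refine integral_congr_ae (ae_of_all _ fun y => ?_)
    simp only [Real.exp_eq_exp_ℝ, NormedSpace.exp_eq_tsum_div]
    refine tsum_congr fun n => ?_
    rw [mul_pow]; ring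
  · refine (summable_pow_div_Gamma h0 (abs_nonneg x)).congr fun n => ?_
    rw [← hF]
    refine integral_congr_ae ?_
    filter_upwards [ae_timeLaw_pos ν] with y hy
    rw [norm_mul, norm_div, norm_pow, norm_of_nonneg (pow_nonneg hy.le n)]
    simp

/-- The sum is the top coefficient in the Lagrange interpolation of the constant `1`, which is `0`
for at least two nodes. The nodes are `-v` to match the order of the differences. -/
theorem sum_one_div_prod_sub_eq_zero {ι : Type*} [DecidableEq ι] {s : Finset ι} {v : ι → ℝ}
    (hv : InjOn v s) (hs : 2 ≤ s.card) :
    ∑ m ∈ s, 1 / ∏ l ∈ s.erase m, (v l - v m) = 0 := by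
  have h := Lagrange.coeff_eq_sum (s := s) (v := fun i => -v i) (P := 1)
    (fun i hi j hj hij => hv hi hj (neg_injective hij)) (by
      rw [Polynomial.degree_one]
      exact_mod_cast (by lia : 0 < s.card))
  rw [Polynomial.coeff_one, if_neg (by lia)] at h
  rw [h]
  refine Finset.sum_congr rfl fun i _ => ?_
  rw [Polynomial.eval_one]
  congr 1
  exact Finset.prod_congr rfl fun j _ => by ring

/-- The explicit state probabilities of the classical birth process. -/
noncomputable def explicitClassicalProb (lam : ℕ → ℝ) (k : ℕ) (s : ℝ) : ℝ :=
  (∏ j ∈ Finset.Icc 1 (k - 1), lam j) *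
    ∑ m ∈ Finset.Icc 1 k, 1 / (∏ l ∈ (Finset.Icc 1 k).erase m, (lam l - lam m)) *
      exp (-(lam m) * s)

theorem hasDerivAt_explicitClassicalProb
    (hinj : ∀ i j : ℕ, 1 ≤ i → 1 ≤ j → lam i = lam j → i = j) {k : ℕ} (hk : 1 ≤ k) (s : ℝ) :
    HasDerivAt (explicitClassicalProb lam (k + 1)) (-(lam (k + 1)) *
      explicitClassicalProb lam (k + 1) s + lam k * explicitClassicalProb lam k s) s := by
  have h : HasDerivAt (explicitClassicalProb lam (k + 1))
      ((∏ j ∈ Finset.Icc 1 (k + 1 - 1), lam j) * ∑ m ∈ Finset.Icc 1 (k + 1),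
        1 / (∏ l ∈ (Finset.Icc 1 (k + 1)).erase m, (lam l - lam m)) *
          (exp (-(lam m) * s) * (-(lam m) * 1))) s := by
    refine HasDerivAt.const_mul _ (HasDerivAt.fun_sum fun m _ => HasDerivAt.const_mul _ ?_)
    exact ((hasDerivAt_id s).const_mul (-(lam m))).exp
  convert! h using 1
  have hP : ∏ j ∈ Finset.Icc 1 (k + 1 - 1), lam j =
      lam k * ∏ j ∈ Finset.Icc 1 (k - 1), lam j := by
    obtain ⟨k, rfl⟩ := Nat.exists_eq_add_of_le' hk
    rw [add_tsub_cancel_right, add_tsub_cancel_right, Finset.prod_Icc_succ_top (by lia), mul_comm]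
  -- The factor `lam (k + 1) - lam m` removes the term `m = k + 1` and cancels the new factor in
  -- every other denominator.
  have hE : ∑ m ∈ Finset.Icc 1 k, 1 / (∏ l ∈ (Finset.Icc 1 k).erase m, (lam l - lam m)) *
      exp (-(lam m) * s) = ∑ m ∈ Finset.Icc 1 (k + 1), (lam (k + 1) - lam m) *
      (1 / (∏ l ∈ (Finset.Icc 1 (k + 1)).erase m, (lam l - lam m)) * exp (-(lam m) * s)) := by
    rw [Finset.sum_Icc_succ_top (by lia), sub_self, zero_mul, add_zero]
    refine Finset.sum_congr rfl fun m hm => ?_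
    have hm := Finset.mem_Icc.1 hm
    have hne : lam (k + 1) - lam m ≠ 0 := fun h0 => by
      have := hinj _ _ (by lia) hm.1 (sub_eq_zero.1 h0)
      lia
    have hins : (Finset.Icc 1 (k + 1)).erase m = insert (k + 1) ((Finset.Icc 1 k).erase m) := by
      ext l
      simp only [Finset.mem_erase, Finset.mem_Icc, Finset.mem_insert]
      lia
    rw [hins, Finset.prod_insert (by simp), ← mul_assoc]
    congr 1
    rw [mul_one_div, ← div_div, div_self hne]
  unfold explicitClassicalProb
  rw [hE, hP]
  simp only [mul_assoc (lam k), Finset.mul_sum]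
  rw [← Finset.sum_add_distrib]
  refine Finset.sum_congr rfl fun m _ => ?_
  ring

theorem birthProb_eq_explicitClassicalProb
    (hinj : ∀ i j : ℕ, 1 ≤ i → 1 ≤ j → lam i = lam j → i = j) {k : ℕ} (hk : 1 ≤ k) :
    birthProb lam k = explicitClassicalProb lam k := by
  induction k, hk using Nat.le_induction with
  | base =>
    funext s
    have : birthProb lam 0 = fun _ => 0 := rfl
    rw [birthProb_succ]
    simp [explicitClassicalProb, this]
  | succ k hk ih =>
    -- Both functions solve the same linear equation, so with the integrating factor their
    -- difference is constant; it vanishes at `0` by the Lagrange identity.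
    have hd : ∀ s, HasDerivAt (fun s => exp (lam (k + 1) * s) *
        (birthProb lam (k + 1) s - explicitClassicalProb lam (k + 1) s)) 0 s := by
      intro s
      have h := ((hasDerivAt_id s).const_mul (lam (k + 1))).exp.mul
        ((hasDerivAt_birthProb lam (k + 1) s).sub (hasDerivAt_explicitClassicalProb hinj hk s))
      convert! h using 1
      rw [add_tsub_cancel_right, ih]
      simp only [Pi.sub_apply, id]
      ring
    have hz : birthProb lam (k + 1) 0 - explicitClassicalProb lam (k + 1) 0 = 0 := by
      rw [birthProb_succ_zero, if_neg (by lia), explicitClassicalProb]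
      simp only [mul_zero, exp_zero, mul_one]
      rw [sum_one_div_prod_sub_eq_zero (fun i hi j hj h => hinj i j
        (Finset.mem_Icc.1 hi).1 (Finset.mem_Icc.1 hj).1 h) (by simp; lia)]
      simp
    funext s
    have h := is_const_of_deriv_eq_zero (fun s => (hd s).differentiableAt)
      (fun s => (hd s).deriv) s 0
    rw [hz, mul_zero, mul_eq_zero] at h
    exact sub_eq_zero.1 (h.resolve_left (exp_pos _).ne')

theorem fractionalBirthProb_eq_explicitBirthProb (h0 : 0 < ν) (h1 : ν ≤ 1)
    (hlam : ∀ k, 1 ≤ k → 0 < lam k)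
    (hinj : ∀ i j : ℕ, 1 ≤ i → 1 ≤ j → lam i = lam j → i = j) {k : ℕ} (hk : 1 ≤ k) {t : ℝ}
    (ht : 0 ≤ t) : fractionalBirthProb ν lam k t = explicitBirthProb ν lam k t := by
  have hi : ∀ m, 1 ≤ m → Integrable (fun y => exp (-(lam m) * (t ^ ν * y))) (timeLaw ν) :=
    fun m hm => integrable_comp_timeLaw h0 h1 (q := fun s => exp (-(lam m) * s)) (C := 1)
      (by fun_prop) (fun s hs => by
        rw [abs_of_pos (exp_pos _), exp_le_one_iff, neg_mul, neg_nonpos]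
        exact mul_nonneg (hlam m hm).le hs) ht
  rw [fractionalBirthProb, birthProb_eq_explicitClassicalProb hinj hk]
  simp only [timeMean, pow_zero, one_mul, explicitClassicalProb, explicitBirthProb]
  rw [integral_const_mul, integral_finsetSum _ fun m hm =>
    (hi m (Finset.mem_Icc.1 hm).1).const_mul _]
  congr 1
  refine Finset.sum_congr rfl fun m _ => ?_
  rw [integral_const_mul, ← integral_exp_mul_timeLaw h0 h1]
  simp_rw [mul_assoc]

end ExplicitFormula

/-! ### State probabilities of the classical birth process -/

section ClassicalProcess

open Real Filter Topology

variable {lam : ℕ → ℝ}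

theorem lintegral_Ioc_ofReal {f : ℝ → ℝ} (hf : Continuous f) {a : ℝ} (ha : 0 ≤ a)
    (h0 : ∀ r ∈ Ioc 0 a, 0 ≤ f r) :
    ∫⁻ r in Ioc 0 a, ENNReal.ofReal (f r) = ENNReal.ofReal (∫ r in (0 : ℝ)..a, f r) := by
  rw [intervalIntegral.integral_of_le ha, ofReal_integral_eq_lintegral_ofReal]
  · exact (hf.intervalIntegrable 0 a).1
  · filter_upwards [ae_restrict_mem measurableSet_Ioc] with r hr using h0 r hr

/-- To be applied to the law of the `k`-th birth time: its density is minus the derivative of its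
tail. -/
theorem eq_withDensity_birthProb (hlam : ∀ k, 1 ≤ k → 0 < lam k) {k : ℕ} (hk : 1 ≤ k)
    {ρ : Measure ℝ} [IsProbabilityMeasure ρ]
    (h : ∀ s, 0 ≤ s → ρ (Ioi s) = ENNReal.ofReal (birthSum lam k s)) :
    ρ = (volume.restrict (Ioi 0)).withDensity
      fun r => ENNReal.ofReal (lam k * birthProb lam k r) := by
  have hc := continuous_birthProb lam k
  have hI : ∀ a, 0 ≤ a → ρ (Iic a) = ENNReal.ofReal (1 - birthSum lam k a) := by
    intro a ha
    rw [← compl_Ioi, prob_compl_eq_one_sub measurableSet_Ioi, h a ha, ENNReal.ofReal_sub _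
      (birthSum_nonneg hlam k ha), ENNReal.ofReal_one]
  have h0 : birthSum lam k 0 = 1 := by
    obtain ⟨k, rfl⟩ := Nat.exists_eq_add_of_le' hk
    exact sum_birthProb_zero lam k
  refine Measure.ext_of_Iic _ _ fun a => ?_
  rw [withDensity_apply _ measurableSet_Iic, Measure.restrict_restrict measurableSet_Iic,
    inter_comm, Ioi_inter_Iic]
  rcases lt_or_ge a 0 with ha | ha
  · rw [Ioc_eq_empty (not_lt.2 ha.le), Measure.restrict_empty, lintegral_zero_measure]
    refine measure_mono_null (Iic_subset_Iic.2 ha.le) ?_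
    rw [hI 0 le_rfl, h0, sub_self, ENNReal.ofReal_zero]
  · rw [hI a ha, lintegral_Ioc_ofReal (by fun_prop) ha fun r hr =>
      mul_nonneg (hlam k hk).le (birthProb_nonneg hlam k hr.1.le)]
    have := intervalIntegral.integral_eq_sub_of_hasDerivAt (a := 0) (b := a)
      (fun s _ => hasDerivAt_birthSum lam k s)
      ((continuous_const.mul hc).intervalIntegrable 0 a)
    simp only [neg_mul, intervalIntegral.integral_neg] at this
    rw [h0] at this
    congr 1
    linarith

theorem expMeasure_Ioi {r : ℝ} (hr : 0 < r) {x : ℝ} (hx : 0 ≤ x) :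
    expMeasure r (Ioi x) = ENNReal.ofReal (exp (-(r * x))) := by
  have := isProbabilityMeasure_expMeasure hr
  rw [← compl_Iic, prob_compl_eq_one_sub measurableSet_Iic, ← ofReal_cdf, cdf_expMeasure_eq hr,
    if_pos hx, ← ENNReal.ofReal_one, ← ENNReal.ofReal_sub _ (by
      rw [sub_nonneg, exp_le_one_iff]; nlinarith)]
  congr 1
  ring

theorem measurableSet_le_lt_add (s : ℝ) :
    MeasurableSet {z : ℝ × ℝ | z.1 ≤ s ∧ s < z.1 + z.2} :=
  (measurableSet_le measurable_fst measurable_const).inter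
    (measurableSet_lt measurable_const (measurable_fst.add measurable_snd))

/-- Conditioning on the `k`-th birth time `r ≤ s`, the next holding time must exceed `s - r`. This
yields exactly the integral in the recursion defining `birthProb`. -/
theorem prod_expMeasure_birthProb (hlam : ∀ k, 1 ≤ k → 0 < lam k) {k : ℕ} (hk : 1 ≤ k) {s : ℝ}
    (hs : 0 ≤ s) :
    (((volume.restrict (Ioi 0)).withDensity
      fun r => ENNReal.ofReal (lam k * birthProb lam k r)).prod (expMeasure (lam (k + 1))))
      {z : ℝ × ℝ | z.1 ≤ s ∧ s < z.1 + z.2} = ENNReal.ofReal (birthProb lam (k + 1) s) := by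
  have hl := hlam (k + 1) (by lia)
  have := isProbabilityMeasure_expMeasure hl
  have hc := continuous_birthProb lam k
  have he : ∀ r, expMeasure (lam (k + 1)) (Prod.mk r ⁻¹' {z : ℝ × ℝ | z.1 ≤ s ∧ s < z.1 + z.2}) =
      (Iic s).indicator (fun r => ENNReal.ofReal (exp (-(lam (k + 1) * (s - r))))) r := by
    intro r
    by_cases hr : r ≤ s
    · rw [indicator_of_mem (mem_Iic.2 hr), ← expMeasure_Ioi hl (sub_nonneg.2 hr)]
      congr 1
      ext y
      simp [hr, sub_lt_iff_lt_add']
    · rw [indicator_of_notMem (by simpa using hr)]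
      simp [hr]
  rw [Measure.prod_apply (measurableSet_le_lt_add s)]
  simp_rw [he]
  rw [lintegral_withDensity_eq_lintegral_mul _ (by fun_prop)
    (Measurable.indicator (by fun_prop) measurableSet_Iic)]
  have e2 : ∀ r, ((fun r => ENNReal.ofReal (lam k * birthProb lam k r)) *
      fun r => (Iic s).indicator (fun r => ENNReal.ofReal (exp (-(lam (k + 1) * (s - r))))) r) r =
      (Iic s).indicator (fun r => ENNReal.ofReal (lam k * birthProb lam k r) *
        ENNReal.ofReal (exp (-(lam (k + 1) * (s - r))))) r := by
    intro r
    by_cases hr : r ∈ Iic s <;> simp [hr]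
  simp_rw [e2]
  rw [lintegral_indicator measurableSet_Iic, Measure.restrict_restrict measurableSet_Iic,
    inter_comm, Ioi_inter_Iic]
  simp_rw [← ENNReal.ofReal_mul' (exp_pos _).le]
  rw [lintegral_Ioc_ofReal (by fun_prop) hs fun r hr => mul_nonneg
    (mul_nonneg (hlam k hk).le (birthProb_nonneg hlam k hr.1.le)) (exp_pos _).le, birthProb_succ,
    if_neg (by lia)]
  simp only [zero_add]
  rw [← intervalIntegral.integral_const_mul]
  congr 1
  refine intervalIntegral.integral_congr fun r _ => ?_
  rw [show -(lam (k + 1) * (s - r)) = -(lam (k + 1) * s) + lam (k + 1) * r by ring, exp_add]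
  ring

theorem birthProcess_eq_succ_iff {Ω : Type*} {τ : ℕ → Ω → ℝ} {ω : Ω} (hω : ∀ n, 0 < τ n ω) (k : ℕ) {s : ℝ} (hs : 0 ≤ s) :
    birthProcess τ s ω = ((k + 1 : ℕ) : ℕ∞) ↔
      ∑ i ∈ Finset.range k, τ i ω ≤ s ∧ s < ∑ i ∈ Finset.range (k + 1), τ i ω := by
  have hmono : StrictMono fun n => ∑ i ∈ Finset.range n, τ i ω :=
    strictMono_nat_of_lt_succ fun n => by
      rw [Finset.sum_range_succ]; linarith [hω n]
  have key : ∀ j, ∑ i ∈ Finset.range j, τ i ω ≤ s → s < ∑ i ∈ Finset.range (j + 1), τ i ω →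
      {n : ℕ | ∑ i ∈ Finset.range (n + 1), τ i ω ≤ s}.encard = j := by
    intro j h1 h2
    have e : {n : ℕ | ∑ i ∈ Finset.range (n + 1), τ i ω ≤ s} = (Finset.range j : Set ℕ) := by
      ext n
      simp only [mem_ofPred_eq, Finset.coe_range, mem_Iio]
      constructor
      · intro h
        have := hmono.lt_iff_lt.1 (h.trans_lt h2)
        lia
      · intro h
        exact (hmono.monotone (show n + 1 ≤ j by lia)).trans h1
    rw [e, encard_coe_eq_coe_finsetCard, Finset.card_range]
  have hb : birthProcess τ s ω = ((k + 1 : ℕ) : ℕ∞) ↔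
      {n : ℕ | ∑ i ∈ Finset.range (n + 1), τ i ω ≤ s}.encard = k := by
    rw [birthProcess, Nat.cast_add, Nat.cast_one, add_comm]
    exact WithTop.add_right_inj ENat.one_ne_top |>.trans Iff.rfl
  rw [hb]
  refine ⟨fun h => ?_, fun h => key k h.1 h.2⟩
  -- Otherwise infinitely many births have occurred by time `s` and the process is at `⊤`. The least
  -- such `n` is the number of births.
  have hex : ∃ n, s < ∑ i ∈ Finset.range (n + 1), τ i ω := by
    by_contra! hall
    have : {n : ℕ | ∑ i ∈ Finset.range (n + 1), τ i ω ≤ s} = univ := eq_univ_of_forall hall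
    rw [this, encard_univ, ENat.card_eq_top_of_infinite] at h
    exact ENat.top_ne_natCast k h
  classical
  have h2 := Nat.find_spec hex
  have h1 : ∑ i ∈ Finset.range (Nat.find hex), τ i ω ≤ s := by
    rcases Nat.eq_zero_or_pos (Nat.find hex) with h0 | h0
    · simpa [h0] using hs
    · obtain ⟨j, hj⟩ := Nat.exists_eq_add_of_le' h0
      have := Nat.find_min hex (m := j) (by lia)
      rw [hj]
      exact not_lt.1 this
  have h3 := key _ h1 h2
  rw [h] at h3
  have h4 : k = Nat.find hex := by exact_mod_cast h3
  rw [h4]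
  exact ⟨h1, h2⟩

theorem birthProcess_ne_zero {Ω : Type*} (τ : ℕ → Ω → ℝ) (s : ℝ) (ω : Ω) : birthProcess τ s ω ≠ 0 := by
  simp [birthProcess]

variable {Ω : Type*} [MeasurableSpace Ω] {P : Measure Ω} {τ : ℕ → Ω → ℝ}

theorem IsHoldingTimes.ae_pos (h : IsHoldingTimes lam P τ) (hlam : ∀ k, 1 ≤ k → 0 < lam k) :
    ∀ᵐ ω ∂P, ∀ n, 0 < τ n ω := by
  rw [ae_all_iff]
  intro n
  have hl := hlam (n + 1) (by lia)
  have := isProbabilityMeasure_expMeasure hl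
  have h1 : ∀ᵐ x ∂(P.map (τ n)), x ∈ Ioi (0 : ℝ) := by
    rw [h.law n]
    refine (mem_ae_iff_prob_eq_one measurableSet_Ioi).2 ?_
    rw [expMeasure_Ioi hl le_rfl]
    simp
  exact ae_of_ae_map (h.measurable n).aemeasurable h1

theorem IsHoldingTimes.measurable_sum (h : IsHoldingTimes lam P τ) (k : ℕ) :
    Measurable fun ω => ∑ i ∈ Finset.range k, τ i ω :=
  Finset.measurable_fun_sum _ fun i _ => h.measurable i

/-- One half of an alternating induction: the tail of the `k`-th birth time gives the probability of
state `k + 1`, which in turn gives the next tail in `measure_tail`. For `k = 0` the birth time is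
`0` and has no density, hence the separate case. -/
theorem IsHoldingTimes.measure_between_of_tail [IsProbabilityMeasure P]
    (h : IsHoldingTimes lam P τ) (hlam : ∀ k, 1 ≤ k → 0 < lam k) (k : ℕ)
    (hk : ∀ s, 0 ≤ s → P {ω | s < ∑ i ∈ Finset.range k, τ i ω} =
      ENNReal.ofReal (birthSum lam k s)) {s : ℝ} (hs : 0 ≤ s) :
    P {ω | ∑ i ∈ Finset.range k, τ i ω ≤ s ∧ s < ∑ i ∈ Finset.range (k + 1), τ i ω} =
      ENNReal.ofReal (birthProb lam (k + 1) s) := by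
  rcases Nat.eq_zero_or_pos k with rfl | hk0
  · have e : {ω | ∑ i ∈ Finset.range 0, τ i ω ≤ s ∧ s < ∑ i ∈ Finset.range (0 + 1), τ i ω} =
        τ 0 ⁻¹' Ioi s := by
      ext ω; simp [hs]
    have h0 : birthProb lam 0 = fun _ => 0 := rfl
    rw [e, ← Measure.map_apply (h.measurable 0) measurableSet_Ioi, h.law 0,
      expMeasure_Ioi (hlam _ (by lia)) hs, birthProb_succ, h0]
    simp
  · have hS := h.measurable_sum k
    have hp : IsProbabilityMeasure (P.map fun ω => ∑ i ∈ Finset.range k, τ i ω) :=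
      Measure.isProbabilityMeasure_map hS.aemeasurable
    have hρ := eq_withDensity_birthProb hlam hk0
      (ρ := P.map fun ω => ∑ i ∈ Finset.range k, τ i ω) fun s hs => by
        rw [Measure.map_apply hS measurableSet_Ioi]; exact hk s hs
    have hind : IndepFun (fun ω => ∑ i ∈ Finset.range k, τ i ω) (τ k) P := by
      have := h.indep.indepFun_sum_range_succ h.measurable k
      convert! this using 1
      ext ω
      simp
    have hjoint := (indepFun_iff_map_prod_eq_prod_map_map hS.aemeasurable
      (h.measurable k).aemeasurable).1 hind
    rw [hρ, h.law k] at hjoint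
    rw [← prod_expMeasure_birthProb hlam hk0 hs, ← hjoint, Measure.map_apply
      (hS.prodMk (h.measurable k)) (measurableSet_le_lt_add s)]
    congr 1
    ext ω
    simp [Finset.sum_range_succ]

theorem IsHoldingTimes.measure_tail [IsProbabilityMeasure P]
    (h : IsHoldingTimes lam P τ) (hlam : ∀ k, 1 ≤ k → 0 < lam k) (k : ℕ) {s : ℝ} (hs : 0 ≤ s) :
    P {ω | s < ∑ i ∈ Finset.range k, τ i ω} = ENNReal.ofReal (birthSum lam k s) := by
  induction k generalizing s with
  | zero => simp [birthSum, birthProb, not_lt.2 hs]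
  | succ k ih =>
    have hb := h.measure_between_of_tail hlam k (fun s hs => ih hs) hs
    -- Either the `k`-th birth is already later than `s`, or `s` lies between two consecutive
    -- births. Equality is almost sure because it uses positivity of the holding times.
    have e : {ω | s < ∑ i ∈ Finset.range (k + 1), τ i ω} =ᵐ[P]
        ({ω | s < ∑ i ∈ Finset.range k, τ i ω} ∪
          {ω | ∑ i ∈ Finset.range k, τ i ω ≤ s ∧ s < ∑ i ∈ Finset.range (k + 1), τ i ω} :
          Set Ω) := by
      filter_upwards [h.ae_pos hlam] with ω hω
      refine propext ⟨fun h1 => ?_, fun h1 => ?_⟩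
      · rcases lt_or_ge s (∑ i ∈ Finset.range k, τ i ω) with h2 | h2
        · exact Or.inl h2
        · exact Or.inr ⟨h2, h1⟩
      · rcases h1 with h1 | h1
        · have h1 : s < ∑ i ∈ Finset.range k, τ i ω := h1
          have := hω k
          change s < ∑ i ∈ Finset.range (k + 1), τ i ω
          rw [Finset.sum_range_succ]
          linarith
        · exact h1.2
    rw [measure_congr e, measure_union, ih hs, hb, ← ENNReal.ofReal_add
      (birthSum_nonneg hlam k hs) (birthProb_nonneg hlam _ hs), birthSum, birthSum,
      Finset.sum_range_succ _ (k + 1)]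
    · exact Set.disjoint_left.2 fun ω h1 h2 => not_lt.2 h2.1 h1
    · exact (measurableSet_le (h.measurable_sum k) measurable_const).inter
        (measurableSet_lt measurable_const (h.measurable_sum (k + 1)))

theorem IsHoldingTimes.measure_birthProcess_eq [IsProbabilityMeasure P]
    (h : IsHoldingTimes lam P τ) (hlam : ∀ k, 1 ≤ k → 0 < lam k) (k : ℕ) {s : ℝ} (hs : 0 ≤ s) :
    P {ω | birthProcess τ s ω = (k : ℕ∞)} = ENNReal.ofReal (birthProb lam k s) := by
  cases k with
  | zero => simp [birthProcess_ne_zero, birthProb]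
  | succ k =>
    rw [← h.measure_between_of_tail hlam k (fun s hs => h.measure_tail hlam k hs) hs]
    refine measure_congr ?_
    filter_upwards [h.ae_pos hlam] with ω hω
    exact propext (birthProcess_eq_succ_iff hω k hs)

end ClassicalProcess

/-! ### The birth process at the random time -/

section SubordinatedProcess

open Real Filter Topology

/-- Joint measurability in the holding times and the time, so that a random time may be substituted
and Fubini applied. -/
theorem measurable_birthProcess :
    Measurable fun z : (ℕ → ℝ) × ℝ => birthProcess (fun n x => x n) z.2 z.1 := by
  have h : Measurable fun z : (ℕ → ℝ) × ℝ =>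
      {n : ℕ | ∑ i ∈ Finset.range (n + 1), z.1 i ≤ z.2}.encard :=
    measurable_encard.comp (measurable_set_iff.2 fun n => measurableSet_setOfPred.1 (measurableSet_le
      (Finset.measurable_fun_sum _ fun i _ => (measurable_pi_apply i).comp measurable_fst)
      measurable_snd))
  exact (Measurable.of_discrete (f := fun x : ℕ∞ => 1 + x)).comp h

theorem birthProcess_eq_comp {Ω : Type*} (τ : ℕ → Ω → ℝ) (s : ℝ) (ω : Ω) :
    birthProcess τ s ω = birthProcess (fun n x => x n) s (fun n => τ n ω) := rfl

/-- The mass at `⊤` is the defect of the finite states, so the birth equations determine the whole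
law, explosion included. -/
theorem ENat.measure_ext {ρ σ : Measure ℕ∞} [IsProbabilityMeasure ρ] [IsProbabilityMeasure σ]
    (h : ∀ k : ℕ, ρ {(k : ℕ∞)} = σ {(k : ℕ∞)}) : ρ = σ := by
  refine Measure.ext_of_singleton fun x => ?_
  induction x using ENat.recTopCoe with
  | top =>
    have e : ({⊤} : Set ℕ∞) = (⋃ k : ℕ, {(k : ℕ∞)})ᶜ := by
      ext x
      induction x using ENat.recTopCoe <;> simp
    have hd : Pairwise (Function.onFun Disjoint fun k : ℕ => ({(k : ℕ∞)} : Set ℕ∞)) :=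
      fun i j hij => by simpa using hij
    rw [e, prob_compl_eq_one_sub .of_discrete, prob_compl_eq_one_sub .of_discrete,
      measure_iUnion hd fun _ => .of_discrete, measure_iUnion hd fun _ => .of_discrete]
    simp_rw [h]
  | coe k => exact h k

variable {ν : ℝ} {lam : ℕ → ℝ}

theorem ae_randomLaw_nonneg (ν : ℝ) {t : ℝ} (ht : 0 ≤ t) : ∀ᵐ s ∂(randomLaw ν t), 0 ≤ s := by
  rw [randomLaw, ae_map_iff (p := fun s => 0 ≤ s) (by fun_prop) measurableSet_Ici]
  filter_upwards [ae_timeLaw_pos ν] with y hy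
  positivity

theorem integrable_birthProb_randomLaw (h0 : 0 < ν) (h1 : ν ≤ 1)
    (hlam : ∀ k, 1 ≤ k → 0 < lam k) (k : ℕ) {t : ℝ} (ht : 0 ≤ t) :
    Integrable (birthProb lam k) (randomLaw ν t) := by
  rw [randomLaw, integrable_map_measure (continuous_birthProb lam k).aestronglyMeasurable
    (by fun_prop)]
  exact integrable_comp_timeLaw h0 h1 (continuous_birthProb lam k)
    (fun s hs => abs_birthProb_le hlam k hs) ht

theorem integral_birthProb_randomLaw (k : ℕ) (t : ℝ) :
    ∫ s, birthProb lam k s ∂(randomLaw ν t) = fractionalBirthProb ν lam k t :=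
  integral_randomLaw (continuous_birthProb lam k).measurable

section

variable {Ω : Type*} [MeasurableSpace Ω] {P : Measure Ω} {τ : ℕ → Ω → ℝ} {T : ℝ → Ω → ℝ}

theorem measurable_subordinated (h : IsHoldingTimes lam P τ)
    (hT : IsIndependentRandomTime (randomLaw ν) P τ T) {t : ℝ} (ht : 0 ≤ t) :
    Measurable fun ω => birthProcess τ (T t ω) ω := by
  have h2 : Measurable fun ω => (fun n => τ n ω, T t ω) :=
    (measurable_pi_iff.2 fun n => h.measurable n).prodMk (hT.measurable t ht)
  have e : (fun ω => birthProcess τ (T t ω) ω) =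
      (fun z : (ℕ → ℝ) × ℝ => birthProcess (fun n x => x n) z.2 z.1) ∘
        fun ω => (fun n => τ n ω, T t ω) :=
    funext fun ω => birthProcess_eq_comp τ (T t ω) ω
  rw [e]
  exact measurable_birthProcess.comp h2

variable [IsProbabilityMeasure P]

theorem IsHoldingTimes.subordination (h : IsHoldingTimes lam P τ) (h0 : 0 < ν) (h1 : ν ≤ 1)
    (hlam : ∀ k, 1 ≤ k → 0 < lam k) (k : ℕ) {t : ℝ} (ht : 0 ≤ t) :
    Integrable (fun s => P.real {ω | birthProcess τ s ω = (k : ℕ∞)}) (randomLaw ν t) ∧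
    fractionalBirthProb ν lam k t =
      ∫ s, P.real {ω | birthProcess τ s ω = (k : ℕ∞)} ∂(randomLaw ν t) := by
  have hae : birthProb lam k =ᵐ[randomLaw ν t]
      fun s => P.real {ω | birthProcess τ s ω = (k : ℕ∞)} := by
    filter_upwards [ae_randomLaw_nonneg ν ht] with s hs
    rw [Measure.real, h.measure_birthProcess_eq hlam k hs,
      ENNReal.toReal_ofReal (birthProb_nonneg hlam k hs)]
  exact ⟨(integrable_birthProb_randomLaw h0 h1 hlam k ht).congr hae,
    by rw [← integral_congr_ae hae, integral_birthProb_randomLaw]⟩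

/-- By independence the joint law of holding times and random time is a product; its sections at a
fixed time have the classical state probabilities as masses. -/
theorem measure_subordinated_eq (h : IsHoldingTimes lam P τ)
    (hT : IsIndependentRandomTime (randomLaw ν) P τ T) (h0 : 0 < ν) (h1 : ν ≤ 1)
    (hlam : ∀ k, 1 ≤ k → 0 < lam k) (k : ℕ) {t : ℝ} (ht : 0 ≤ t) :
    P {ω | birthProcess τ (T t ω) ω = (k : ℕ∞)} =
      ENNReal.ofReal (fractionalBirthProb ν lam k t) := by
  have := isProbabilityMeasure_timeLaw h0 h1
  have hτ : Measurable fun ω n => τ n ω := measurable_pi_iff.2 fun n => h.measurable n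
  have hj := (indepFun_iff_map_prod_eq_prod_map_map hτ.aemeasurable
    (hT.measurable t ht).aemeasurable).1 (hT.indep t ht)
  have hS : MeasurableSet ((fun z : (ℕ → ℝ) × ℝ => birthProcess (fun n x => x n) z.2 z.1) ⁻¹'
      {(k : ℕ∞)}) := measurable_birthProcess (.of_discrete)
  have e : P {ω | birthProcess τ (T t ω) ω = (k : ℕ∞)} =
      (P.map fun ω => (fun n => τ n ω, T t ω))
        ((fun z : (ℕ → ℝ) × ℝ => birthProcess (fun n x => x n) z.2 z.1) ⁻¹' {(k : ℕ∞)}) := by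
    rw [Measure.map_apply (hτ.prodMk (hT.measurable t ht)) hS]
    rfl
  have : IsProbabilityMeasure (P.map fun ω n => τ n ω) :=
    Measure.isProbabilityMeasure_map hτ.aemeasurable
  rw [e, hj, hT.law t ht, Measure.prod_apply_symm hS, ← integral_birthProb_randomLaw,
    ofReal_integral_eq_lintegral_ofReal (integrable_birthProb_randomLaw h0 h1 hlam k ht)]
  · refine lintegral_congr_ae ?_
    filter_upwards [ae_randomLaw_nonneg ν ht] with s hs
    have hSs : MeasurableSet ((fun x : ℕ → ℝ => (x, s)) ⁻¹'
        ((fun z : (ℕ → ℝ) × ℝ => birthProcess (fun n x => x n) z.2 z.1) ⁻¹' {(k : ℕ∞)})) :=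
      hS.preimage (measurable_id.prodMk measurable_const)
    rw [← h.measure_birthProcess_eq hlam k hs, Measure.map_apply hτ hSs]
    rfl
  · filter_upwards [ae_randomLaw_nonneg ν ht] with s hs using birthProb_nonneg hlam k hs

theorem SolvesFractionalBirth.congr {p q : ℕ → ℝ → ℝ} (hp : SolvesFractionalBirth ν lam p)
    (h : ∀ k t, 0 ≤ t → q k t = p k t) : SolvesFractionalBirth ν lam q where
  zero t ht := by rw [h 0 t ht, hp.zero t ht]
  initial k hk := by rw [h k 0 le_rfl, hp.initial k hk]
  equation k hk := (hp.equation k hk).congr (fun t ht => h k t ht) fun t ht => by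
    rw [h k t ht.le, h (k - 1) t ht.le]

theorem isFractionalBirthProcess_subordinated (h : IsHoldingTimes lam P τ)
    (hT : IsIndependentRandomTime (randomLaw ν) P τ T) (h0 : 0 < ν) (h1 : ν ≤ 1)
    (hlam : ∀ k, 1 ≤ k → 0 < lam k) :
    IsFractionalBirthProcess ν lam P fun t ω => birthProcess τ (T t ω) ω where
  measurable t ht := measurable_subordinated h hT ht
  law := (solvesFractionalBirth_fractionalBirthProb h0 h1 hlam).congr fun k t ht => by
    rw [Measure.real, measure_subordinated_eq h hT h0 h1 hlam k ht,
      ENNReal.toReal_ofReal (fractionalBirthProb_nonneg hlam k ht)]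

theorem IsFractionalBirthProcess.measure_eq {X : ℝ → Ω → ℕ∞}
    (hX : IsFractionalBirthProcess ν lam P X) (h0 : 0 < ν) (h1 : ν ≤ 1)
    (hlam : ∀ k, 1 ≤ k → 0 < lam k) (k : ℕ) {t : ℝ} (ht : 0 ≤ t) :
    P {ω | X t ω = (k : ℕ∞)} = ENNReal.ofReal (fractionalBirthProb ν lam k t) := by
  rw [← hX.law.eq_fractionalBirthProb h0 h1 hlam k ht, ofReal_measureReal]

theorem IsFractionalBirthProcess.identDistrib {X : ℝ → Ω → ℕ∞}
    (hX : IsFractionalBirthProcess ν lam P X) {Ω' : Type*} [MeasurableSpace Ω'] {P' : Measure Ω'}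
    [IsProbabilityMeasure P'] {Y : ℝ → Ω' → ℕ∞} (hY : IsFractionalBirthProcess ν lam P' Y)
    (h0 : 0 < ν) (h1 : ν ≤ 1) (hlam : ∀ k, 1 ≤ k → 0 < lam k) {t : ℝ} (ht : 0 ≤ t) :
    IdentDistrib (X t) (Y t) P P' where
  aemeasurable_fst := (hX.measurable t ht).aemeasurable
  aemeasurable_snd := (hY.measurable t ht).aemeasurable
  map_eq := by
    have := Measure.isProbabilityMeasure_map (hX.measurable t ht).aemeasurable (μ := P)
    have := Measure.isProbabilityMeasure_map (hY.measurable t ht).aemeasurable (μ := P')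
    refine ENat.measure_ext fun k => ?_
    rw [Measure.map_apply (hX.measurable t ht) .of_discrete,
      Measure.map_apply (hY.measurable t ht) .of_discrete]
    exact (hX.measure_eq h0 h1 hlam k ht).trans (hY.measure_eq h0 h1 hlam k ht).symm

theorem IsFractionalBirthProcess.measure_lt_top_eq_one_iff {X : ℝ → Ω → ℕ∞}
    (hX : IsFractionalBirthProcess ν lam P X) (h0 : 0 < ν) (h1 : ν ≤ 1)
    (hlam : ∀ k, 1 ≤ k → 0 < lam k) {t : ℝ} (ht : 0 ≤ t) :
    P {ω | X t ω < ⊤} = 1 ↔ HasSum (fun k => fractionalBirthProb ν lam (k + 1) t) 1 := by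
  have hp := fun k => fractionalBirthProb_nonneg (ν := ν) hlam (k + 1) ht
  have e : {ω | X t ω < ⊤} = ⋃ k : ℕ, {ω | X t ω = (k : ℕ∞)} := by
    ext ω
    simp only [mem_ofPred_eq, mem_iUnion]
    rw [lt_top_iff_ne_top, ENat.ne_top_iff_exists]
    exact exists_congr fun k => eq_comm
  have hsum : P {ω | X t ω < ⊤} =
      ∑' k : ℕ, ENNReal.ofReal (fractionalBirthProb ν lam (k + 1) t) := by
    rw [e, measure_iUnion]
    · simp_rw [hX.measure_eq h0 h1 hlam _ ht]
      rw [tsum_eq_zero_add' ENNReal.summable,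
        (solvesFractionalBirth_fractionalBirthProb h0 h1 hlam).zero t ht, ENNReal.ofReal_zero,
        zero_add]
    · intro i j hij
      refine Set.disjoint_left.2 fun ω h1 h2 => hij ?_
      have h1 : X t ω = (i : ℕ∞) := h1
      have h2 : X t ω = (j : ℕ∞) := h2
      exact_mod_cast h1.symm.trans h2
    · exact fun k => hX.measurable t ht (MeasurableSet.of_discrete (s := {(k : ℕ∞)}))
  rw [hsum]
  constructor
  · intro h
    have hs := ENNReal.summable_toReal (h.trans_ne ENNReal.one_ne_top)
    simp_rw [ENNReal.toReal_ofReal (hp _)] at hs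
    rw [← ENNReal.ofReal_tsum_of_nonneg hp hs, ENNReal.ofReal_eq_one] at h
    exact h ▸ hs.hasSum
  · intro h
    rw [← ENNReal.ofReal_tsum_of_nonneg hp h.summable, h.tsum_eq, ENNReal.ofReal_one]

end

theorem exists_isIndependentRandomTime (h0 : 0 < ν) (h1 : ν ≤ 1)
    (hlam : ∀ k, 1 ≤ k → 0 < lam k) :
    ∃ (Ω : Type) (_ : MeasurableSpace Ω) (P : Measure Ω) (τ : ℕ → Ω → ℝ) (T : ℝ → Ω → ℝ),
      IsProbabilityMeasure P ∧ IsHoldingTimes lam P τ ∧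
        IsIndependentRandomTime (randomLaw ν) P τ T := by
  have := isProbabilityMeasure_timeLaw h0 h1
  have hE : ∀ n : ℕ, IsProbabilityMeasure (expMeasure (lam (n + 1))) :=
    fun n => isProbabilityMeasure_expMeasure (hlam _ (by lia))
  set Q := Measure.infinitePi fun n : ℕ => expMeasure (lam (n + 1)) with hQ
  have hfst : (Q.prod (timeLaw ν)).map Prod.fst = Q := by simp
  have hsnd : (Q.prod (timeLaw ν)).map Prod.snd = timeLaw ν := by simp
  have hlaw : ∀ n : ℕ, (Q.prod (timeLaw ν)).map (fun ω => ω.1 n) = expMeasure (lam (n + 1)) := by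
    intro n
    rw [show (fun ω : (ℕ → ℝ) × ℝ => ω.1 n) = (fun x => x n) ∘ Prod.fst from rfl,
      ← Measure.map_map (measurable_pi_apply n) measurable_fst, hfst, hQ,
      Measure.infinitePi_map_eval]
  -- A single variable `ω.2` with law `timeLaw ν` serves all times as `t ^ ν * ω.2`; only the
  -- one-dimensional laws of the random time are prescribed.
  refine ⟨(ℕ → ℝ) × ℝ, inferInstance, Q.prod (timeLaw ν), fun n ω => ω.1 n,
    fun t ω => t ^ ν * ω.2, inferInstance, ⟨fun n => by fun_prop, ?_, hlaw⟩,
    ⟨fun t _ => by fun_prop, fun t _ => ?_, fun t _ => ?_⟩⟩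
  · rw [iIndepFun_iff_map_fun_eq_infinitePi_map (fun n => by fun_prop)]
    simp_rw [hlaw]
    exact hfst
  · rw [show (fun ω : (ℕ → ℝ) × ℝ => t ^ ν * ω.2) = (fun y => t ^ ν * y) ∘ Prod.snd from rfl,
      ← Measure.map_map (by fun_prop) measurable_snd, hsnd, randomLaw]
  · exact indepFun_prod (X := fun x : ℕ → ℝ => x) (Y := fun y : ℝ => t ^ ν * y)
      measurable_id (by fun_prop)

end SubordinatedProcess

theorem mainTheorem6 (ν : ℝ) (hν0 : 0 < ν) (hν1 : ν ≤ 1)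
    (lam : ℕ → ℝ) (hlam : ∀ k : ℕ, 1 ≤ k → 0 < lam k) :
    ∃ (u : ℝ → SignedMeasure ℝ) (m : ℝ → Measure ℝ) (p : ℕ → ℝ → ℝ),
      -- `u` is the fundamental solution, `m t` is the law of the random time at `t`
      IsFundamentalSolution ν u ∧
      (∀ v : ℝ → SignedMeasure ℝ, IsFundamentalSolution ν v → ∀ t : ℝ, 0 ≤ t → v t = u t) ∧
      IsFoldedLaw u m ∧
      -- for `ν < 1` the law has a density, with the stated Laplace transform in time
      (ν < 1 → ∃ f : ℝ → ℝ → ℝ,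
        ContinuousOn (fun z : ℝ × ℝ => f z.1 z.2) (Ioi 0 ×ˢ Ioi 0) ∧
        (∀ s t : ℝ, 0 < s → 0 < t → 0 ≤ f s t) ∧
        (∀ t : ℝ, 0 < t →
          m t = (volume.restrict (Ioi 0)).withDensity (fun s => ENNReal.ofReal (f s t))) ∧
        (∀ s μ : ℝ, 0 < s → 0 < μ →
          IntegrableOn (fun t => Real.exp (-(μ * t)) * f s t) (Ioi 0) ∧
          ∫ t in Ioi 0, Real.exp (-(μ * t)) * f s t = μ ^ (ν - 1) * Real.exp (-(s * μ ^ ν)))) ∧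
      -- for `ν = 1` the random time is the time itself
      (ν = 1 → ∀ t : ℝ, 0 < t → m t = Measure.dirac t) ∧
      -- the Laplace transform in time of the law, for every `ν`
      (∀ μ : ℝ, 0 < μ → ∀ B : Set ℝ, MeasurableSet B → B ⊆ Ioi 0 →
        IntegrableOn (fun t => Real.exp (-(μ * t)) * (m t).real B) (Ioi 0) ∧
        ∫ t in Ioi 0, Real.exp (-(μ * t)) * (m t).real B =
          ∫ s in B, μ ^ (ν - 1) * Real.exp (-(s * μ ^ ν))) ∧
      -- `p` is the solution of the fractional birth equations
      SolvesFractionalBirth ν lam p ∧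
      (∀ q : ℕ → ℝ → ℝ, SolvesFractionalBirth ν lam q → ∀ k : ℕ, ∀ t : ℝ, 0 ≤ t → q k t = p k t) ∧
      ((∀ i j : ℕ, 1 ≤ i → 1 ≤ j → lam i = lam j → i = j) →
        ∀ k : ℕ, 1 ≤ k → ∀ t : ℝ, 0 ≤ t → p k t = explicitBirthProb ν lam k t) ∧
      -- non-negativity and non-explosion
      (∀ k : ℕ, ∀ t : ℝ, 0 ≤ t → 0 ≤ p k t) ∧
      ((∀ t : ℝ, 0 < t → HasSum (fun k : ℕ => p (k + 1) t) 1) ↔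
        ¬ Summable (fun k : ℕ => 1 / lam (k + 1))) ∧
      -- the subordination formula for the state probabilities
      (∀ (Ω : Type*) [MeasurableSpace Ω] (P : Measure Ω) [IsProbabilityMeasure P]
        (τ : ℕ → Ω → ℝ), IsHoldingTimes lam P τ →
        ∀ k : ℕ, 1 ≤ k → ∀ t : ℝ, 0 < t →
          Integrable (fun s => P.real {ω | birthProcess τ s ω = (k : ℕ∞)}) (m t) ∧
          p k t = ∫ s, P.real {ω | birthProcess τ s ω = (k : ℕ∞)} ∂(m t)) ∧
      -- a birth process together with an independent random time exists
      (∃ (Ω : Type) (_ : MeasurableSpace Ω) (P : Measure Ω) (τ : ℕ → Ω → ℝ) (T : ℝ → Ω → ℝ),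
        IsProbabilityMeasure P ∧ IsHoldingTimes lam P τ ∧ IsIndependentRandomTime m P τ T) ∧
      -- the classical process at the random time is a fractional birth process
      (∀ (Ω : Type*) [MeasurableSpace Ω] (P : Measure Ω) [IsProbabilityMeasure P]
        (τ : ℕ → Ω → ℝ) (T : ℝ → Ω → ℝ), IsHoldingTimes lam P τ →
        IsIndependentRandomTime m P τ T →
        IsFractionalBirthProcess ν lam P (fun t ω => birthProcess τ (T t ω) ω)) ∧
      -- every fractional birth process has that representation in distribution
      (∀ (Ω : Type*) [MeasurableSpace Ω] (P : Measure Ω) [IsProbabilityMeasure P]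
        (τ : ℕ → Ω → ℝ) (T : ℝ → Ω → ℝ) (Ω' : Type*) [MeasurableSpace Ω']
        (P' : Measure Ω') [IsProbabilityMeasure P'] (X : ℝ → Ω' → ℕ∞),
        IsHoldingTimes lam P τ → IsIndependentRandomTime m P τ T →
        IsFractionalBirthProcess ν lam P' X →
        ∀ t : ℝ, 0 ≤ t → IdentDistrib (X t) (fun ω => birthProcess τ (T t ω) ω) P' P) ∧
      -- non-explosion of the process
      (∀ (Ω' : Type*) [MeasurableSpace Ω'] (P' : Measure Ω') [IsProbabilityMeasure P']
        (X : ℝ → Ω' → ℕ∞), IsFractionalBirthProcess ν lam P' X →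
        ((∀ t : ℝ, 0 < t → P' {ω | X t ω < ⊤} = 1) ↔
          ¬ Summable (fun k : ℕ => 1 / lam (k + 1)))) := by
  have := isProbabilityMeasure_timeLaw hν0 hν1
  refine ⟨fundamentalSolution ν, randomLaw ν, fractionalBirthProb ν lam,
    isFundamentalSolution_fundamentalSolution hν0 hν1, fun v hv t ht => hv.unique hν0 hν1 ht,
    isFoldedLaw_randomLaw hν0 hν1, fun h1 => ⟨timeDensity ν, continuousOn_timeDensity hν0 h1,
      fun s t hs ht => timeDensity_nonneg hν0 h1 hs ht,
      fun t ht => randomLaw_eq_withDensity h1 ht,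
      fun s μ hs hμ => ⟨integrableOn_exp_mul_timeDensity hν0 h1 hs hμ,
        laplace_timeDensity hν0 h1 hs hμ⟩⟩,
    fun h t _ => by rw [h, randomLaw_one],
    fun μ hμ B hB hB0 => laplace_randomLaw hν0 hν1 hμ hB hB0,
    solvesFractionalBirth_fractionalBirthProb hν0 hν1 hlam,
    fun q hq k t ht => hq.eq_fractionalBirthProb hν0 hν1 hlam k ht,
    fun hinj k hk t ht => fractionalBirthProb_eq_explicitBirthProb hν0 hν1 hlam hinj hk ht,
    fun k t ht => fractionalBirthProb_nonneg hlam k ht,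
    hasSum_fractionalBirthProb_iff hν0 hν1 hlam,
    fun Ω _ P _ τ hτ k _ t ht => hτ.subordination hν0 hν1 hlam k ht.le,
    exists_isIndependentRandomTime hν0 hν1 hlam,
    fun Ω _ P _ τ T hτ hT => isFractionalBirthProcess_subordinated hτ hT hν0 hν1 hlam,
    fun Ω _ P _ τ T Ω' _ P' _ X hτ hT hX t ht => hX.identDistrib
      (isFractionalBirthProcess_subordinated hτ hT hν0 hν1 hlam) hν0 hν1 hlam ht,
    fun Ω' _ P' _ X hX => ?_⟩
  rw [← hasSum_fractionalBirthProb_iff hν0 hν1 hlam]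
  exact forall₂_congr fun t ht => hX.measure_lt_top_eq_one_iff hν0 hν1 hlam ht.le
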